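/- **Setting.** Let $\mathcal S,\mathcal A$ be finite sets, $P(s'\mid s,a)$ transition probabilities, $r(s,a,s')$ rewards with $|r(s,a,s')|\le R_{\max}$, $R_{\max}>0$, $\gamma\in(0,1)$ a discount factor, $\beta(a\mid s)$ a behavior policy, $\phi(s,a)\in\mathbb R^h$ features with $\|\phi(s,a)\|_2\le1$, $\Phi$ the matrix with rows $\phi(s,a)^\top$, and $\eta>0$. Assume that the Markov chain $(S_k,A_k)_{k\ge0}$ on $\mathcal S\times\mathcal A$ with transition probabilities $P(s'\mid s,a)\beta(a'\mid s')$ is irreducible; let $d$ be its stationary distribution and $D=\mathrm{diag}(d)$. Fix a pair $z_0\in\mathcal S\times\mathcal A$, let $\tau=\inf\{n\ge1:(S_n,A_n)=z_0\}$ and $\tau_{\max}=\max_{z}\mathbb E[\tau\mid (S_0,A_0)=z]$. Put $$(Tq)(s,a)=\sum_{s'}P(s'\mid s,a)\bigl(r(s,a,s')+\gamma\max_u q(s',u)\bigr),\qquad \Gamma_\eta=\Phi(\Phi^\top D\Phi+\eta I)^{-1}\Phi^\top D,$$ let $x=\gamma\|\Gamma_\eta\|_\infty$ ($\|\cdot\|_\infty$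 of a matrix is the maximal absolute row sum) and assume $x<1$. Let $\mu_\eta=\lambda_{\min}(\Phi^\top D\Phi)+\eta$, $l_\eta=\lambda_{\max}(\Phi^\top D\Phi)+\eta$, $\kappa=l_\eta/\mu_\eta$. **Algorithm.** Given $\theta_0\in\mathbb R^h$, a step size $\alpha_0>0$ and $K\in\mathbb N$, put $\theta_{0,K}=\theta_0$ and, for $t\ge1$, $\theta_{t,0}=\theta_{t-1,K}$ and, for $0\le k<K$, $$\theta_{t,k+1}=\theta_{t,k}-\alpha_0\Bigl(-\bigl[r(s,a,s')+\gamma\max_u\phi(s',u)^\top\theta_{t-1,K}-\phi(s,a)^\top\theta_{t,k}\bigr]\phi(s,a)+\eta\,\theta_{t,k}\Bigr),$$ where $(s,a,s')=(S_n,A_n,S_{n+1})$ with $n=(t-1)K+k$ is read off a single trajectory of the chain with an arbitrary initial distribution. **Constants.** For $\theta^*_\eta\in\mathbb R^h$ let $\sigma_\eta^2=\max_{(s,a)}\mathbb E\bigl[\|(Y-\mathbb E[Y\mid s,a])\phi(s,a)\|_2^2\mid s,a\bigr]$ with $Y=r(s,a,s')+\gamma\max_u\phi(s',u)^\top\theta^*_\eta$,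 $s'\sim P(\cdot\mid s,a)$, and $$l_{V_1}=2\tau_{\max}(1+\eta),\quad l_{V_2}=\max\{2\tau_{\max}\gamma,1\},\quad l_{V_3}=\tau_{\max}\bigl(R_{\max}+(1+\gamma+\eta)\|\theta^*_\eta\|_2\bigr),$$ $$D_1=l_\eta(6l_{V_1}+l_{V_3})+\kappa l_{V_1}\gamma,\quad D_2=4\kappa l_{V_1}(1+l_\eta),\quad D_3=\kappa l_{V_1}+l_\eta l_{V_2},$$ $$g_1=16+16\eta,\quad g_2=(42+32\eta)\gamma^2,\quad g_3=32(1+\eta)\gamma^2\|\Phi\theta^*_\eta\|_\infty^2+(16+16\eta)R_{\max}^2+8\sigma_\eta^2,$$ $$\mathcal E_1=\bigl(D_1+\tfrac{l_\eta}2\bigr)g_2+D_3,\qquad \mathcal E_2=\bigl(D_1+\tfrac{l_\eta}2\bigr)g_3+2l_\eta l_{V_3},$$ and, for $\epsilon>0$, $$\bar\alpha_1=\frac{\mu_\eta}{(D_1+\frac{l_\eta}2)g_1+2D_2},\qquad \bar\alpha_2=\frac{\mu_\eta}{16l_\eta(6l_{V_1}+l_{V_3})(1+\eta)+24\kappa l_{V_1}(1+\eta)},$$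 $$\bar\alpha_3=\frac{\mu_\eta^2(1-x^2)^2}{8(1+x^2)\bigl(2\mu_\eta\mathcal E_1+4\mu_\eta(l_{V_1}\gamma\kappa+l_\eta l_{V_2})\bigr)},\qquad \bar\alpha_4=\frac{2\mu_\eta^2\,\epsilon\,\gamma^2(1-x^2)^2}{4(1+x^2)\bigl(\mathcal E_2+3l_\eta l_{V_3}\mu_\eta\bigr)},$$ $$\bar\alpha=\min\{\bar\alpha_1,\bar\alpha_2,\bar\alpha_3,\bar\alpha_4\},$$ $$\overline K=\max\Bigl\{\tfrac{l_\eta(6l_{V_1}+l_{V_3})(1+\eta)+\kappa l_{V_1}(1+\eta)}{\mu_\eta^2},\ \tfrac{2\mu_\eta\mathcal E_1+4\mu_\eta(l_{V_1}\kappa+l_\eta l_{V_2})}{\mu_\eta^3(1-x)^2},\ \tfrac{\mathcal E_2+\mu_\eta l_\eta l_{V_3}}{\epsilon\,\mu_\eta^3\gamma^2(1-x)^2}\Bigr\},$$ $$\Lambda_K=\ln\Bigl(2+\frac1{\mu_\eta}+\frac1{1-x}+\frac{\|\theta_0-\theta^*_\eta\|_2^2}{\epsilon}\Bigr),\qquad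 \Lambda_t=\ln\Bigl(2+\frac{\|\Phi(\theta_0-\theta^*_\eta)\|_\infty^2}{\epsilon}\Bigr).$$ **Theorem.** There are absolute constants $C,C'>0$ such that in every such setting the following holds. There is exactly one $\theta^*_\eta\in\mathbb R^h$ with $\theta^*_\eta=(\Phi^\top D\Phi+\eta I)^{-1}\Phi^\top D\,T\Phi\theta^*_\eta$. Moreover, with this $\theta^*_\eta$, for every $\theta_0\in\mathbb R^h$ and $\epsilon>0$: 1. if $0<\alpha_0\le\bar\alpha$, $K\ge\dfrac{C}{\mu_\eta\alpha_0}\Lambda_K$ and $t\ge\dfrac{C}{1-x}\Lambda_t$, then, for every trajectory of the chain, $\|\Phi(\theta_{t,K}-\theta^*_\eta)\|_\infty^2$ is integrable and $$\mathbb E\bigl[\|\Phi(\theta_{t,K}-\theta^*_\eta)\|_\infty^2\bigr]\le\epsilon;$$ 2. $\bar\alpha>0$, and for $\alpha_0=\bar\alpha$ the conditions in 1. on the integers $K$ and $t$ are met by some $$K\le C'\,\overline K\,\Lambda_K\qquad\text{and}\qquad t\le\frac{C'}{1-x}\,\Lambda_t .$$ -/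

import Mathlib

open MeasureTheory ProbabilityTheory
open scoped ENNReal

universe u v w

noncomputable section

/-- A finite discounted Markov decision process with a behaviour policy, linear features and
the regularization parameter of periodic regularized Q-learning. -/
structure RegLinearMDP (S : Type u) (A : Type v) [Fintype S] [Fintype A] (h : ℕ) where
  /-- transition probabilities `P s a s'` -/
  P : S → A → S → ℝ
  P_nonneg : ∀ s a s', 0 ≤ P s a s'
  P_sum : ∀ s a, ∑ s', P s a s' = 1
  /-- reward of a transition -/
  r : S → A → S → ℝ
  /-- behaviour policy `pol s a` -/
  pol : S → A → ℝ
  pol_nonneg : ∀ s a, 0 ≤ pol s a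
  pol_sum : ∀ s, ∑ a, pol s a = 1
  /-- feature vectors of state-action pairs -/
  feat : S × A → EuclideanSpace ℝ (Fin h)
  /-- discount factor -/
  γ : ℝ
  γ_pos : 0 < γ
  γ_lt_one : γ < 1
  /-- regularization parameter -/
  η : ℝ
  η_pos : 0 < η

namespace RegLinearMDP

variable {S : Type u} {A : Type v} [Fintype S] [Fintype A] {h : ℕ} (M : RegLinearMDP S A h)

/-! ### The Markov chain of state-action pairs under the behaviour policy -/

/-- Transition matrix of the chain of state-action pairs. -/
def chainMatrix : Matrix (S × A) (S × A) ℝ :=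
  Matrix.of fun z z' => M.P z.1 z.2 z'.1 * M.pol z'.1 z'.2

lemma chainMatrix_nonneg (z z' : S × A) : 0 ≤ M.chainMatrix z z' :=
  mul_nonneg (M.P_nonneg _ _ _) (M.pol_nonneg _ _)

lemma chainMatrix_sum (z : S × A) : ∑ z', M.chainMatrix z z' = 1 := by
  simp [chainMatrix, Fintype.sum_prod_type, ← Finset.mul_sum, M.pol_sum, M.P_sum]

/-- `d` is a stationary distribution of the chain. -/
def IsStationary (d : S × A → ℝ) : Prop :=
  (∀ z, 0 ≤ d z) ∧ ∑ z, d z = 1 ∧ ∀ z', ∑ z, d z * M.chainMatrix z z' = d z'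

section Chain

variable [MeasurableSpace S] [MeasurableSingletonClass S]
  [MeasurableSpace A] [MeasurableSingletonClass A]

/-- `X` is a trajectory of the chain (with arbitrary initial distribution), expressed through its
finite-dimensional distributions. -/
def IsTrajectory {Ω : Type w} [MeasurableSpace Ω] (Pr : Measure Ω) (X : ℕ → Ω → S × A) : Prop :=
  (∀ n, Measurable (X n)) ∧
    ∀ (n : ℕ) (z : ℕ → S × A),
      Pr {ω | ∀ i ≤ n + 1, X i ω = z i} =
        Pr {ω | ∀ i ≤ n, X i ω = z i} * ENNReal.ofReal (M.chainMatrix (z n) (z (n + 1)))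

/-- One step of the chain as a Markov kernel. -/
def stepKernel : Kernel (S × A) (S × A) where
  toFun z := ∑ z', ENNReal.ofReal (M.chainMatrix z z') • Measure.dirac z'
  measurable' := measurable_of_finite _

instance : IsMarkovKernel M.stepKernel where
  isProbabilityMeasure z := by
    constructor
    change (∑ z', ENNReal.ofReal (M.chainMatrix z z') • Measure.dirac z') Set.univ = 1
    simp only [Measure.coe_finsetSum, Finset.sum_apply, Measure.smul_apply, measure_univ,
      smul_eq_mul, mul_one]
    rw [← ENNReal.ofReal_sum_of_nonneg fun z' _ => M.chainMatrix_nonneg z z',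
      M.chainMatrix_sum, ENNReal.ofReal_one]

/-- The law, on the space of sequences of state-action pairs, of the chain started at `z`. -/
def chainLaw (z : S × A) : Measure (ℕ → S × A) :=
  Kernel.trajMeasure (X := fun _ => S × A) (Measure.dirac z) fun n =>
    M.stepKernel.comap (fun x : (∀ _ : Finset.Iic n, S × A) => x ⟨n, by simp⟩) (by fun_prop)

/-- The expectation, for the chain started at `z`, of the hitting time
`inf {n ≥ 1 : (S_n, A_n) = z₀}`. -/
def expectedHit (z₀ z : S × A) : ℝ≥0∞ :=
  ∫⁻ x, ENat.toENNReal (hittingAfter (fun n (x : ℕ → S × A) => x n) {z₀} 1 x) ∂(M.chainLaw z)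

/-- `τ_max`, the largest expected hitting time of `z₀` over all starting points. -/
def tauMax (z₀ : S × A) : ℝ := (⨆ z, M.expectedHit z₀ z).toReal

end Chain

/-! ### Linear approximation, projected Bellman equation -/

/-- The feature matrix `Φ`. -/
def Phi : Matrix (S × A) (Fin h) ℝ := Matrix.of fun z j => M.feat z j

/-- `Φ θ` as a function on state-action pairs; its norm is the maximum norm. -/
def qfun (θ : EuclideanSpace ℝ (Fin h)) : S × A → ℝ := Matrix.mulVec M.Phi θ.ofLp

/-- The Bellman optimality operator `T`. -/
def bellman (q : S × A → ℝ) : S × A → ℝ := fun z =>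
  ∑ s', M.P z.1 z.2 s' * (M.r z.1 z.2 s' + M.γ * ⨆ a, q (s', a))

variable (d : S × A → ℝ)

/-- `Φᵀ D` with `D = diag d`. -/
def PhiTD : Matrix (Fin h) (S × A) ℝ := Matrix.of fun j z => M.feat z j * d z

/-- `Φᵀ D Φ`. -/
def gram : Matrix (Fin h) (Fin h) ℝ := M.PhiTD d * M.Phi

/-- The matrix `(Φᵀ D Φ + η I)⁻¹ Φᵀ D`. -/
def regSolve : Matrix (Fin h) (S × A) ℝ :=
  (M.gram d + M.η • (1 : Matrix (Fin h) (Fin h) ℝ))⁻¹ * M.PhiTD d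

/-- The regularized projection `Γ_η = Φ (Φᵀ D Φ + η I)⁻¹ Φᵀ D`. -/
def Gam : Matrix (S × A) (S × A) ℝ := M.Phi * M.regSolve d

/-- `‖Γ_η‖_∞`, the maximal absolute row sum. -/
def gamNorm : ℝ := ⨆ z, ∑ z', |M.Gam d z z'|

/-- `γ ‖Γ_η‖_∞`. -/
def contr : ℝ := M.γ * M.gamNorm d

/-- `θ` solves the regularized projected Bellman equation `Φ θ = Γ_η T Φ θ`, in parameter form
`θ = (Φᵀ D Φ + η I)⁻¹ Φᵀ D T Φ θ`. -/
def IsRPBESolution (θ : EuclideanSpace ℝ (Fin h)) : Prop :=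
  θ = WithLp.toLp 2 (Matrix.mulVec (M.regSolve d) (M.bellman (M.qfun θ)))

/-! ### Periodic regularized Q-learning along a trajectory -/

/-- The stochastic gradient `g(θ, θ'; z, s')`. -/
def grad (θ θ' : EuclideanSpace ℝ (Fin h)) (z : S × A) (s' : S) : EuclideanSpace ℝ (Fin h) :=
  -((M.r z.1 z.2 s' + M.γ * (⨆ a, M.qfun θ' (s', a)) - M.qfun θ z) • M.feat z) + M.η • θ

/-- Inner loop with target parameter `θ'` and step size `α`, started at `θ'` and reading the
trajectory `x` from time `n` on; the `k`-th sample is `(s, a, s')` with `(s, a) = x (n + k)` and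
`s'` the state at time `n + k + 1`. -/
def inner (α : ℝ) (x : ℕ → S × A) (θ' : EuclideanSpace ℝ (Fin h)) (n : ℕ) :
    ℕ → EuclideanSpace ℝ (Fin h)
  | 0 => θ'
  | k + 1 => inner α x θ' n k -
      α • M.grad (inner α x θ' n k) θ' (x (n + k)) (x (n + k + 1)).1

/-- `θ_{t,K}`: the parameter after `t` inner loops of length `K` along a single trajectory. -/
def outer (α : ℝ) (K : ℕ) (θ₀ : EuclideanSpace ℝ (Fin h)) (x : ℕ → S × A) :
    ℕ → EuclideanSpace ℝ (Fin h)
  | 0 => θ₀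
  | t + 1 => M.inner α x (outer α K θ₀ x t) (t * K) K

/-! ### Constants; `Rm` is the reward bound, `θs` the solution `θ*_η` -/

/-- `μ_η = λ_min(Φᵀ D Φ) + η`. -/
def mu : ℝ := sInf (spectrum ℝ (M.gram d)) + M.η

/-- `l_η = λ_max(Φᵀ D Φ) + η`. -/
def ell : ℝ := sSup (spectrum ℝ (M.gram d)) + M.η

/-- `κ = l_η / μ_η`. -/
def kap : ℝ := M.ell d / M.mu d

/-- The conditional mean of `r(s, a, s') + γ max_u φ(s', u)ᵀ θ*` is `T Φ θ*`; `σ_η²` is the largest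
conditional variance of this target multiplied by the feature vector. -/
def sigmaSq (θs : EuclideanSpace ℝ (Fin h)) : ℝ :=
  ⨆ z : S × A, ∑ s', M.P z.1 z.2 s' *
    ‖(M.r z.1 z.2 s' + M.γ * (⨆ a, M.qfun θs (s', a)) - M.bellman (M.qfun θs) z) • M.feat z‖ ^ 2

def g₁ : ℝ := 16 + 16 * M.η

def g₂ : ℝ := (42 + 32 * M.η) * M.γ ^ 2

def g₃ (Rm : ℝ) (θs : EuclideanSpace ℝ (Fin h)) : ℝ :=
  32 * (1 + M.η) * M.γ ^ 2 * ‖M.qfun θs‖ ^ 2 + (16 + 16 * M.η) * Rm ^ 2 + 8 * M.sigmaSq θs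

section Constants

variable [MeasurableSpace S] [MeasurableSingletonClass S]
  [MeasurableSpace A] [MeasurableSingletonClass A]
  (z₀ : S × A) (Rm : ℝ) (θs : EuclideanSpace ℝ (Fin h)) (ε : ℝ)

def lV₁ : ℝ := 2 * M.tauMax z₀ * (1 + M.η)

def lV₂ : ℝ := max (2 * M.tauMax z₀ * M.γ) 1

def lV₃ : ℝ := M.tauMax z₀ * (Rm + (1 + M.γ + M.η) * ‖θs‖)

def D₁ : ℝ :=
  M.ell d * (6 * M.lV₁ z₀ + M.lV₃ z₀ Rm θs) + M.kap d * M.lV₁ z₀ * M.γ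

def D₂ : ℝ := M.kap d * (4 * M.lV₁ z₀ * (1 + M.ell d))

def D₃ : ℝ := M.kap d * M.lV₁ z₀ + M.ell d * M.lV₂ z₀

def E₁ : ℝ := (M.D₁ d z₀ Rm θs + M.ell d / 2) * M.g₂ + M.D₃ d z₀

def E₂ : ℝ :=
  (M.D₁ d z₀ Rm θs + M.ell d / 2) * M.g₃ Rm θs + 2 * M.ell d * M.lV₃ z₀ Rm θs

def alpha₁ : ℝ :=
  M.mu d / ((M.D₁ d z₀ Rm θs + M.ell d / 2) * M.g₁ + 2 * M.D₂ d z₀)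

def alpha₂ : ℝ :=
  M.mu d / (16 * M.ell d * (6 * M.lV₁ z₀ + M.lV₃ z₀ Rm θs) * (1 + M.η)
    + 24 * M.kap d * M.lV₁ z₀ * (1 + M.η))

def alpha₃ : ℝ :=
  M.mu d ^ 2 * (1 - M.contr d ^ 2) ^ 2 /
    (8 * (1 + M.contr d ^ 2) * (2 * M.mu d * M.E₁ d z₀ Rm θs
      + 4 * M.mu d * (M.lV₁ z₀ * M.γ * M.kap d + M.ell d * M.lV₂ z₀)))

def alpha₄ : ℝ :=
  2 * M.mu d ^ 2 * ε * M.γ ^ 2 * (1 - M.contr d ^ 2) ^ 2 /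
    (4 * (1 + M.contr d ^ 2) *
      (M.E₂ d z₀ Rm θs + 3 * M.ell d * M.lV₃ z₀ Rm θs * M.mu d))

/-- The step-size threshold `min {ᾱ₁, ᾱ₂, ᾱ₃, ᾱ₄}`. -/
def alphaBar : ℝ :=
  min (min (M.alpha₁ d z₀ Rm θs) (M.alpha₂ d z₀ Rm θs))
    (min (M.alpha₃ d z₀ Rm θs) (M.alpha₄ d z₀ Rm θs ε))

/-- The order of the inner-loop length, up to a logarithmic factor. -/
def orderK : ℝ :=
  max ((M.ell d * (6 * M.lV₁ z₀ + M.lV₃ z₀ Rm θs) * (1 + M.η)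
      + M.kap d * M.lV₁ z₀ * (1 + M.η)) / M.mu d ^ 2)
    (max
      ((2 * M.mu d * M.E₁ d z₀ Rm θs
          + 4 * M.mu d * (M.lV₁ z₀ * M.kap d + M.ell d * M.lV₂ z₀)) /
        (M.mu d ^ 3 * (1 - M.contr d) ^ 2))
      ((M.E₂ d z₀ Rm θs + M.mu d * M.ell d * M.lV₃ z₀ Rm θs) /
        (ε * M.mu d ^ 3 * M.γ ^ 2 * (1 - M.contr d) ^ 2)))

end Constants

/-- The logarithmic factor in the inner-loop length. -/
def logK (θs θ₀ : EuclideanSpace ℝ (Fin h)) (ε : ℝ) : ℝ :=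
  Real.log (2 + 1 / M.mu d + 1 / (1 - M.contr d) + ‖θ₀ - θs‖ ^ 2 / ε)

/-- The logarithmic factor in the number of outer iterations. -/
def logT (θs θ₀ : EuclideanSpace ℝ (Fin h)) (ε : ℝ) : ℝ :=
  Real.log (2 + ‖M.qfun (θ₀ - θs)‖ ^ 2 / ε)

end RegLinearMDP

end

/-! An inner loop is constant-step stochastic gradient descent, driven by the Markov chain, for a
ridge regression with frozen targets. Its stationary solution is `target d θ'`, with θ' the
parameter at which the loop starts. The map `target` contracts the seminorm ‖Φ·‖∞ around θ* with
factor x, so its fixed point exists and is unique, and the outer iteration is an approximate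
fixed-point iteration. What must be controlled is the mean square distance of an inner loop from its
target.

The samples are dependent and the loop starts at an arbitrary state. Both are handled by the Poisson
equation Pv = v - f for functions f with d-mean zero. A solution is the potential v = Gf, where G is
the Green kernel of the chain killed on hitting z₀. Since d(z₀)G(z₀,·) = d, the potential vanishes
at z₀, so killing makes no difference to it (`sum_P_smul_pot`). Rows of G sum to expected hitting
times, so G has norm at most τ_max on bounded functions, and on mean-zero functions in L²(d) it has
norm at most 2τ_max (`sum_d_norm_pot_sq_le`).

Correcting ‖y‖², with y the distance vector to the target, by potentials of the linear part, of the
noise and of the second-order noise term gives a Lyapunov function that contracts by 1 - (3/4)αμ per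
step, up to a floor of order ατ_max U²/μ, where U bounds the regression targets
(`RidgeProblem.lyap_drift`). The L² bound matters here: in stationary mean the squared noise is at
most U², while the uniform bound of the squared noise carries an extra factor 1/μ.

The error at the start of an inner loop is Euclidean, the contraction is in ‖Φ·‖∞. Hence the outer
argument follows a = E‖Φ(θ-θ*)‖∞² and b = E‖θ-θ*‖² together. A small enough weight p⁶ makes a + p⁶b
contract by 1 - (1-x)/2 (`coupled_recursion_step`), provided the inner loop reduces its initial
error by a factor p¹². The logarithm in the condition on K achieves this. The rest is arithmetic:
the thresholds on the step size imply the smallness conditions used, and 32·μ·`orderK`·ᾱ ≥ 1 gives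
the stated order of K. -/

noncomputable section

/-! ### Chains killed on hitting a state -/

section Taboo

variable {ι : Type*} [DecidableEq ι]

/-- The transition matrix `P` with the transitions into `z₀` removed. -/
def tabooMatrix (P : Matrix ι ι ℝ) (z₀ : ι) : Matrix ι ι ℝ :=
  Matrix.of fun z z' => if z' = z₀ then 0 else P z z'

variable {P : Matrix ι ι ℝ} {z₀ : ι}

lemma tabooMatrix_nonneg (hP : ∀ z z', 0 ≤ P z z') (z z' : ι) : 0 ≤ tabooMatrix P z₀ z z' := by
  simp only [tabooMatrix, Matrix.of_apply]
  split_ifs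
  · exact le_rfl
  · exact hP _ _

lemma tabooMatrix_le (hP : ∀ z z', 0 ≤ P z z') (z z' : ι) : tabooMatrix P z₀ z z' ≤ P z z' := by
  simp only [tabooMatrix, Matrix.of_apply]
  split_ifs
  · exact hP _ _
  · exact le_rfl

variable [Fintype ι]

/-- The probability that the chain started at `z` avoids `z₀` at the times `1, …, n`. -/
def survival (P : Matrix ι ι ℝ) (z₀ : ι) (n : ℕ) (z : ι) : ℝ :=
  ∑ z', (tabooMatrix P z₀ ^ n) z z'

lemma sum_tabooMatrix_mul {f : ι → ℝ} (hf : f z₀ = 0) (z : ι) :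
    ∑ z', tabooMatrix P z₀ z z' * f z' = ∑ z', P z z' * f z' := by
  refine Finset.sum_congr rfl fun z' _ => ?_
  simp only [tabooMatrix, Matrix.of_apply]
  split_ifs with h
  · simp [h, hf]
  · rfl

lemma survival_zero (z : ι) : survival P z₀ 0 z = 1 := by
  simp [survival, Matrix.one_apply]

lemma survival_add (m n : ℕ) (z : ι) :
    survival P z₀ (m + n) z = ∑ z', (tabooMatrix P z₀ ^ m) z z' * survival P z₀ n z' := by
  simp only [survival, pow_add, Matrix.mul_apply, Finset.mul_sum]
  exact Finset.sum_comm

lemma survival_succ (n : ℕ) (z : ι) :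
    survival P z₀ (n + 1) z = ∑ z', tabooMatrix P z₀ z z' * survival P z₀ n z' := by
  rw [add_comm, survival_add, pow_one]

lemma survival_nonneg (hP : ∀ z z', 0 ≤ P z z') (n : ℕ) (z : ι) : 0 ≤ survival P z₀ n z :=
  Finset.sum_nonneg fun _ _ => Matrix.pow_apply_nonneg (tabooMatrix_nonneg hP) _ _ _

lemma survival_succ_le (hP : ∀ z z', 0 ≤ P z z') (hs : ∀ z, ∑ z', P z z' = 1) (n : ℕ) (z : ι) :
    survival P z₀ (n + 1) z ≤ survival P z₀ n z := by
  induction n generalizing z with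
  | zero =>
    rw [survival_succ, survival_zero, ← hs z]
    refine Finset.sum_le_sum fun z' _ => ?_
    rw [survival_zero, mul_one]
    exact tabooMatrix_le hP _ _
  | succ n ih =>
    rw [survival_succ, survival_succ n]
    exact Finset.sum_le_sum fun z' _ =>
      mul_le_mul_of_nonneg_left (ih z') (tabooMatrix_nonneg hP _ _)

lemma survival_antitone (hP : ∀ z z', 0 ≤ P z z') (hs : ∀ z, ∑ z', P z z' = 1) (z : ι) :
    Antitone fun n => survival P z₀ n z :=
  antitone_nat_of_succ_le fun n => survival_succ_le hP hs n z

lemma survival_le_one (hP : ∀ z z', 0 ≤ P z z') (hs : ∀ z, ∑ z', P z z' = 1) (n : ℕ) (z : ι) :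
    survival P z₀ n z ≤ 1 :=
  (survival_antitone hP hs z (Nat.zero_le n)).trans_eq (survival_zero z)

/-- A chain that sits at z₀ at time n + 1 ≥ 1 has not avoided z₀ up to that time. At time 0 this
fails for the starting point z₀ itself, hence the exponent n + 1. -/
lemma pow_apply_le_one_sub_survival (hP : ∀ z z', 0 ≤ P z z') (hs : ∀ z, ∑ z', P z z' = 1)
    (n : ℕ) (z : ι) : (P ^ (n + 1)) z z₀ ≤ 1 - survival P z₀ (n + 1) z := by
  -- First-step analysis. After a first step into z₀ the trivial bound 1 suffices, since that
  -- transition is missing from the taboo matrix; the inductive bound is needed only for z' ≠ z₀,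
  -- where it holds already for n = 0.
  have key : ∀ n, (∀ z', z' ≠ z₀ → (P ^ n) z' z₀ ≤ 1 - survival P z₀ n z') → (P ^ n) z₀ z₀ ≤ 1 →
      ∀ z, (P ^ (n + 1)) z z₀ ≤ 1 - survival P z₀ (n + 1) z := by
    intro n h1 h2 z
    rw [survival_succ, pow_succ', Matrix.mul_apply, ← hs z, ← Finset.sum_sub_distrib]
    refine Finset.sum_le_sum fun z' _ => ?_
    simp only [tabooMatrix, Matrix.of_apply]
    split_ifs with hz
    · subst hz
      nlinarith [hP z z']
    · nlinarith [hP z z', h1 z' hz]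
  induction n generalizing z with
  | zero =>
    refine key 0 (fun z' hz' => ?_) ?_ z
    · simp [survival_zero, hz']
    · simp
  | succ n ih =>
    exact key (n + 1) (fun z' _ => ih z') ((ih z₀).trans (by
      linarith [survival_nonneg (z₀ := z₀) hP (n + 1) z₀])) z

/-- From each state z₀ is reached with positive probability at some time; the state space is finite
and survival decreases in time, so one time serves all states. -/
lemma exists_survival_le (hP : ∀ z z', 0 ≤ P z z') (hs : ∀ z, ∑ z', P z z' = 1)
    (hirr : P.IsIrreducible) : ∃ (N : ℕ) (ρ : ℝ), ρ < 1 ∧ ∀ z, survival P z₀ N z ≤ ρ := by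
  have h1 : ∀ z, ∃ n, survival P z₀ n z < 1 := by
    intro z
    obtain ⟨k, hk, hpos⟩ := (Matrix.isIrreducible_iff_exists_pow_pos hP).1 hirr z z₀
    obtain ⟨n, rfl⟩ := Nat.exists_eq_succ_of_ne_zero hk.ne'
    exact ⟨n + 1, by linarith [pow_apply_le_one_sub_survival (z₀ := z₀) hP hs n z]⟩
  choose n hn using h1
  obtain ⟨w, -, hw⟩ := Finset.exists_max_image Finset.univ
    (survival P z₀ (Finset.univ.sup n)) ⟨z₀, Finset.mem_univ _⟩
  refine ⟨Finset.univ.sup n, _, ?_, fun z => hw z (Finset.mem_univ _)⟩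
  exact (survival_antitone hP hs w (Finset.le_sup (Finset.mem_univ w))).trans_lt (hn w)

/-- Let B be the largest partial sum over all starting points. Splitting off the first N terms and
restarting gives B ≤ N + ρB, a bound independent of the number of terms. -/
lemma summable_survival (hP : ∀ z z', 0 ≤ P z z') (hs : ∀ z, ∑ z', P z z' = 1)
    (hirr : P.IsIrreducible) (z : ι) : Summable fun n => survival P z₀ n z := by
  obtain ⟨N, ρ, hρ, hN⟩ := exists_survival_le (z₀ := z₀) hP hs hirr
  have hb : ∀ m z, ∑ n ∈ Finset.range m, survival P z₀ n z ≤ N / (1 - ρ) := by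
    intro m
    obtain ⟨w, -, hw⟩ := Finset.exists_max_image Finset.univ
      (fun z => ∑ n ∈ Finset.range m, survival P z₀ n z) ⟨z₀, Finset.mem_univ _⟩
    have hw' := fun z => hw z (Finset.mem_univ z)
    refine fun z => (hw' z).trans ?_
    obtain ⟨B, hB⟩ : ∃ B, B = ∑ n ∈ Finset.range m, survival P z₀ n w := ⟨_, rfl⟩
    rw [← hB] at hw' ⊢
    have hB0 : 0 ≤ B := hB ▸ Finset.sum_nonneg fun n _ => survival_nonneg hP n w
    have h1 : B ≤ ∑ n ∈ Finset.range (N + m), survival P z₀ n w := hB ▸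
      Finset.sum_le_sum_of_subset_of_nonneg (Finset.range_mono (by omega))
        fun n _ _ => survival_nonneg hP n w
    rw [Finset.sum_range_add] at h1
    have h2 : ∑ n ∈ Finset.range N, survival P z₀ n w ≤ N := by
      refine (Finset.sum_le_sum fun n _ => survival_le_one hP hs n w).trans ?_
      simp
    have h3 : ∑ n ∈ Finset.range m, survival P z₀ (N + n) w ≤ ρ * B := by
      simp only [survival_add]
      rw [Finset.sum_comm]
      simp only [← Finset.mul_sum]
      calc _ ≤ ∑ z', (tabooMatrix P z₀ ^ N) w z' * B := Finset.sum_le_sum fun z' _ =>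
            mul_le_mul_of_nonneg_left (hw' z')
              (Matrix.pow_apply_nonneg (tabooMatrix_nonneg hP) _ _ _)
        _ = survival P z₀ N w * B := by rw [← Finset.sum_mul]; rfl
        _ ≤ ρ * B := mul_le_mul_of_nonneg_right (hN w) hB0
    rw [le_div_iff₀ (by linarith)]
    linarith
  exact summable_of_sum_range_le (fun n => survival_nonneg hP n z) (fun m => hb m z)

end Taboo

/-- The Green kernel of a finite Markov chain with transition matrix `P` and stationary
distribution `d`, killed on hitting a base point, with row sums at most `T`. -/
structure GreenKernel {ι : Type*} [Fintype ι] [DecidableEq ι] (P : Matrix ι ι ℝ) (d : ι → ℝ)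
    (T : ℝ) where
  /-- the base point -/
  base : ι
  /-- the kernel -/
  G : Matrix ι ι ℝ
  /-- the row sums, which are the expected hitting times of the base point -/
  hit : ι → ℝ
  P_nonneg : ∀ z z', 0 ≤ P z z'
  P_sum : ∀ z, ∑ z', P z z' = 1
  d_nonneg : ∀ z, 0 ≤ d z
  d_sum : ∑ z, d z = 1
  d_stat : ∀ z', ∑ z, d z * P z z' = d z'
  G_nonneg : ∀ z z', 0 ≤ G z z'
  G_sum : ∀ z, ∑ z', G z z' = hit z
  one_le_hit : ∀ z, 1 ≤ hit z
  hit_le : ∀ z, hit z ≤ T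
  hit_eq : ∀ z, hit z = 1 + ∑ z', tabooMatrix P base z z' * hit z'
  G_eq : ∀ z u, G z u = (if z = u then 1 else 0) + ∑ z', tabooMatrix P base z z' * G z' u
  d_base_pos : 0 < d base

/-- A state of positive mass reaches z₀ in k steps with positive probability, and d is invariant
under the k-th power. The positivity allows cancelling d(z₀) in `pot_base`. -/
lemma stationary_pos {ι : Type*} [Fintype ι] [DecidableEq ι] {P : Matrix ι ι ℝ} {d : ι → ℝ}
    (hP : ∀ z z', 0 ≤ P z z') (hirr : P.IsIrreducible) (hd0 : ∀ z, 0 ≤ d z)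
    (hd1 : ∑ z, d z = 1) (hd : ∀ z', ∑ z, d z * P z z' = d z') (z₀ : ι) : 0 < d z₀ := by
  obtain ⟨z, hz⟩ : ∃ z, 0 < d z := by
    by_contra! hcon
    have : ∑ z, d z ≤ 0 := Finset.sum_nonpos fun z _ => hcon z
    linarith
  obtain ⟨k, -, hpos⟩ := (Matrix.isIrreducible_iff_exists_pow_pos hP).1 hirr z z₀
  have hk : ∀ k z', ∑ z, d z * (P ^ k) z z' = d z' := by
    intro k
    induction k with
    | zero => intro z'; simp [Matrix.one_apply]
    | succ k ih =>
      intro z'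
      simp only [pow_succ, Matrix.mul_apply, Finset.mul_sum]
      rw [Finset.sum_comm]
      simp only [← mul_assoc, ← Finset.sum_mul, ih, hd]
  rw [← hk k z₀]
  exact Finset.sum_pos' (fun i _ => mul_nonneg (hd0 i) (Matrix.pow_apply_nonneg hP _ _ _))
    ⟨z, Finset.mem_univ _, mul_pos hz hpos⟩

/-- The Green kernel of an irreducible chain, killed on hitting `z₀`. -/
def GreenKernel.ofIrreducible {ι : Type*} [Fintype ι] [DecidableEq ι] {P : Matrix ι ι ℝ}
    {d : ι → ℝ} {T : ℝ} (hP : ∀ z z', 0 ≤ P z z') (hs : ∀ z, ∑ z', P z z' = 1)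
    (hirr : P.IsIrreducible) (hd0 : ∀ z, 0 ≤ d z) (hd1 : ∑ z, d z = 1)
    (hd : ∀ z', ∑ z, d z * P z z' = d z') (z₀ : ι)
    (hT : ∀ z, ∑' n, survival P z₀ n z ≤ T) : GreenKernel P d T := by
  have hQ := tabooMatrix_nonneg (z₀ := z₀) hP
  have hsum : ∀ z z', Summable fun n => (tabooMatrix P z₀ ^ n) z z' := fun z z' =>
    Summable.of_nonneg_of_le (fun n => Matrix.pow_apply_nonneg hQ n z z')
      (fun n => Finset.single_le_sum (f := fun z' => (tabooMatrix P z₀ ^ n) z z')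
        (fun i _ => Matrix.pow_apply_nonneg hQ n z i) (Finset.mem_univ z'))
      (summable_survival hP hs hirr z)
  have hsurv := summable_survival (z₀ := z₀) hP hs hirr
  exact
  { base := z₀
    G := Matrix.of fun z z' => ∑' n, (tabooMatrix P z₀ ^ n) z z'
    hit := fun z => ∑' n, survival P z₀ n z
    P_nonneg := hP
    P_sum := hs
    d_nonneg := hd0
    d_sum := hd1
    d_stat := hd
    G_nonneg := fun z z' => tsum_nonneg fun n => Matrix.pow_apply_nonneg hQ n z z'
    G_sum := fun z => by
      simp only [Matrix.of_apply, survival]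
      exact (Summable.tsum_finsetSum fun z' _ => hsum z z').symm
    one_le_hit := fun z => by
      have := (hsurv z).le_tsum 0 fun n _ => survival_nonneg hP n z
      rwa [survival_zero] at this
    hit_le := hT
    hit_eq := fun z => by
      rw [(hsurv z).tsum_eq_zero_add, survival_zero]
      congr 1
      simp only [survival_succ]
      rw [Summable.tsum_finsetSum fun z' _ => (hsurv z').mul_left _]
      simp only [tsum_mul_left]
    G_eq := fun z u => by
      simp only [Matrix.of_apply]
      rw [(hsum z u).tsum_eq_zero_add]
      congr 1
      simp only [pow_succ', Matrix.mul_apply]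
      rw [Summable.tsum_finsetSum fun z' _ => (hsum z' u).mul_left _]
      simp only [tsum_mul_left]
    d_base_pos := stationary_pos hP hirr hd0 hd1 hd z₀ }
end

/-! ### Potentials of the killed chain and the Poisson equation -/

noncomputable section

namespace GreenKernel

variable {ι : Type*} [Fintype ι] [DecidableEq ι] {P : Matrix ι ι ℝ} {d : ι → ℝ} {T : ℝ}

lemma one_le (g : GreenKernel P d T) : 1 ≤ T := (g.one_le_hit g.base).trans (g.hit_le _)

/-- The mean of a function after one step of the stationary chain. -/
lemma sum_d_mul_sum (g : GreenKernel P d T) (f : ι → ℝ) :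
    ∑ z, d z * ∑ z', P z z' * f z' = ∑ z, d z * f z := by
  simp only [Finset.mul_sum]
  rw [Finset.sum_comm]
  simp only [← mul_assoc, ← Finset.sum_mul, g.d_stat]

variable (g : GreenKernel P d T)

lemma sum_d_mul_taboo (z' : ι) :
    ∑ z, d z * tabooMatrix P g.base z z' = if z' = g.base then 0 else d z' := by
  simp only [tabooMatrix, Matrix.of_apply]
  split_ifs
  · simp
  · exact g.d_stat z'

/-- The cycle formula: the expected number of visits to u during an excursion from the base point is
d(u)/d(base). Integrate G = I + QG against d, with Q the taboo matrix; stationarity gives dQ = d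
with the base entry deleted, and everything but the base term cancels. -/
lemma d_base_mul_G (u : ι) : d g.base * g.G g.base u = d u := by
  have h1 : ∑ z, d z * g.G z u =
      d u + ∑ z', (if z' = g.base then 0 else d z') * g.G z' u := by
    simp only [← g.sum_d_mul_taboo, Finset.sum_mul]
    rw [Finset.sum_comm]
    conv_lhs => enter [2, z]; rw [g.G_eq, mul_add, Finset.mul_sum]
    simp [Finset.sum_add_distrib, mul_assoc]
  have h2 : ∑ z', (if z' = g.base then 0 else d z') * g.G z' u =
      ∑ z, d z * g.G z u - d g.base * g.G g.base u := by
    rw [eq_sub_iff_add_eq, ← Finset.add_sum_erase _ _ (Finset.mem_univ g.base),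
      ← Finset.add_sum_erase _ (fun z => d z * g.G z u) (Finset.mem_univ g.base)]
    simp only [if_true, zero_mul, zero_add]
    rw [add_comm]
    congr 1
    exact Finset.sum_congr rfl fun z hz => by rw [if_neg (Finset.ne_of_mem_erase hz)]
  linarith

section Pot

variable {E : Type*} [NormedAddCommGroup E] [NormedSpace ℝ E]

/-- The potential of `f`. -/
def pot (f : ι → E) (z : ι) : E := ∑ z', g.G z z' • f z'

lemma pot_add (f₁ f₂ : ι → E) (z : ι) :
    g.pot (fun z => f₁ z + f₂ z) z = g.pot f₁ z + g.pot f₂ z := by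
  simp [pot, Finset.sum_add_distrib]

lemma norm_pot_le {f : ι → E} {B : ℝ} (hf : ∀ z, ‖f z‖ ≤ B) (z : ι) : ‖g.pot f z‖ ≤ T * B := by
  have hB : 0 ≤ B := (norm_nonneg _).trans (hf z)
  calc ‖g.pot f z‖ ≤ ∑ z', ‖g.G z z' • f z'‖ := norm_sum_le _ _
    _ ≤ ∑ z', g.G z z' * B := Finset.sum_le_sum fun z' _ => by
        rw [norm_smul, Real.norm_of_nonneg (g.G_nonneg _ _)]
        exact mul_le_mul_of_nonneg_left (hf z') (g.G_nonneg _ _)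
    _ = g.hit z * B := by rw [← Finset.sum_mul, g.G_sum]
    _ ≤ T * B := mul_le_mul_of_nonneg_right (g.hit_le z) hB

/-- By the cycle formula, d(base) times the potential at the base point is the d-mean of f. -/
lemma pot_base {f : ι → E} (hf : ∑ z, d z • f z = 0) : g.pot f g.base = 0 := by
  have h : d g.base • g.pot f g.base = 0 := by
    simp only [pot, Finset.smul_sum, smul_smul, g.d_base_mul_G, hf]
  exact (smul_eq_zero.1 h).resolve_left g.d_base_pos.ne'

lemma pot_eq_add_taboo (f : ι → E) (z : ι) :
    g.pot f z = f z + ∑ z', tabooMatrix P g.base z z' • g.pot f z' := by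
  simp only [pot, Finset.smul_sum, smul_smul]
  rw [Finset.sum_comm]
  simp only [← Finset.sum_smul]
  conv_lhs => enter [2, u]; rw [g.G_eq, add_smul, ite_smul]
  simp [Finset.sum_add_distrib]

/-- The Poisson equation. The potential always solves it for the taboo matrix; for centred f it
vanishes at the base point, so the deleted transitions contribute nothing. -/
lemma sum_P_smul_pot {f : ι → E} (hf : ∑ z, d z • f z = 0) (z : ι) :
    ∑ z', P z z' • g.pot f z' = g.pot f z - f z := by
  rw [eq_sub_iff_add_eq', g.pot_eq_add_taboo f z]
  congr 1
  refine Finset.sum_congr rfl fun z' _ => ?_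
  simp only [tabooMatrix, Matrix.of_apply]
  split_ifs with h
  · simp [h, g.pot_base hf]
  · rfl

/-- Weight the squared potential by 1/`hit`. Because `hit` = 1 + Q·`hit` with Q the taboo matrix,
Cauchy–Schwarz with weights `hit` turns the equation of the potential v into u ≤ 2‖f‖² + (1 -
1/(2T))Qu for u = ‖v‖²/`hit`. Integrating against d, which Q does not increase, gives a d-mean of u
of at most 4T times that of ‖f‖²; the second factor T removes the weight. -/
lemma sum_d_norm_pot_sq_le {f : ι → E} (hf : ∑ z, d z • f z = 0) :
    ∑ z, d z * ‖g.pot f z‖ ^ 2 ≤ 4 * T ^ 2 * ∑ z, d z * ‖f z‖ ^ 2 := by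
  have hT := g.one_le
  have hQ := tabooMatrix_nonneg (z₀ := g.base) g.P_nonneg
  have hpos : ∀ z, 0 < g.hit z := fun z => zero_lt_one.trans_le (g.one_le_hit z)
  have hu0 : ∀ z, 0 ≤ ‖g.pot f z‖ ^ 2 / g.hit z := fun z => div_nonneg (sq_nonneg _) (hpos z).le
  have hq0 : ∀ z, 0 ≤ ∑ z', tabooMatrix P g.base z z' * (‖g.pot f z'‖ ^ 2 / g.hit z') := fun z =>
    Finset.sum_nonneg fun z' _ => mul_nonneg (hQ z z') (hu0 z')
  have hstep : ∀ z, ‖g.pot f z‖ ^ 2 / g.hit z ≤ 2 * ‖f z‖ ^ 2 + (1 - 1 / (2 * T)) *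
      ∑ z', tabooMatrix P g.base z z' * (‖g.pot f z'‖ ^ 2 / g.hit z') := by
    intro z
    obtain ⟨w, hw⟩ : ∃ w, w = ∑ z', tabooMatrix P g.base z z' * (‖g.pot f z'‖ ^ 2 / g.hit z') :=
      ⟨_, rfl⟩
    obtain ⟨q, hq⟩ : ∃ q, q = ∑ z', tabooMatrix P g.base z z' * ‖g.pot f z'‖ := ⟨_, rfl⟩
    have hw0 : 0 ≤ w := hw ▸ hq0 z
    have hCS : q ^ 2 ≤ (g.hit z - 1) * w := by
      have h1 : g.hit z - 1 = ∑ z', tabooMatrix P g.base z z' * g.hit z' := by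
        rw [g.hit_eq z]; ring
      rw [h1, hw, hq]
      refine Finset.sum_sq_le_sum_mul_sum_of_sq_le_mul _
        (fun z' _ => mul_nonneg (hQ z z') (hpos z').le)
        (fun z' _ => mul_nonneg (hQ z z') (hu0 z')) fun z' _ => ?_
      have := (hpos z').ne'
      refine le_of_eq ?_
      field_simp
    have hn : ‖g.pot f z‖ ≤ ‖f z‖ + q := by
      rw [g.pot_eq_add_taboo f z, hq]
      refine (norm_add_le _ _).trans (add_le_add le_rfl ((norm_sum_le _ _).trans_eq ?_))
      exact Finset.sum_congr rfl fun z' _ => by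
        rw [norm_smul, Real.norm_of_nonneg (hQ z z')]
    have hq_nonneg : 0 ≤ q := hq ▸ Finset.sum_nonneg fun z' _ => mul_nonneg (hQ z z') (norm_nonneg _)
    have hsq : ‖g.pot f z‖ ^ 2 ≤ (2 * g.hit z - 1) * ‖f z‖ ^ 2 + (g.hit z - 1 / 2) * w := by
      have h1 : ‖g.pot f z‖ ^ 2 ≤ (‖f z‖ + q) ^ 2 := pow_le_pow_left₀ (norm_nonneg _) hn 2
      have hk : 0 ≤ g.hit z - 1 := sub_nonneg.2 (g.one_le_hit z)
      -- Young's inequality with weight `hit` - 1. If this weight is zero, Cauchy–Schwarz has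
      -- already forced q = 0.
      have h2 : 2 * (‖f z‖ * q) ≤ 2 * (g.hit z - 1) * ‖f z‖ ^ 2 + w / 2 := by
        rcases hk.eq_or_lt with h0 | h0
        · rw [← h0, zero_mul] at hCS
          have : q = 0 := by nlinarith
          rw [this, ← h0]; linarith
        · have : 0 ≤ (2 * (g.hit z - 1)) * (2 * (g.hit z - 1) * ‖f z‖ ^ 2 + w / 2
              - 2 * (‖f z‖ * q)) := by
            nlinarith [sq_nonneg (2 * (g.hit z - 1) * ‖f z‖ - q)]
          linarith [nonneg_of_mul_nonneg_right this (by linarith)]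
      nlinarith
    rw [← hw, div_le_iff₀ (hpos z)]
    have h3 : (1 - 1 / (2 * T)) * w * g.hit z ≥ (g.hit z - 1 / 2) * w := by
      have : g.hit z / T ≤ 1 := (div_le_one (by linarith)).2 (g.hit_le z)
      have h4 : (1 - 1 / (2 * T)) * w * g.hit z = (g.hit z - (g.hit z / T) / 2) * w := by
        field_simp
      rw [h4]
      exact mul_le_mul_of_nonneg_right (by linarith) hw0
    nlinarith [sq_nonneg ‖f z‖]
  -- The potential vanishes at the base point, so the taboo matrix may be replaced by P, under which
  -- the d-mean is invariant.
  have hX : ∑ z, d z * ∑ z', tabooMatrix P g.base z z' * (‖g.pot f z'‖ ^ 2 / g.hit z') =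
      ∑ z, d z * (‖g.pot f z‖ ^ 2 / g.hit z) := by
    rw [← g.sum_d_mul_sum fun z => ‖g.pot f z‖ ^ 2 / g.hit z]
    refine Finset.sum_congr rfl fun z _ => ?_
    rw [sum_tabooMatrix_mul (by simp [g.pot_base hf])]
  have hsum := Finset.sum_le_sum fun z (_ : z ∈ Finset.univ) =>
    mul_le_mul_of_nonneg_left (hstep z) (g.d_nonneg z)
  simp only [mul_add, Finset.sum_add_distrib, mul_left_comm _ (1 - 1 / (2 * T)),
    mul_left_comm _ (2 : ℝ), ← Finset.mul_sum] at hsum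
  rw [hX] at hsum
  obtain ⟨X, hXd⟩ : ∃ X, X = ∑ z, d z * (‖g.pot f z‖ ^ 2 / g.hit z) := ⟨_, rfl⟩
  rw [← hXd] at hsum
  have h5 : X ≤ 4 * T * ∑ z, d z * ‖f z‖ ^ 2 := by
    have : X / (2 * T) ≤ 2 * ∑ z, d z * ‖f z‖ ^ 2 := by
      have : (1 - 1 / (2 * T)) * X = X - X / (2 * T) := by ring
      linarith
    rw [div_le_iff₀ (by linarith)] at this
    linarith
  calc ∑ z, d z * ‖g.pot f z‖ ^ 2 ≤ ∑ z, T * (d z * (‖g.pot f z‖ ^ 2 / g.hit z)) := by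
        refine Finset.sum_le_sum fun z _ => ?_
        rw [mul_left_comm]
        refine mul_le_mul_of_nonneg_left ?_ (g.d_nonneg z)
        rw [mul_div_assoc', le_div_iff₀ (hpos z), mul_comm]
        exact mul_le_mul_of_nonneg_right (g.hit_le z) (sq_nonneg _)
    _ = T * X := by rw [← Finset.mul_sum, hXd]
    _ ≤ T * (4 * T * ∑ z, d z * ‖f z‖ ^ 2) := mul_le_mul_of_nonneg_left h5 (by linarith)
    _ = _ := by ring

end Pot

end GreenKernel
end

noncomputable section

/-! ### Regularized least mean squares along a Markov chain -/

/-- The scalar inequality behind one Lyapunov step: n = ‖y‖, p is the norm of the linear gradient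
part, q its inner product with y, ω the norm of the noise, v that of its potential. The left side
bounds all terms of second order in the increment. The decrease per step is 2αq; half of it is spent
here, the other half is left for the averaged drift. -/
lemma lyapunov_increment_le {α T a μ n p q ω v : ℝ} (hα : 0 < α) (hT : 1 ≤ T) (ha : 1 ≤ a)
    (h1 : α * T * a ^ 2 ≤ μ / 48) (h2 : α * T * a ^ 2 ≤ 1 / 192) (hpq : p ^ 2 ≤ a * q) :
    (α * (p + ω)) ^ 2 * (1 + 2 * α * T) + 4 * α * T * n * (α * (p + ω))
      + 2 * α * (α * (p + ω)) * v
      ≤ α * q + α * μ / 12 * n ^ 2 + α ^ 2 * (7 * T * ω ^ 2 + v ^ 2 / T) := by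
  have ha0 : 0 < a := by linarith
  have hT0 : 0 < T := by linarith
  have hαT : 0 < α * T := by positivity
  have haa : a ≤ a ^ 2 := by nlinarith
  have hαTa : α * T * a ≤ 1 / 192 := (mul_le_mul_of_nonneg_left haa hαT.le).trans h2
  have hαTa' : α * T * a ≤ μ / 48 := (mul_le_mul_of_nonneg_left haa hαT.le).trans h1
  have hαT1 : α * T ≤ 1 / 192 := (le_mul_of_one_le_right hαT.le ha).trans hαTa
  have hαa : α * a ≤ 1 / 192 := by
    refine le_trans ?_ hαTa
    have : α * a * 1 ≤ α * a * T := mul_le_mul_of_nonneg_left hT (by positivity)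
    nlinarith
  have hq : 0 ≤ q := by
    have : 0 ≤ a * q := (sq_nonneg p).trans hpq
    exact nonneg_of_mul_nonneg_right this ha0
  have hp2 : p ^ 2 / a ≤ q := by rw [div_le_iff₀ ha0]; linarith
  have t1 : (α * (p + ω)) ^ 2 * (1 + 2 * α * T)
      ≤ α ^ 2 * (97 / 96) * (2 * p ^ 2 + 2 * ω ^ 2) := by
    have e1 : (p + ω) ^ 2 ≤ 2 * p ^ 2 + 2 * ω ^ 2 := by nlinarith [sq_nonneg (p - ω)]
    have e2 : (p + ω) ^ 2 * (1 + 2 * α * T) ≤ (2 * p ^ 2 + 2 * ω ^ 2) * (97 / 96) :=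
      mul_le_mul e1 (by linarith) (by positivity) (by positivity)
    calc _ = α ^ 2 * ((p + ω) ^ 2 * (1 + 2 * α * T)) := by ring
      _ ≤ α ^ 2 * ((2 * p ^ 2 + 2 * ω ^ 2) * (97 / 96)) :=
        mul_le_mul_of_nonneg_left e2 (sq_nonneg _)
      _ = _ := by ring
  have t2 : 4 * α * T * n * (α * (p + ω)) ≤
      2 * α ^ 2 * T * (a * n ^ 2 + p ^ 2 / a) + 2 * α ^ 2 * T * (n ^ 2 + ω ^ 2) := by
    have e1 : 2 * (n * p) ≤ a * n ^ 2 + p ^ 2 / a := by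
      have : a * n ^ 2 + p ^ 2 / a - 2 * (n * p) = (a * n - p) ^ 2 / a := by field_simp; ring
      have : 0 ≤ (a * n - p) ^ 2 / a := by positivity
      linarith
    have e2 : 2 * (n * ω) ≤ n ^ 2 + ω ^ 2 := by nlinarith [sq_nonneg (n - ω)]
    have e3 : 0 ≤ 2 * α ^ 2 * T := by positivity
    linarith [mul_le_mul_of_nonneg_left e1 e3, mul_le_mul_of_nonneg_left e2 e3]
  have t3 : 2 * α * (α * (p + ω)) * v ≤ (α / 2 * (p ^ 2 / a) + 2 * a * α ^ 3 * v ^ 2)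
      + α ^ 2 * (2 * T * ω ^ 2 + v ^ 2 / (2 * T)) := by
    have e1 : 2 * (α ^ 2 * (p * v)) ≤ α / 2 * (p ^ 2 / a) + 2 * a * α ^ 3 * v ^ 2 := by
      have : α / 2 * (p ^ 2 / a) + 2 * a * α ^ 3 * v ^ 2 - 2 * (α ^ 2 * (p * v))
          = α / (2 * a) * (p - 2 * a * α * v) ^ 2 := by field_simp; ring
      have : 0 ≤ α / (2 * a) * (p - 2 * a * α * v) ^ 2 := by positivity
      linarith
    have e2 : 2 * (ω * v) ≤ 2 * T * ω ^ 2 + v ^ 2 / (2 * T) := by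
      have : 2 * T * ω ^ 2 + v ^ 2 / (2 * T) - 2 * (ω * v) = (2 * T * ω - v) ^ 2 / (2 * T) := by
        field_simp; ring
      have : 0 ≤ (2 * T * ω - v) ^ 2 / (2 * T) := by positivity
      linarith
    have := mul_le_mul_of_nonneg_left e2 (sq_nonneg α)
    linarith
  have t4 : 2 * a * α ^ 3 * v ^ 2 ≤ α ^ 2 * (v ^ 2 / (96 * T)) := by
    have e1 : a * α ≤ 1 / (192 * T) := by
      rw [le_div_iff₀ (by positivity)]; nlinarith
    calc _ = 2 * α ^ 2 * v ^ 2 * (a * α) := by ring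
      _ ≤ 2 * α ^ 2 * v ^ 2 * (1 / (192 * T)) := mul_le_mul_of_nonneg_left e1 (by positivity)
      _ = _ := by field_simp; ring
  -- The three terms in p² use the fraction (97/48)αa + 2αT + 1/2 < 1 of αp²/a ≤ αq.
  have t5 : α ^ 2 * (97 / 96) * (2 * p ^ 2) + 2 * α ^ 2 * T * (p ^ 2 / a) + α / 2 * (p ^ 2 / a)
      ≤ α * q := by
    have e0 : α ^ 2 * (97 / 96) * (2 * p ^ 2) = α * (p ^ 2 / a) * (97 / 48 * (α * a)) := by
      field_simp; ring
    have e1 : α * (p ^ 2 / a) ≤ α * q := mul_le_mul_of_nonneg_left hp2 hα.le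
    have e2 : 0 ≤ α * (p ^ 2 / a) := by positivity
    rw [e0]
    calc _ = α * (p ^ 2 / a) * (97 / 48 * (α * a) + 2 * (α * T) + 1 / 2) := by ring
      _ ≤ α * (p ^ 2 / a) * 1 := mul_le_mul_of_nonneg_left (by linarith) e2
      _ ≤ _ := by linarith
  have t6 : 2 * α ^ 2 * T * (a * n ^ 2) + 2 * α ^ 2 * T * n ^ 2 ≤ α * μ / 12 * n ^ 2 := by
    have e1 : 2 * (α * T * a) + 2 * (α * T) ≤ μ / 12 := by
      have : α * T ≤ α * T * a := le_mul_of_one_le_right hαT.le ha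
      linarith
    have e2 : 0 ≤ α * n ^ 2 := by positivity
    have := mul_le_mul_of_nonneg_left e1 e2
    linarith
  have t7 : α ^ 2 * (97 / 96) * (2 * ω ^ 2) + 2 * α ^ 2 * T * ω ^ 2 + α ^ 2 * (2 * T * ω ^ 2)
      ≤ α ^ 2 * (7 * T * ω ^ 2) := by
    have e2 : 0 ≤ α ^ 2 * ω ^ 2 := by positivity
    have e1 : 97 / 48 + 4 * T ≤ 7 * T := by linarith
    have := mul_le_mul_of_nonneg_left e1 e2
    linarith
  have t8 : α ^ 2 * (v ^ 2 / (96 * T)) + α ^ 2 * (v ^ 2 / (2 * T)) ≤ α ^ 2 * (v ^ 2 / T) := by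
    have e2 : 0 ≤ α ^ 2 * (v ^ 2 / T) := by positivity
    have : α ^ 2 * (v ^ 2 / (96 * T)) + α ^ 2 * (v ^ 2 / (2 * T))
        = α ^ 2 * (v ^ 2 / T) * (49 / 96) := by field_simp; ring
    rw [this]; linarith
  linarith

/-- Regularized linear regression, with features `φ` and targets `c`, on the transitions of a
stationary Markov chain; `θbar` solves the normal equation. -/
structure RidgeProblem {ι : Type*} [Fintype ι] [DecidableEq ι] (P : Matrix ι ι ℝ) (d : ι → ℝ)
    (T : ℝ) (E : Type*) [NormedAddCommGroup E] [InnerProductSpace ℝ E] where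
  green : GreenKernel P d T
  φ : ι → E
  c : ι → ι → ℝ
  θbar : E
  η : ℝ
  μ : ℝ
  U : ℝ
  norm_φ_le : ∀ z, ‖φ z‖ ≤ 1
  η_nonneg : 0 ≤ η
  μ_pos : 0 < μ
  μ_le : μ ≤ 1 + η
  coercive : ∀ y, μ * ‖y‖ ^ 2 ≤ ∑ z, d z * inner ℝ (φ z) y ^ 2 + η * ‖y‖ ^ 2
  U_nonneg : 0 ≤ U
  abs_c_le : ∀ z z', |c z z'| ≤ U
  normal_eq : ∑ z, d z • (inner ℝ (φ z) θbar • φ z) + η • θbar =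
    ∑ z, d z • ((∑ z', P z z' * c z z') • φ z)

namespace RidgeProblem

variable {ι : Type*} [Fintype ι] [DecidableEq ι] {P : Matrix ι ι ℝ} {d : ι → ℝ}
    {T : ℝ} {E : Type*} [NormedAddCommGroup E] [InnerProductSpace ℝ E] (R : RidgeProblem P d T E)

/-- The linear part of the stochastic gradient. -/
def lin (y : E) (z : ι) : E := inner ℝ (R.φ z) y • R.φ z + R.η • y

/-- The stochastic gradient at the solution. -/
def noise (z z' : ι) : E :=
  -((R.c z z' - inner ℝ (R.φ z) R.θbar) • R.φ z) + R.η • R.θbar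

/-- The conditional mean of the noise. -/
def noiseMean (z : ι) : E := ∑ z', P z z' • R.noise z z'

/-- The deviation of the linear part from its stationary mean. -/
def linDev (y : E) (z : ι) : E :=
  inner ℝ (R.φ z) y • R.φ z - ∑ u, d u • (inner ℝ (R.φ u) y • R.φ u)

lemma abs_inner_φ_le (y : E) (z : ι) : |inner ℝ (R.φ z) y| ≤ ‖y‖ :=
  (abs_real_inner_le_norm _ _).trans (mul_le_of_le_one_left (norm_nonneg _) (R.norm_φ_le z))

lemma norm_rank_one_le (y : E) (z : ι) : ‖inner ℝ (R.φ z) y • R.φ z‖ ≤ ‖y‖ := by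
  rw [norm_smul, Real.norm_eq_abs]
  exact (mul_le_of_le_one_right (abs_nonneg _) (R.norm_φ_le z)).trans (R.abs_inner_φ_le y z)

lemma inner_lin (y : E) (z : ι) :
    inner ℝ y (R.lin y z) = inner ℝ (R.φ z) y ^ 2 + R.η * ‖y‖ ^ 2 := by
  simp only [lin, inner_add_right, inner_smul_right, real_inner_self_eq_norm_sq]
  rw [real_inner_comm]
  ring

/-- The operator φφᵀ + η is positive semidefinite with norm at most 1 + η. Thus the squared gradient
is paid for by the pointwise decrease, not by ‖y‖², which would cost a further factor 1/μ in the
step size. -/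
lemma norm_lin_sq_le (y : E) (z : ι) :
    ‖R.lin y z‖ ^ 2 ≤ (1 + R.η) * inner ℝ y (R.lin y z) := by
  have h1 : inner ℝ (R.φ z) y ^ 2 ≤ ‖y‖ ^ 2 := sq_le_sq.2 (by
    rw [abs_norm]; exact R.abs_inner_φ_le y z)
  have h2 : ‖R.φ z‖ ^ 2 ≤ 1 := pow_le_one₀ (norm_nonneg _) (R.norm_φ_le z)
  rw [inner_lin, lin, norm_add_sq_real, norm_smul, norm_smul, inner_smul_left, inner_smul_right,
    mul_pow, mul_pow, Real.norm_eq_abs, Real.norm_eq_abs, sq_abs, sq_abs]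
  simp only [conj_trivial]
  nlinarith [R.η_nonneg, mul_nonneg R.η_nonneg (sub_nonneg.2 h1),
    mul_nonneg (sq_nonneg (inner ℝ (R.φ z) y)) (sub_nonneg.2 h2)]

lemma linDev_add (y₁ y₂ : E) (z : ι) : R.linDev (y₁ + y₂) z = R.linDev y₁ z + R.linDev y₂ z := by
  simp only [linDev, inner_add_right, add_smul, smul_add, Finset.sum_add_distrib]
  abel

lemma norm_linDev_le (y : E) (z : ι) : ‖R.linDev y z‖ ≤ 2 * ‖y‖ := by
  have h : ‖∑ u, d u • (inner ℝ (R.φ u) y • R.φ u)‖ ≤ ‖y‖ := by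
    refine (norm_sum_le _ _).trans ?_
    calc _ ≤ ∑ u, d u * ‖y‖ := Finset.sum_le_sum fun u _ => by
          rw [norm_smul, Real.norm_of_nonneg (R.green.d_nonneg u)]
          exact mul_le_mul_of_nonneg_left (R.norm_rank_one_le y u) (R.green.d_nonneg u)
      _ = ‖y‖ := by rw [← Finset.sum_mul, R.green.d_sum, one_mul]
  exact (norm_sub_le _ _).trans (by linarith [R.norm_rank_one_le y z])

lemma sum_d_linDev (y : E) : ∑ z, d z • R.linDev y z = 0 := by
  simp only [linDev, smul_sub, Finset.sum_sub_distrib]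
  rw [← Finset.sum_smul, R.green.d_sum, one_smul, sub_self]

/-- Subtracting the deviation leaves the stationary mean of the linear part, which is coercive; a
single sample is coercive only through η. -/
lemma le_inner_lin_sub (y : E) (z : ι) :
    R.μ * ‖y‖ ^ 2 ≤ inner ℝ y (R.lin y z) - inner ℝ y (R.linDev y z) := by
  refine (R.coercive y).trans_eq ?_
  rw [inner_lin, linDev, inner_sub_right, inner_sum]
  simp only [inner_smul_right]
  simp only [real_inner_comm (R.φ _) y]
  ring_nf

lemma noiseMean_eq (z : ι) : R.noiseMean z =
    -((∑ z', P z z' * R.c z z' - inner ℝ (R.φ z) R.θbar) • R.φ z) + R.η • R.θbar := by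
  simp only [noiseMean, noise, smul_add, smul_neg, Finset.sum_add_distrib, Finset.sum_neg_distrib,
    smul_smul, mul_sub, ← Finset.sum_smul, Finset.sum_sub_distrib, ← Finset.sum_mul,
    R.green.P_sum, one_mul]

/-- This is the normal equation: the mean gradient vanishes at `θbar`. It makes the Poisson equation
available for the noise. -/
lemma sum_d_noiseMean : ∑ z, d z • R.noiseMean z = 0 := by
  simp only [noiseMean_eq, sub_smul, neg_sub, smul_add, smul_sub, Finset.sum_add_distrib,
    Finset.sum_sub_distrib]
  rw [← Finset.sum_smul, R.green.d_sum, one_smul, ← R.normal_eq]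
  abel

lemma sum_P_mul_le (R : RidgeProblem P d T E) (z : ι) {f : ι → ℝ} {B : ℝ} (hf : ∀ z', f z' ≤ B) :
    ∑ z', P z z' * f z' ≤ B := by
  calc _ ≤ ∑ z', P z z' * B := Finset.sum_le_sum fun z' _ =>
        mul_le_mul_of_nonneg_left (hf z') (R.green.P_nonneg z z')
    _ = B := by rw [← Finset.sum_mul, R.green.P_sum, one_mul]

lemma sum_d_le (R : RidgeProblem P d T E) {f : ι → ℝ} {B : ℝ} (hf : ∀ z, f z ≤ B) : ∑ z, d z * f z ≤ B := by
  calc _ ≤ ∑ z', d z' * B := Finset.sum_le_sum fun z' _ =>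
        mul_le_mul_of_nonneg_left (hf z') (R.green.d_nonneg z')
    _ = B := by rw [← Finset.sum_mul, R.green.d_sum, one_mul]

lemma c_sq_le (z z' : ι) : R.c z z' ^ 2 ≤ R.U ^ 2 :=
  sq_le_sq.2 (by rw [abs_of_nonneg R.U_nonneg]; exact R.abs_c_le z z')

/-- The normal equation tested with the solution. -/
lemma normal_eq_inner : ∑ z, d z * inner ℝ (R.φ z) R.θbar ^ 2 + R.η * ‖R.θbar‖ ^ 2 =
    ∑ z, d z * ∑ z', P z z' * (R.c z z' * inner ℝ (R.φ z) R.θbar) := by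
  have h := congrArg (fun x => inner ℝ R.θbar x) R.normal_eq
  simp only [inner_add_right, inner_sum, inner_smul_right, real_inner_self_eq_norm_sq,
    real_inner_comm (R.φ _) R.θbar] at h
  simp only [← mul_assoc (P _ _), ← Finset.sum_mul]
  simp only [sq (inner ℝ _ _)]
  exact h

lemma energy_le : ∑ z, d z * inner ℝ (R.φ z) R.θbar ^ 2 + R.η * ‖R.θbar‖ ^ 2 ≤ R.U ^ 2 := by
  have h1 : ∑ z, d z * ∑ z', P z z' * (R.c z z' * inner ℝ (R.φ z) R.θbar) ≤
      ∑ z, d z * (R.U ^ 2 / 2 + inner ℝ (R.φ z) R.θbar ^ 2 / 2) := by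
    refine Finset.sum_le_sum fun z _ => mul_le_mul_of_nonneg_left ?_ (R.green.d_nonneg z)
    refine R.sum_P_mul_le z fun z' => ?_
    nlinarith [R.c_sq_le z z', sq_nonneg (R.c z z' - inner ℝ (R.φ z) R.θbar)]
  rw [← R.normal_eq_inner] at h1
  simp only [mul_add, Finset.sum_add_distrib] at h1
  rw [← Finset.sum_mul, R.green.d_sum] at h1
  simp only [← mul_div_assoc, ← Finset.sum_div] at h1
  nlinarith [mul_nonneg R.η_nonneg (sq_nonneg ‖R.θbar‖)]

/-- Expand the square with ‖φ‖ ≤ 1 and replace the mean of c⟨φ, θbar⟩ by means of the normal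
equation. All terms in `θbar` then have a nonpositive coefficient, so no power of 1/μ enters. -/
lemma sum_noise_sq_le : ∑ z, d z * ∑ z', P z z' * ‖R.noise z z'‖ ^ 2 ≤ R.U ^ 2 := by
  obtain ⟨s, hs⟩ : ∃ s : ι → ℝ, s = fun z => inner ℝ (R.φ z) R.θbar := ⟨_, rfl⟩
  have hs' : ∀ z, inner ℝ (R.φ z) R.θbar = s z := fun z => by rw [hs]
  have h1 : ∀ z z', ‖R.noise z z'‖ ^ 2 ≤ R.U ^ 2 - (2 + 2 * R.η) * (R.c z z' * s z)
      + ((1 + 2 * R.η) * s z ^ 2 + R.η ^ 2 * ‖R.θbar‖ ^ 2) := by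
    intro z z'
    have h2 : ‖R.φ z‖ ^ 2 ≤ 1 := pow_le_one₀ (norm_nonneg _) (R.norm_φ_le z)
    rw [noise, norm_add_sq_real, norm_neg, norm_smul, norm_smul, inner_neg_left, inner_smul_left,
      inner_smul_right, mul_pow, mul_pow, Real.norm_eq_abs, Real.norm_eq_abs, sq_abs, sq_abs, hs']
    simp only [conj_trivial]
    nlinarith [R.c_sq_le z z', mul_nonneg (sq_nonneg (R.c z z' - s z)) (sub_nonneg.2 h2)]
  have h2 := R.normal_eq_inner
  have h3 : ∑ z, d z * ∑ z', P z z' * ‖R.noise z z'‖ ^ 2 ≤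
      ∑ z, d z * (R.U ^ 2 - (2 + 2 * R.η) * ∑ z', P z z' * (R.c z z' * s z)
      + ((1 + 2 * R.η) * s z ^ 2 + R.η ^ 2 * ‖R.θbar‖ ^ 2)) := by
    refine Finset.sum_le_sum fun z _ => mul_le_mul_of_nonneg_left ?_ (R.green.d_nonneg z)
    refine (Finset.sum_le_sum fun z' _ =>
      mul_le_mul_of_nonneg_left (h1 z z') (R.green.P_nonneg z z')).trans_eq ?_
    simp only [mul_add, mul_sub, Finset.sum_add_distrib, Finset.sum_sub_distrib, ← Finset.sum_mul,
      R.green.P_sum, one_mul, mul_left_comm (P _ _) (2 + 2 * R.η), ← Finset.mul_sum]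
  refine h3.trans ?_
  simp only [hs'] at h2
  simp only [mul_add, mul_sub, Finset.sum_add_distrib, Finset.sum_sub_distrib, ← Finset.sum_mul,
      R.green.d_sum, one_mul, mul_left_comm (d _) (2 + 2 * R.η),
      mul_left_comm (d _) (1 + 2 * R.η), ← Finset.mul_sum]
  rw [← h2]
  have h4 : 0 ≤ ∑ z, d z * s z ^ 2 :=
    Finset.sum_nonneg fun z _ => mul_nonneg (R.green.d_nonneg z) (sq_nonneg _)
  nlinarith [mul_nonneg R.η_nonneg (sq_nonneg ‖R.θbar‖), sq_nonneg (R.η * ‖R.θbar‖)]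

/-- A uniform bound of the noise. -/
def noiseBound : ℝ := R.U + (1 + R.η) * ‖R.θbar‖

lemma norm_noise_le (z z' : ι) : ‖R.noise z z'‖ ≤ R.noiseBound := by
  have h1 : |R.c z z' - inner ℝ (R.φ z) R.θbar| ≤ R.U + ‖R.θbar‖ :=
    (abs_sub _ _).trans (add_le_add (R.abs_c_le z z') (R.abs_inner_φ_le _ z))
  refine (norm_add_le _ _).trans ?_
  rw [norm_neg, norm_smul, norm_smul, Real.norm_eq_abs, Real.norm_of_nonneg R.η_nonneg, noiseBound]
  have := mul_le_of_le_one_right (abs_nonneg (R.c z z' - inner ℝ (R.φ z) R.θbar)) (R.norm_φ_le z)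
  linarith

lemma norm_θbar_sq_le : R.μ * ‖R.θbar‖ ^ 2 ≤ R.U ^ 2 := (R.coercive _).trans R.energy_le

/-- In contrast to the stationary mean, the uniform bound sees ‖θbar‖, and coercivity controls this
only at the price of 1/μ. It is used only where an additional factor α compensates. -/
lemma noiseBound_sq_le : R.μ * R.noiseBound ^ 2 ≤ 2 * R.U ^ 2 * (R.μ + (1 + R.η) ^ 2) := by
  have h := mul_le_mul_of_nonneg_left R.norm_θbar_sq_le (sq_nonneg (1 + R.η))
  have h2 : R.noiseBound ^ 2 ≤ 2 * R.U ^ 2 + 2 * ((1 + R.η) * ‖R.θbar‖) ^ 2 := by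
    rw [noiseBound]; nlinarith [sq_nonneg (R.U - (1 + R.η) * ‖R.θbar‖)]
  nlinarith [mul_le_mul_of_nonneg_left h2 R.μ_pos.le]

lemma norm_noiseMean_sq_le (z : ι) : ‖R.noiseMean z‖ ^ 2 ≤ ∑ z', P z z' * ‖R.noise z z'‖ ^ 2 := by
  have h1 : ‖R.noiseMean z‖ ≤ ∑ z', P z z' * ‖R.noise z z'‖ := by
    refine (norm_sum_le _ _).trans_eq (Finset.sum_congr rfl fun z' _ => ?_)
    rw [norm_smul, Real.norm_of_nonneg (R.green.P_nonneg z z')]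
  refine (pow_le_pow_left₀ (norm_nonneg _) h1 2).trans ?_
  have := Finset.sum_sq_le_sum_mul_sum_of_sq_le_mul Finset.univ (r := fun z' => P z z' * ‖R.noise z z'‖)
    (f := fun z' => P z z') (g := fun z' => P z z' * ‖R.noise z z'‖ ^ 2)
    (fun z' _ => R.green.P_nonneg z z')
    (fun z' _ => mul_nonneg (R.green.P_nonneg z z') (sq_nonneg _)) (fun z' _ => le_of_eq (by ring))
  rwa [R.green.P_sum, one_mul] at this

lemma norm_noiseMean_le (z : ι) : ‖R.noiseMean z‖ ≤ R.noiseBound := by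
  refine (norm_sum_le _ _).trans ?_
  simp only [norm_smul, Real.norm_of_nonneg (R.green.P_nonneg z _)]
  exact R.sum_P_mul_le z (R.norm_noise_le z)

/-- The potential of the mean noise. -/
def noisePot (z : ι) : E := R.green.pot R.noiseMean z

lemma norm_noisePot_le (z : ι) : ‖R.noisePot z‖ ≤ T * R.noiseBound :=
  R.green.norm_pot_le R.norm_noiseMean_le z

lemma sum_noisePot_sq_le : ∑ z, d z * ‖R.noisePot z‖ ^ 2 ≤ 4 * T ^ 2 * R.U ^ 2 := by
  refine (R.green.sum_d_norm_pot_sq_le R.sum_d_noiseMean).trans ?_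
  refine mul_le_mul_of_nonneg_left (le_trans ?_ R.sum_noise_sq_le) (by positivity)
  exact Finset.sum_le_sum fun z _ =>
    mul_le_mul_of_nonneg_left (R.norm_noiseMean_sq_le z) (R.green.d_nonneg z)

/-- The second-order contribution of the noise in one step. -/
def var (z : ι) : ℝ := ∑ z', P z z' * (7 * T * ‖R.noise z z'‖ ^ 2 + ‖R.noisePot z'‖ ^ 2 / T)

/-- The stationary mean of `var`. -/
def varMean : ℝ := ∑ z, d z * R.var z

/-- 11 = 7 + 4: seven from the noise itself and four from the L² bound 4T²U² of its potential,
divided by T. -/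
lemma varMean_le : R.varMean ≤ 11 * T * R.U ^ 2 := by
  have hT := R.green.one_le
  have h1 : R.varMean = 7 * T * (∑ z, d z * ∑ z', P z z' * ‖R.noise z z'‖ ^ 2) +
      (∑ z, d z * ‖R.noisePot z‖ ^ 2) / T := by
    rw [← R.green.sum_d_mul_sum fun z => ‖R.noisePot z‖ ^ 2]
    simp only [varMean, var, mul_add, Finset.sum_add_distrib, Finset.mul_sum, Finset.sum_div,
      mul_left_comm _ (7 * T), mul_div_assoc]
  rw [h1]
  have h2 : (∑ z, d z * ‖R.noisePot z‖ ^ 2) / T ≤ 4 * T * R.U ^ 2 := by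
    rw [div_le_iff₀ (by linarith)]
    exact R.sum_noisePot_sq_le.trans_eq (by ring)
  have h3 := mul_le_mul_of_nonneg_left R.sum_noise_sq_le (by linarith : 0 ≤ 7 * T)
  linarith

lemma var_nonneg (z : ι) : 0 ≤ R.var z := by
  have hT := R.green.one_le
  exact Finset.sum_nonneg fun z' _ => mul_nonneg (R.green.P_nonneg z z') (by positivity)

lemma var_le (z : ι) : R.var z ≤ 8 * T * R.noiseBound ^ 2 := by
  have hT := R.green.one_le
  refine R.sum_P_mul_le z fun z' => ?_
  have h1 := pow_le_pow_left₀ (norm_nonneg _) (R.norm_noise_le z z') 2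
  have h2 := pow_le_pow_left₀ (norm_nonneg _) (R.norm_noisePot_le z') 2
  have h3 : ‖R.noisePot z'‖ ^ 2 / T ≤ T * R.noiseBound ^ 2 := by
    rw [div_le_iff₀ (by linarith)]; linarith
  nlinarith

/-- The potential of the centred `var`. -/
def varPot (z : ι) : ℝ := R.green.pot (fun z => R.var z - R.varMean) z

lemma abs_varPot_le (z : ι) : |R.varPot z| ≤ 8 * T ^ 2 * R.noiseBound ^ 2 := by
  have h : ∀ z, ‖R.var z - R.varMean‖ ≤ 8 * T * R.noiseBound ^ 2 := by
    intro z
    have h1 : 0 ≤ R.varMean :=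
      Finset.sum_nonneg fun z _ => mul_nonneg (R.green.d_nonneg z) (R.var_nonneg z)
    have h2 : R.varMean ≤ 8 * T * R.noiseBound ^ 2 := R.sum_d_le R.var_le
    rw [Real.norm_eq_abs, abs_le]
    constructor <;> linarith [R.var_nonneg z, R.var_le z]
  exact (R.green.norm_pot_le h z).trans_eq (by ring)

lemma sum_P_varPot (z : ι) : ∑ z', P z z' * R.varPot z' = R.varPot z - (R.var z - R.varMean) :=
  R.green.sum_P_smul_pot (f := fun z => R.var z - R.varMean) (by
    simp only [smul_eq_mul, mul_sub, Finset.sum_sub_distrib, ← Finset.sum_mul, R.green.d_sum]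
    simp [varMean]) z

/-- The potential of the deviation of the linear part. -/
def linPot (y : E) (z : ι) : E := R.green.pot (R.linDev y) z

lemma linPot_add (y₁ y₂ : E) (z : ι) : R.linPot (y₁ + y₂) z = R.linPot y₁ z + R.linPot y₂ z := by
  rw [linPot, linPot, linPot, ← R.green.pot_add]
  congr 1
  funext u
  exact R.linDev_add _ _ _

lemma norm_linPot_le (y : E) (z : ι) : ‖R.linPot y z‖ ≤ 2 * T * ‖y‖ :=
  (R.green.norm_pot_le (R.norm_linDev_le y) z).trans_eq (by ring)

/-- The Lyapunov function of the recursion with step size `α`. -/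
def lyap (α : ℝ) (y : E) (z : ι) : ℝ :=
  ‖y‖ ^ 2 - α * inner ℝ y (R.linPot y z) - 2 * α * inner ℝ y (R.noisePot z) + α ^ 2 * R.varPot z

/-- One step of the recursion. -/
def step (α : ℝ) (y : E) (z z' : ι) : E := y - α • (R.lin y z + R.noise z z')

variable {α : ℝ}

/-- Expand the Lyapunov function at y + Δ. Terms linear in Δ paired with y are kept exactly; those
in which Δ meets a potential or itself go into `lyapunov_increment_le`, with the remaining noise as
the quantity averaged in `var`. -/
lemma lyap_step_le (hα : 0 < α) (h1 : α * T * (1 + R.η) ^ 2 ≤ R.μ / 48)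
    (h2 : α * T * (1 + R.η) ^ 2 ≤ 1 / 192) (y : E) (z z' : ι) :
    R.lyap α (R.step α y z z') z' ≤ (‖y‖ ^ 2 - α * inner ℝ y (R.lin y z) + α * R.μ / 12 * ‖y‖ ^ 2)
      - α * inner ℝ y (R.linPot y z') - 2 * α * inner ℝ y (R.noisePot z')
      - 2 * α * inner ℝ y (R.noise z z') + α ^ 2 * R.varPot z'
      + α ^ 2 * (7 * T * ‖R.noise z z'‖ ^ 2 + ‖R.noisePot z'‖ ^ 2 / T) := by
  have hT := R.green.one_le
  obtain ⟨Δ, hΔ⟩ : ∃ Δ, Δ = -(α • (R.lin y z + R.noise z z')) := ⟨_, rfl⟩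
  have hstep : R.step α y z z' = y + Δ := by rw [hΔ, step, sub_eq_add_neg]
  have hnΔ : ‖Δ‖ ≤ α * (‖R.lin y z‖ + ‖R.noise z z'‖) := by
    rw [hΔ, norm_neg, norm_smul, Real.norm_of_nonneg hα.le]
    exact mul_le_mul_of_nonneg_left (norm_add_le _ _) hα.le
  have hyΔ : inner ℝ y Δ = -(α * inner ℝ y (R.lin y z)) - α * inner ℝ y (R.noise z z') := by
    rw [hΔ, inner_neg_right, inner_smul_right, inner_add_right]; ring
  have key := lyapunov_increment_le (n := ‖y‖) (ω := ‖R.noise z z'‖) (v := ‖R.noisePot z'‖) hα hT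
    (by linarith [R.η_nonneg]) h1 h2 (R.norm_lin_sq_le y z)
  obtain ⟨D, hD⟩ : ∃ D, D = α * (‖R.lin y z‖ + ‖R.noise z z'‖) := ⟨_, rfl⟩
  rw [← hD] at key hnΔ
  have hn0 := norm_nonneg Δ
  have i1 : |inner ℝ Δ (R.linPot y z')| ≤ D * (2 * T * ‖y‖) :=
    (abs_real_inner_le_norm _ _).trans (mul_le_mul hnΔ (R.norm_linPot_le _ _) (norm_nonneg _)
      (hn0.trans hnΔ))
  have i2 : |inner ℝ y (R.linPot Δ z')| ≤ ‖y‖ * (2 * T * D) :=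
    (abs_real_inner_le_norm _ _).trans (mul_le_mul_of_nonneg_left
      ((R.norm_linPot_le _ _).trans (mul_le_mul_of_nonneg_left hnΔ (by linarith)))
      (norm_nonneg _))
  have i3 : |inner ℝ Δ (R.linPot Δ z')| ≤ D * (2 * T * D) :=
    (abs_real_inner_le_norm _ _).trans (mul_le_mul hnΔ
      ((R.norm_linPot_le _ _).trans (mul_le_mul_of_nonneg_left hnΔ (by linarith)))
      (norm_nonneg _) (hn0.trans hnΔ))
  have i4 : |inner ℝ Δ (R.noisePot z')| ≤ D * ‖R.noisePot z'‖ :=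
    (abs_real_inner_le_norm _ _).trans (mul_le_mul_of_nonneg_right hnΔ (norm_nonneg _))
  have i5 : ‖Δ‖ ^ 2 ≤ D ^ 2 := pow_le_pow_left₀ hn0 hnΔ 2
  rw [hstep, lyap, linPot_add, norm_add_sq_real]
  simp only [inner_add_left, inner_add_right]
  rw [hyΔ]
  have j1 := mul_le_mul_of_nonneg_left ((neg_le_abs _).trans i1) hα.le
  have j2 := mul_le_mul_of_nonneg_left ((neg_le_abs _).trans i2) hα.le
  have j3 := mul_le_mul_of_nonneg_left ((neg_le_abs _).trans i3) hα.le
  have j4 := mul_le_mul_of_nonneg_left ((neg_le_abs _).trans i4) hα.le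
  nlinarith

/-- Averaging over z' with the Poisson equations cancels the mean noise and replaces `var` by its
stationary mean. The linear potential enters `lyap` with coefficient α, not 2α: it averages only the
half of the drift that `lyap_step_le` has left, and this half becomes -αμ‖y‖². Of it 1/12 pays for
the αμ/12 lost there. -/
lemma sum_P_lyap_step_le (hα : 0 < α) (h1 : α * T * (1 + R.η) ^ 2 ≤ R.μ / 48)
    (h2 : α * T * (1 + R.η) ^ 2 ≤ 1 / 192) (y : E) (z : ι) :
    ∑ z', P z z' * R.lyap α (R.step α y z z') z' ≤
      R.lyap α y z - 11 / 12 * (α * R.μ) * ‖y‖ ^ 2 + α ^ 2 * (11 * T * R.U ^ 2) := by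
  refine (Finset.sum_le_sum fun z' _ => mul_le_mul_of_nonneg_left
    (R.lyap_step_le hα h1 h2 y z z') (R.green.P_nonneg z z')).trans ?_
  have e1 : ∑ z', P z z' * inner ℝ y (R.linPot y z') =
      inner ℝ y (R.linPot y z) - inner ℝ y (R.linDev y z) := by
    rw [← inner_sub_right, linPot, ← R.green.sum_P_smul_pot (R.sum_d_linDev y) z, inner_sum]
    simp only [inner_smul_right, linPot]
  have e2 : ∑ z', P z z' * inner ℝ y (R.noisePot z') =
      inner ℝ y (R.noisePot z) - inner ℝ y (R.noiseMean z) := by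
    rw [← inner_sub_right, noisePot, ← R.green.sum_P_smul_pot R.sum_d_noiseMean z, inner_sum]
    simp only [inner_smul_right, noisePot]
  have e3 : ∑ z', P z z' * inner ℝ y (R.noise z z') = inner ℝ y (R.noiseMean z) := by
    rw [noiseMean, inner_sum]
    simp only [inner_smul_right]
  have e4 := R.sum_P_varPot z
  have e5 : ∑ z', P z z' * (7 * T * ‖R.noise z z'‖ ^ 2 + ‖R.noisePot z'‖ ^ 2 / T) = R.var z := rfl
  obtain ⟨k, hk⟩ : ∃ k, k = ‖y‖ ^ 2 - α * inner ℝ y (R.lin y z) + α * R.μ / 12 * ‖y‖ ^ 2 :=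
    ⟨_, rfl⟩
  have e6 : ∑ z', P z z' * k = k := by rw [← Finset.sum_mul, R.green.P_sum, one_mul]
  have hsum : ∑ z', P z z' * (k - α * inner ℝ y (R.linPot y z') - 2 * α * inner ℝ y (R.noisePot z')
      - 2 * α * inner ℝ y (R.noise z z') + α ^ 2 * R.varPot z'
      + α ^ 2 * (7 * T * ‖R.noise z z'‖ ^ 2 + ‖R.noisePot z'‖ ^ 2 / T)) =
      k - α * (inner ℝ y (R.linPot y z) - inner ℝ y (R.linDev y z))
      - 2 * α * (inner ℝ y (R.noisePot z) - inner ℝ y (R.noiseMean z))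
      - 2 * α * inner ℝ y (R.noiseMean z) + α ^ 2 * (R.varPot z - (R.var z - R.varMean))
      + α ^ 2 * R.var z := by
    rw [← e1, ← e2, ← e3, ← e4, ← e5]
    conv_rhs => rw [← e6]
    simp only [Finset.mul_sum, ← Finset.sum_sub_distrib, ← Finset.sum_add_distrib]
    exact Finset.sum_congr rfl fun z' _ => by ring
  rw [← hk, hsum, hk, lyap]
  have h3 := mul_le_mul_of_nonneg_left (R.le_inner_lin_sub y z) hα.le
  have h4 := mul_le_mul_of_nonneg_left R.varMean_le (sq_nonneg α)
  linarith

/-- Each correction carries a factor αT, so `lyap` is comparable with ‖y‖² up to the noise floor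
αTU²/μ. The factor 1/μ in the noise bound is of the same order as this floor. -/
lemma abs_lyap_sub_le (hα : 0 < α) (h2 : α * T * (1 + R.η) ^ 2 ≤ 1 / 192) (y : E) (z : ι) :
    |R.lyap α y z - ‖y‖ ^ 2| ≤ 5 / 96 * ‖y‖ ^ 2 + 3 / 4 * (α * T * R.U ^ 2 / R.μ) := by
  have hT := R.green.one_le
  have hη := R.η_nonneg
  have hαT : α * T ≤ 1 / 192 := by
    refine le_trans ?_ h2
    exact le_mul_of_one_le_right (by positivity) (one_le_pow₀ (by linarith))
  have k1 : |inner ℝ y (R.linPot y z)| ≤ ‖y‖ * (2 * T * ‖y‖) :=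
    (abs_real_inner_le_norm _ _).trans
      (mul_le_mul_of_nonneg_left (R.norm_linPot_le _ _) (norm_nonneg _))
  have k2 : |inner ℝ y (R.noisePot z)| ≤ ‖y‖ * (T * R.noiseBound) :=
    (abs_real_inner_le_norm _ _).trans
      (mul_le_mul_of_nonneg_left (R.norm_noisePot_le _) (norm_nonneg _))
  have k3 := R.abs_varPot_le z
  have b1 : |R.lyap α y z - ‖y‖ ^ 2| ≤ α * (‖y‖ * (2 * T * ‖y‖))
      + 2 * α * (‖y‖ * (T * R.noiseBound)) + α ^ 2 * (8 * T ^ 2 * R.noiseBound ^ 2) := by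
    have m1 := mul_le_mul_of_nonneg_left k1 hα.le
    have m2 := mul_le_mul_of_nonneg_left k2 (by linarith : 0 ≤ 2 * α)
    have m3 := mul_le_mul_of_nonneg_left k3 (sq_nonneg α)
    rw [lyap]
    have : ‖y‖ ^ 2 - α * inner ℝ y (R.linPot y z) - 2 * α * inner ℝ y (R.noisePot z)
        + α ^ 2 * R.varPot z - ‖y‖ ^ 2 = -(α * inner ℝ y (R.linPot y z))
        + -(2 * α * inner ℝ y (R.noisePot z)) + α ^ 2 * R.varPot z := by ring
    rw [this]
    refine (abs_add_three _ _ _).trans ?_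
    rw [abs_neg, abs_neg, abs_mul, abs_mul (2 * α), abs_mul (α ^ 2), abs_of_pos hα,
      abs_of_pos (by linarith : 0 < 2 * α), abs_of_nonneg (sq_nonneg α)]
    linarith
  have b2 : 2 * α * (‖y‖ * (T * R.noiseBound)) ≤
      1 / 24 * ‖y‖ ^ 2 + 24 * (α * T * R.noiseBound) ^ 2 := by
    nlinarith [sq_nonneg (‖y‖ - 24 * (α * T * R.noiseBound))]
  have b3 : 32 * (α * T * R.noiseBound) ^ 2 ≤ 3 / 4 * (α * T * R.U ^ 2 / R.μ) := by
    have c1 := R.noiseBound_sq_le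
    have hμ := R.μ_pos
    have c2 : R.μ + (1 + R.η) ^ 2 ≤ 2 * (1 + R.η) ^ 2 := by nlinarith [R.μ_le]
    rw [← mul_div_assoc, le_div_iff₀ hμ]
    calc 32 * (α * T * R.noiseBound) ^ 2 * R.μ
        = 32 * (α * T) ^ 2 * (R.μ * R.noiseBound ^ 2) := by ring
      _ ≤ 32 * (α * T) ^ 2 * (2 * R.U ^ 2 * (2 * (1 + R.η) ^ 2)) := by
        refine mul_le_mul_of_nonneg_left (c1.trans ?_) (by positivity)
        exact mul_le_mul_of_nonneg_left c2 (by positivity)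
      _ = 128 * (α * T * R.U ^ 2) * (α * T * (1 + R.η) ^ 2) := by ring
      _ ≤ 128 * (α * T * R.U ^ 2) * (1 / 192) :=
        mul_le_mul_of_nonneg_left h2 (by positivity)
      _ ≤ _ := by nlinarith [show 0 ≤ α * T * R.U ^ 2 by positivity]
  have b4 : α * (‖y‖ * (2 * T * ‖y‖)) ≤ 1 / 96 * ‖y‖ ^ 2 := by
    nlinarith [mul_le_mul_of_nonneg_right hαT (sq_nonneg ‖y‖)]
  nlinarith

lemma lyap_le (hα : 0 < α) (h2 : α * T * (1 + R.η) ^ 2 ≤ 1 / 192) (y : E) (z : ι) :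
    R.lyap α y z ≤ 2 * ‖y‖ ^ 2 + α * T * R.U ^ 2 / R.μ := by
  have hT := R.green.one_le
  have hμ := R.μ_pos
  have h := (abs_le.1 (R.abs_lyap_sub_le hα h2 y z)).2
  have : 0 ≤ α * T * R.U ^ 2 / R.μ := by positivity
  nlinarith [sq_nonneg ‖y‖]

lemma norm_sq_le_lyap (hα : 0 < α) (h2 : α * T * (1 + R.η) ^ 2 ≤ 1 / 192) (y : E) (z : ι) :
    ‖y‖ ^ 2 ≤ 11 / 10 * R.lyap α y z + α * T * R.U ^ 2 / R.μ := by
  have hT := R.green.one_le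
  have hμ := R.μ_pos
  have h := (abs_le.1 (R.abs_lyap_sub_le hα h2 y z)).1
  have : 0 ≤ α * T * R.U ^ 2 / R.μ := by positivity
  nlinarith [sq_nonneg ‖y‖]

/-- The drift inequality of the Lyapunov function. -/
lemma lyap_drift (hα : 0 < α) (h1 : α * T * (1 + R.η) ^ 2 ≤ R.μ / 48)
    (h2 : α * T * (1 + R.η) ^ 2 ≤ 1 / 192) (y : E) (z : ι) :
    ∑ z', P z z' * R.lyap α (R.step α y z z') z' ≤
      (1 - 3 / 4 * (α * R.μ)) * R.lyap α y z + 12 * (α * R.μ) * (α * T * R.U ^ 2 / R.μ) := by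
  have hT := R.green.one_le
  have hμ := R.μ_pos
  refine (R.sum_P_lyap_step_le hα h1 h2 y z).trans ?_
  have h := (abs_le.1 (R.abs_lyap_sub_le hα h2 y z)).2
  obtain ⟨b, hb⟩ : ∃ b, b = α * T * R.U ^ 2 / R.μ := ⟨_, rfl⟩
  have hb0 : 0 ≤ b := by rw [hb]; positivity
  have h3 : α ^ 2 * (11 * T * R.U ^ 2) = 11 * (α * R.μ) * b := by rw [hb]; field_simp
  rw [h3, ← hb]
  rw [← hb] at h
  -- Here (3/4)(1 + 5/96) ≤ 11/12 and (3/4)(3/4) ≤ 1; the extra b raises the constant from 11 to 12.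
  have h4 : 3 / 4 * R.lyap α y z ≤ 11 / 12 * ‖y‖ ^ 2 + b := by nlinarith [sq_nonneg ‖y‖]
  nlinarith [mul_le_mul_of_nonneg_left h4 (by positivity : 0 ≤ α * R.μ)]

end RidgeProblem
end

noncomputable section

namespace RegLinearMDP

variable {S : Type u} {A : Type v} [Fintype S] [Fintype A] {h : ℕ} (M : RegLinearMDP S A h)

/-! ### The Gram matrix and the regularized projection -/

lemma qfun_apply (θ : EuclideanSpace ℝ (Fin h)) (z : S × A) :
    M.qfun θ z = Inner.inner ℝ (M.feat z) θ := by
  simp [qfun, Phi, Matrix.mulVec, dotProduct, PiLp.inner_apply, mul_comm]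

lemma qfun_sub (θ₁ θ₂ : EuclideanSpace ℝ (Fin h)) :
    M.qfun (θ₁ - θ₂) = M.qfun θ₁ - M.qfun θ₂ := by
  funext z
  simp [qfun_apply, inner_sub_right]

lemma norm_qfun_le (hφ : ∀ z, ‖M.feat z‖ ≤ 1) (θ : EuclideanSpace ℝ (Fin h)) :
    ‖M.qfun θ‖ ≤ ‖θ‖ := by
  refine (pi_norm_le_iff_of_nonneg (norm_nonneg _)).2 fun z => ?_
  rw [qfun_apply]
  exact (norm_inner_le_norm _ _).trans (mul_le_of_le_one_left (norm_nonneg _) (hφ z))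

variable (d : S × A → ℝ)

lemma PhiTD_mulVec (q : S × A → ℝ) :
    WithLp.toLp 2 ((M.PhiTD d).mulVec q) = ∑ z, d z • (q z • M.feat z) := by
  ext j
  simp only [PhiTD, Matrix.mulVec, dotProduct, Matrix.of_apply, WithLp.ofLp_sum,
    Finset.sum_apply, WithLp.ofLp_smul, Pi.smul_apply, smul_eq_mul]
  exact Finset.sum_congr rfl fun z _ => by ring

lemma gram_mulVec (θ : EuclideanSpace ℝ (Fin h)) :
    WithLp.toLp 2 ((M.gram d).mulVec θ.ofLp) = ∑ z, d z • (Inner.inner ℝ (M.feat z) θ • M.feat z) := by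
  rw [gram, ← Matrix.mulVec_mulVec, PhiTD_mulVec]
  simp only [← qfun_apply]
  rfl

lemma dotProduct_gram_mulVec (θ : EuclideanSpace ℝ (Fin h)) :
    θ.ofLp ⬝ᵥ (M.gram d).mulVec θ.ofLp = ∑ z, d z * Inner.inner ℝ (M.feat z) θ ^ 2 := by
  have h1 : θ.ofLp ⬝ᵥ (M.gram d).mulVec θ.ofLp =
      Inner.inner ℝ (WithLp.toLp 2 ((M.gram d).mulVec θ.ofLp)) θ := by
    simp [EuclideanSpace.inner_eq_star_dotProduct]
  rw [h1, gram_mulVec, sum_inner]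
  refine Finset.sum_congr rfl fun z _ => ?_
  simp only [inner_smul_left, conj_trivial]
  ring

lemma gram_isHermitian : (M.gram d).IsHermitian := by
  ext i j
  simp only [Matrix.conjTranspose_apply, gram, Matrix.mul_apply, PhiTD, Phi, Matrix.of_apply,
    star_trivial]
  exact Finset.sum_congr rfl fun z _ => by ring

variable {d}

lemma spectrum_gram_subset (hφ : ∀ z, ‖M.feat z‖ ≤ 1) (hd : ∀ z, 0 ≤ d z) (hd1 : ∑ z, d z = 1) :
    spectrum ℝ (M.gram d) ⊆ Set.Icc 0 1 := by
  rw [(M.gram_isHermitian d).spectrum_real_eq_range_eigenvalues]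
  rintro _ ⟨i, rfl⟩
  obtain ⟨v, hv⟩ : ∃ v, v = (M.gram_isHermitian d).eigenvectorBasis i := ⟨_, rfl⟩
  have h1 : ‖v‖ = 1 := hv ▸ (M.gram_isHermitian d).eigenvectorBasis.norm_eq_one i
  have h2 := M.dotProduct_gram_mulVec d v
  rw [hv, (M.gram_isHermitian d).mulVec_eigenvectorBasis i, ← hv, dotProduct_smul,
    show v.ofLp ⬝ᵥ v.ofLp = ‖v‖ ^ 2 by
      rw [EuclideanSpace.real_norm_sq_eq]; simp [dotProduct, sq], h1] at h2
  simp only [smul_eq_mul, one_pow, mul_one] at h2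
  rw [h2]
  refine ⟨Finset.sum_nonneg fun z _ => mul_nonneg (hd z) (sq_nonneg _), ?_⟩
  rw [← hd1]
  refine Finset.sum_le_sum fun z _ => mul_le_of_le_one_right (hd z) ?_
  rw [sq_le_one_iff_abs_le_one]
  refine (abs_real_inner_le_norm _ _).trans ?_
  rw [h1, mul_one]
  exact hφ z

lemma eta_le_mu (hφ : ∀ z, ‖M.feat z‖ ≤ 1) (hd : ∀ z, 0 ≤ d z) (hd1 : ∑ z, d z = 1) :
    M.η ≤ M.mu d :=
  le_add_of_nonneg_left (Real.sInf_nonneg fun _ hx => (M.spectrum_gram_subset hφ hd hd1 hx).1)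

lemma mu_pos (hφ : ∀ z, ‖M.feat z‖ ≤ 1) (hd : ∀ z, 0 ≤ d z) (hd1 : ∑ z, d z = 1) :
    0 < M.mu d := M.η_pos.trans_le (M.eta_le_mu hφ hd hd1)

lemma ell_le (hφ : ∀ z, ‖M.feat z‖ ≤ 1) (hd : ∀ z, 0 ≤ d z) (hd1 : ∑ z, d z = 1) :
    M.ell d ≤ 1 + M.η :=
  add_le_add (Real.sSup_le (fun _ hx => (M.spectrum_gram_subset hφ hd hd1 hx).2) zero_le_one) le_rfl

lemma mu_le_ell (hφ : ∀ z, ‖M.feat z‖ ≤ 1) (hd : ∀ z, 0 ≤ d z) (hd1 : ∑ z, d z = 1) :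
    M.mu d ≤ M.ell d := by
  refine add_le_add ?_ le_rfl
  -- The spectrum is empty for h = 0; infimum and supremum then both take the default value 0.
  rcases (spectrum ℝ (M.gram d)).eq_empty_or_nonempty with he | ⟨x, hx⟩
  · simp [he]
  · have hsub := M.spectrum_gram_subset hφ hd hd1
    exact (csInf_le ⟨0, fun y hy => (hsub hy).1⟩ hx).trans (le_csSup ⟨1, fun y hy => (hsub hy).2⟩ hx)

/-- Shifting the Gram matrix by its least eigenvalue leaves a matrix with nonnegative eigenvalues,
hence a positive semidefinite one. -/
lemma mu_mul_norm_sq_le (hφ : ∀ z, ‖M.feat z‖ ≤ 1) (hd : ∀ z, 0 ≤ d z) (hd1 : ∑ z, d z = 1)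
    (y : EuclideanSpace ℝ (Fin h)) :
    M.mu d * ‖y‖ ^ 2 ≤ ∑ z, d z * Inner.inner ℝ (M.feat z) y ^ 2 + M.η * ‖y‖ ^ 2 := by
  obtain ⟨c, hc⟩ : ∃ c, c = sInf (spectrum ℝ (M.gram d)) := ⟨_, rfl⟩
  have hH : (M.gram d - algebraMap ℝ _ c).IsHermitian := by
    refine (M.gram_isHermitian d).sub ?_
    rw [Algebra.algebraMap_eq_smul_one]
    ext i j
    simp [Matrix.one_apply, eq_comm]
  have hpsd : (M.gram d - algebraMap ℝ _ c).PosSemidef := by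
    rw [hH.posSemidef_iff_eigenvalues_nonneg]
    intro i
    have hi := hH.eigenvalues_mem_spectrum_real i
    rw [← spectrum.sub_singleton_eq] at hi
    obtain ⟨x, hx, y, hy, hxy⟩ := hi
    have h1 : c ≤ x := hc ▸ csInf_le ⟨0, fun y hy => (M.spectrum_gram_subset hφ hd hd1 hy).1⟩ hx
    simp only [Set.mem_singleton_iff] at hy
    rw [← hxy, hy]
    simpa using h1
  have h1 := hpsd.dotProduct_mulVec_nonneg y.ofLp
  rw [Matrix.sub_mulVec, Algebra.algebraMap_eq_smul_one, Matrix.smul_mulVec, Matrix.one_mulVec,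
    star_trivial, dotProduct_sub, dotProduct_smul, dotProduct_gram_mulVec,
    show y.ofLp ⬝ᵥ y.ofLp = ‖y‖ ^ 2 by
      rw [EuclideanSpace.real_norm_sq_eq]; simp [dotProduct, sq], smul_eq_mul] at h1
  rw [mu, ← hc]
  linarith

lemma isUnit_det_reg (hd : ∀ z, 0 ≤ d z) :
    IsUnit (M.gram d + M.η • (1 : Matrix (Fin h) (Fin h) ℝ)).det := by
  rw [← Matrix.isUnit_iff_isUnit_det, ← Matrix.mulVec_injective_iff_isUnit]
  refine (injective_iff_map_eq_zero (Matrix.mulVecLin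
    (M.gram d + M.η • (1 : Matrix (Fin h) (Fin h) ℝ)))).2 fun v hv => ?_
  have h1 : v ⬝ᵥ (M.gram d + M.η • (1 : Matrix (Fin h) (Fin h) ℝ)).mulVec v = 0 := by
    rw [← Matrix.mulVecLin_apply, hv, dotProduct_zero]
  rw [Matrix.add_mulVec, Matrix.smul_mulVec, Matrix.one_mulVec, dotProduct_add, dotProduct_smul,
    smul_eq_mul] at h1
  have h2 := M.dotProduct_gram_mulVec d (WithLp.toLp 2 v)
  simp only at h2
  have h3 : 0 ≤ v ⬝ᵥ (M.gram d).mulVec v := by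
    rw [h2]
    exact Finset.sum_nonneg fun z _ => mul_nonneg (hd z) (sq_nonneg _)
  have h4 : 0 ≤ v ⬝ᵥ v := Finset.sum_nonneg fun i _ => mul_self_nonneg _
  have h5 : v ⬝ᵥ v = 0 := by nlinarith [M.η_pos]
  exact dotProduct_self_eq_zero.1 h5

/-- The minimizer of the regularized projection of `q`, in parameter form. -/
def solve (d : S × A → ℝ) (q : S × A → ℝ) : EuclideanSpace ℝ (Fin h) :=
  WithLp.toLp 2 ((M.regSolve d).mulVec q)

lemma normal_eq (hd : ∀ z, 0 ≤ d z) (q : S × A → ℝ) :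
    ∑ z, d z • (Inner.inner ℝ (M.feat z) (M.solve d q) • M.feat z) + M.η • M.solve d q =
      ∑ z, d z • (q z • M.feat z) := by
  rw [← gram_mulVec, ← PhiTD_mulVec, ← WithLp.toLp_ofLp (p := 2) (M.η • M.solve d q),
    ← WithLp.toLp_add]
  congr 1
  have h1 : (M.solve d q).ofLp = (M.gram d + M.η • (1 : Matrix (Fin h) (Fin h) ℝ))⁻¹.mulVec
      ((M.PhiTD d).mulVec q) := by
    rw [solve, regSolve, Matrix.mulVec_mulVec]
  have h2 : (M.gram d + M.η • (1 : Matrix (Fin h) (Fin h) ℝ)).mulVec (M.solve d q).ofLp =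
      (M.PhiTD d).mulVec q := by
    rw [h1, Matrix.mulVec_mulVec, Matrix.mul_nonsing_inv _ (M.isUnit_det_reg hd),
      Matrix.one_mulVec]
  rw [← h2, Matrix.add_mulVec, Matrix.smul_mulVec, Matrix.one_mulVec]
  rfl

/-! ### Contraction properties -/

lemma abs_iSup_sub_le [Nonempty A] (q₁ q₂ : S × A → ℝ) (s : S) :
    |(⨆ a, q₁ (s, a)) - ⨆ a, q₂ (s, a)| ≤ ‖q₁ - q₂‖ := by
  have key : ∀ q₁ q₂ : S × A → ℝ, (⨆ a, q₁ (s, a)) ≤ (⨆ a, q₂ (s, a)) + ‖q₁ - q₂‖ := by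
    intro q₁ q₂
    refine ciSup_le fun a => ?_
    have h1 := le_ciSup (Set.finite_range fun a => q₂ (s, a)).bddAbove a
    have h2 := (le_abs_self _).trans (norm_le_pi_norm (q₁ - q₂) (s, a))
    simp only [Pi.sub_apply] at h2
    linarith
  rw [abs_le]
  constructor
  · have := key q₂ q₁
    rw [norm_sub_rev] at this
    linarith
  · linarith [key q₁ q₂]

lemma abs_iSup_le [Nonempty A] (q : S × A → ℝ) (s : S) : |⨆ a, q (s, a)| ≤ ‖q‖ := by
  simpa using abs_iSup_sub_le q 0 s

lemma norm_bellman_sub_le [Nonempty A] (q₁ q₂ : S × A → ℝ) :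
    ‖M.bellman q₁ - M.bellman q₂‖ ≤ M.γ * ‖q₁ - q₂‖ := by
  have hγ := M.γ_pos.le
  refine (pi_norm_le_iff_of_nonneg (by positivity)).2 fun z => ?_
  simp only [Pi.sub_apply, bellman, ← Finset.sum_sub_distrib, Real.norm_eq_abs]
  refine (Finset.abs_sum_le_sum_abs _ _).trans ?_
  calc _ ≤ ∑ s', M.P z.1 z.2 s' * (M.γ * ‖q₁ - q₂‖) := by
        refine Finset.sum_le_sum fun s' _ => ?_
        rw [← mul_sub, abs_mul, abs_of_nonneg (M.P_nonneg _ _ _)]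
        refine mul_le_mul_of_nonneg_left ?_ (M.P_nonneg _ _ _)
        rw [add_sub_add_left_eq_sub, ← mul_sub, abs_mul, abs_of_nonneg hγ]
        exact mul_le_mul_of_nonneg_left (abs_iSup_sub_le _ _ _) hγ
    _ = _ := by rw [← Finset.sum_mul, M.P_sum, one_mul]

lemma gamNorm_nonneg : 0 ≤ M.gamNorm d :=
  Real.iSup_nonneg fun _ => Finset.sum_nonneg fun _ _ => abs_nonneg _

lemma contr_nonneg : 0 ≤ M.contr d := mul_nonneg M.γ_pos.le M.gamNorm_nonneg

lemma norm_Gam_mulVec_le (q : S × A → ℝ) : ‖(M.Gam d).mulVec q‖ ≤ M.gamNorm d * ‖q‖ := by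
  refine (pi_norm_le_iff_of_nonneg (mul_nonneg M.gamNorm_nonneg (norm_nonneg _))).2 fun z => ?_
  simp only [Matrix.mulVec, dotProduct, Real.norm_eq_abs]
  refine (Finset.abs_sum_le_sum_abs _ _).trans ?_
  simp only [abs_mul]
  calc _ ≤ ∑ z', |M.Gam d z z'| * ‖q‖ := Finset.sum_le_sum fun z' _ =>
        mul_le_mul_of_nonneg_left (norm_le_pi_norm q z') (abs_nonneg _)
    _ ≤ _ := by
      rw [← Finset.sum_mul]
      refine mul_le_mul_of_nonneg_right ?_ (norm_nonneg _)
      exact le_ciSup (f := fun z => ∑ z', |M.Gam d z z'|) (Set.finite_range _).bddAbove z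

lemma qfun_solve (q : S × A → ℝ) : M.qfun (M.solve d q) = (M.Gam d).mulVec q := by
  rw [qfun, solve, Gam, Matrix.mulVec_mulVec]

lemma solve_sub (q₁ q₂ : S × A → ℝ) : M.solve d (q₁ - q₂) = M.solve d q₁ - M.solve d q₂ := by
  rw [solve, Matrix.mulVec_sub, WithLp.toLp_sub]; rfl

/-- The target of an inner loop. -/
def target (d : S × A → ℝ) (θ : EuclideanSpace ℝ (Fin h)) : EuclideanSpace ℝ (Fin h) :=
  M.solve d (M.bellman (M.qfun θ))

lemma isRPBESolution_iff (θ : EuclideanSpace ℝ (Fin h)) :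
    M.IsRPBESolution d θ ↔ θ = M.target d θ := Iff.rfl

lemma norm_Gam_bellman_sub_le [Nonempty A] (q₁ q₂ : S × A → ℝ) :
    ‖(M.Gam d).mulVec (M.bellman q₁) - (M.Gam d).mulVec (M.bellman q₂)‖ ≤
      M.contr d * ‖q₁ - q₂‖ := by
  rw [← Matrix.mulVec_sub]
  refine (M.norm_Gam_mulVec_le _).trans ?_
  refine (mul_le_mul_of_nonneg_left (M.norm_bellman_sub_le _ _) M.gamNorm_nonneg).trans_eq ?_
  rw [contr]; ring

lemma norm_qfun_target_sub_le [Nonempty A] {θs : EuclideanSpace ℝ (Fin h)}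
    (hs : M.IsRPBESolution d θs) (θ : EuclideanSpace ℝ (Fin h)) :
    ‖M.qfun (M.target d θ - θs)‖ ≤ M.contr d * ‖M.qfun (θ - θs)‖ := by
  rw [isRPBESolution_iff] at hs
  conv_lhs => rw [hs]
  rw [qfun_sub, target, target, qfun_solve, qfun_solve, qfun_sub]
  exact M.norm_Gam_bellman_sub_le _ _

/-- Test the normal equation with its solution and use coercivity on the left and ‖φ‖ ≤ 1 on the
right. -/
lemma norm_solve_le (hφ : ∀ z, ‖M.feat z‖ ≤ 1) (hd : ∀ z, 0 ≤ d z) (hd1 : ∑ z, d z = 1)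
    (q : S × A → ℝ) : M.mu d * ‖M.solve d q‖ ≤ ‖q‖ := by
  have h1 := M.mu_mul_norm_sq_le hφ hd hd1 (M.solve d q)
  have h2 := congrArg (fun x => Inner.inner ℝ (M.solve d q) x) (M.normal_eq hd q)
  simp only [inner_add_right, inner_sum, inner_smul_right, real_inner_self_eq_norm_sq,
    real_inner_comm (M.feat _) (M.solve d q)] at h2
  simp only [sq (Inner.inner ℝ _ _)] at h1
  rw [h2] at h1
  have h3 : ∑ z, d z * (q z * Inner.inner ℝ (M.feat z) (M.solve d q)) ≤ ‖q‖ * ‖M.solve d q‖ := by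
    calc _ ≤ ∑ z, d z * (‖q‖ * ‖M.solve d q‖) := by
          refine Finset.sum_le_sum fun z _ => mul_le_mul_of_nonneg_left ?_ (hd z)
          refine (le_abs_self _).trans ?_
          rw [abs_mul]
          refine mul_le_mul (norm_le_pi_norm q z) ?_ (abs_nonneg _) (norm_nonneg _)
          exact (abs_real_inner_le_norm _ _).trans (mul_le_of_le_one_left (norm_nonneg _) (hφ z))
      _ = _ := by rw [← Finset.sum_mul, hd1, one_mul]
  rcases (norm_nonneg (M.solve d q)).eq_or_lt with h0 | h0
  · rw [← h0, mul_zero]; exact norm_nonneg _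
  · refine le_of_mul_le_mul_right ?_ h0
    linarith [sq ‖M.solve d q‖]

/-- The Euclidean error of the target is controlled by the ‖Φ·‖∞ error alone. This is how the
Euclidean error returns to the contracting quantity. -/
lemma norm_target_sub_le [Nonempty A] (hφ : ∀ z, ‖M.feat z‖ ≤ 1) (hd : ∀ z, 0 ≤ d z)
    (hd1 : ∑ z, d z = 1) {θs : EuclideanSpace ℝ (Fin h)} (hs : M.IsRPBESolution d θs)
    (θ : EuclideanSpace ℝ (Fin h)) :
    M.mu d * ‖M.target d θ - θs‖ ≤ ‖M.qfun (θ - θs)‖ := by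
  rw [isRPBESolution_iff] at hs
  conv_lhs => rw [hs]
  rw [target, target, ← solve_sub]
  refine (M.norm_solve_le hφ hd hd1 _).trans ((M.norm_bellman_sub_le _ _).trans ?_)
  rw [qfun_sub]
  exact mul_le_of_le_one_left (norm_nonneg _) M.γ_lt_one.le

/-- Banach's theorem is applied to q ↦ Γ_η T q on functions of state-action pairs, since ‖Φ·‖∞ need
not be a norm on parameters. The parameter is recovered from the fixed point q as `solve d (bellman
q)`. -/
lemma existsUnique_isRPBESolution [Nonempty A] (hx : M.contr d < 1) :
    ∃! θs : EuclideanSpace ℝ (Fin h), M.IsRPBESolution d θs := by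
  have hc : ContractingWith ⟨M.contr d, M.contr_nonneg⟩
      (fun q : S × A → ℝ => (M.Gam d).mulVec (M.bellman q)) :=
    ⟨hx, LipschitzWith.of_dist_le_mul fun q₁ q₂ => by
      rw [dist_eq_norm, dist_eq_norm]
      exact M.norm_Gam_bellman_sub_le q₁ q₂⟩
  obtain ⟨q, hq⟩ : ∃ q, q = ContractingWith.fixedPoint _ hc := ⟨_, rfl⟩
  have hfix : (M.Gam d).mulVec (M.bellman q) = q := hq ▸ hc.fixedPoint_isFixedPt
  refine ⟨M.solve d (M.bellman q), ?_, fun θ hθ => ?_⟩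
  · change _ = M.solve d (M.bellman (M.qfun (M.solve d (M.bellman q))))
    rw [qfun_solve, hfix]
  · replace hθ : θ = M.target d θ := hθ
    have h1 : M.qfun θ = q := by
      rw [hq]
      refine hc.fixedPoint_unique ?_
      change (M.Gam d).mulVec (M.bellman (M.qfun θ)) = M.qfun θ
      conv_rhs => rw [hθ]
      rw [target, qfun_solve]
    rw [← h1]
    exact hθ

/-! ### The inner loop as a regularized regression problem -/

/-- The regression problem solved by an inner loop with target parameter `θ'`. -/
def ridge [DecidableEq (S × A)] [Nonempty A] {T Rm : ℝ} (g : GreenKernel M.chainMatrix d T)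
    (hφ : ∀ z, ‖M.feat z‖ ≤ 1) (hRm : 0 ≤ Rm) (hr : ∀ s a s', |M.r s a s'| ≤ Rm)
    (θ' : EuclideanSpace ℝ (Fin h)) :
    RidgeProblem M.chainMatrix d T (EuclideanSpace ℝ (Fin h)) where
  green := g
  φ := M.feat
  c z z' := M.r z.1 z.2 z'.1 + M.γ * ⨆ a, M.qfun θ' (z'.1, a)
  θbar := M.target d θ'
  η := M.η
  μ := M.mu d
  U := Rm + M.γ * ‖M.qfun θ'‖
  norm_φ_le := hφ
  η_nonneg := M.η_pos.le
  μ_pos := M.mu_pos hφ g.d_nonneg g.d_sum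
  μ_le := (M.mu_le_ell hφ g.d_nonneg g.d_sum).trans (M.ell_le hφ g.d_nonneg g.d_sum)
  coercive := M.mu_mul_norm_sq_le hφ g.d_nonneg g.d_sum
  U_nonneg := add_nonneg hRm (mul_nonneg M.γ_pos.le (norm_nonneg _))
  abs_c_le z z' := by
    refine (abs_add_le _ _).trans (add_le_add (hr _ _ _) ?_)
    rw [abs_mul, abs_of_pos M.γ_pos]
    exact mul_le_mul_of_nonneg_left (abs_iSup_le _ _) M.γ_pos.le
  -- The target depends on the next pair only through its state, so the behaviour policy sums out
  -- and the Bellman operator remains.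
  normal_eq := by
    rw [target, M.normal_eq g.d_nonneg]
    refine Finset.sum_congr rfl fun z _ => ?_
    congr 2
    simp only [bellman, chainMatrix, Matrix.of_apply, Fintype.sum_prod_type]
    refine Finset.sum_congr rfl fun s' _ => ?_
    simp only [mul_right_comm _ (M.pol _ _)]
    rw [← Finset.mul_sum, M.pol_sum, mul_one]

lemma inner_succ_sub [DecidableEq (S × A)] [Nonempty A] {T Rm : ℝ}
    (g : GreenKernel M.chainMatrix d T)
    (hφ : ∀ z, ‖M.feat z‖ ≤ 1) (hRm : 0 ≤ Rm) (hr : ∀ s a s', |M.r s a s'| ≤ Rm)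
    (α : ℝ) (x : ℕ → S × A) (θ' : EuclideanSpace ℝ (Fin h)) (n k : ℕ) :
    M.inner α x θ' n (k + 1) - M.target d θ' = (M.ridge g hφ hRm hr θ').step α
      (M.inner α x θ' n k - M.target d θ') (x (n + k)) (x (n + k + 1)) := by
  rw [RegLinearMDP.inner, RidgeProblem.step, sub_right_comm]
  congr 2
  simp only [grad, RidgeProblem.lin, RidgeProblem.noise, ridge, qfun_apply, inner_sub_right,
    sub_smul, add_smul, smul_sub]
  abel

end RegLinearMDP
end

noncomputable section

/-! ### Functions of finitely many steps of a finite-valued process -/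

open Classical in
/-- The indicator of the paths that avoid `z₀` at the times `1, …, n`. -/
def avoid {Z : Type*} (z₀ : Z) (n : ℕ) (x : ℕ → Z) : ℝ :=
  if ∀ i, 1 ≤ i → i ≤ n → x i ≠ z₀ then 1 else 0

lemma dependsOn_avoid {Z : Type*} (z₀ : Z) (n : ℕ) : DependsOn (avoid z₀ n) (Set.Iic n) := by
  intro x y hxy
  simp only [avoid]
  congr 1
  exact propext ⟨fun H i h1 h2 => by rw [← hxy i h2]; exact H i h1 h2,
    fun H i h1 h2 => by rw [hxy i h2]; exact H i h1 h2⟩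

section FinitePaths

variable {Z : Type*} {Ω : Type*}

/-- The path up to time `n`. -/
def pathTo (X : ℕ → Ω → Z) (n : ℕ) (ω : Ω) : Fin (n + 1) → Z := fun i => X i ω

/-- A path up to time `n`, continued by its last value. -/
def extendPath {n : ℕ} (p : Fin (n + 1) → Z) : ℕ → Z :=
  fun i => p ⟨min i n, Nat.lt_succ_of_le (min_le_right i n)⟩

lemma extendPath_pathTo (X : ℕ → Ω → Z) {n i : ℕ} (hi : i ≤ n) (ω : Ω) :
    extendPath (pathTo X n ω) i = X i ω := by
  simp [extendPath, pathTo, hi]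

lemma DependsOn.apply_extendPath {β : Type*} {n : ℕ} {f : (ℕ → Z) → β}
    (hf : DependsOn f (Set.Iic n)) (X : ℕ → Ω → Z) (ω : Ω) :
    f (fun i => X i ω) = f (extendPath (pathTo X n ω)) :=
  hf fun _ hi => (extendPath_pathTo X hi ω).symm

variable [MeasurableSpace Z] [MeasurableSpace Ω]

lemma measurable_pathTo {X : ℕ → Ω → Z} (hX : ∀ n, Measurable (X n)) (n : ℕ) :
    Measurable (pathTo X n) :=
  measurable_pi_iff.2 fun i => hX i

variable [MeasurableSingletonClass Z] [Fintype Z]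

/-- Such a function factors through the finite set of paths up to time n, where everything is
measurable and bounded. -/
lemma DependsOn.integrable {Pr : Measure Ω} [IsFiniteMeasure Pr] {X : ℕ → Ω → Z}
    (hX : ∀ n, Measurable (X n)) {n : ℕ} {f : (ℕ → Z) → ℝ} (hf : DependsOn f (Set.Iic n)) :
    Integrable (fun ω => f (fun i => X i ω)) Pr := by
  simp only [hf.apply_extendPath X]
  exact (Integrable.of_finite (f := fun p : Fin (n + 1) → Z => f (extendPath p))
    (μ := Pr.map (pathTo X n))).comp_measurable (measurable_pathTo hX n)

end FinitePaths

namespace RegLinearMDP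

variable {S : Type u} {A : Type v} [Fintype S] [Fintype A] {h : ℕ} (M : RegLinearMDP S A h)
  [MeasurableSpace S] [MeasurableSingletonClass S]
  [MeasurableSpace A] [MeasurableSingletonClass A]

variable {M} in
/-- The Markov property of a trajectory. -/
lemma IsTrajectory.integral_succ {Ω : Type w} [MeasurableSpace Ω] {Pr : Measure Ω}
    [IsProbabilityMeasure Pr] {X : ℕ → Ω → S × A} (hX : M.IsTrajectory Pr X) {n : ℕ}
    {f : (ℕ → S × A) → S × A → ℝ} (hf : ∀ z', DependsOn (fun x => f x z') (Set.Iic n)) :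
    ∫ ω, f (fun i => X i ω) (X (n + 1) ω) ∂Pr =
      ∫ ω, ∑ z', M.chainMatrix (X n ω) z' * f (fun i => X i ω) z' ∂Pr := by
  classical
  have hm := measurable_pathTo hX.1 n
  have h1 : ∀ ω, f (fun i => X i ω) (X (n + 1) ω) =
      (fun q : (Fin (n + 1) → S × A) × (S × A) => f (extendPath q.1) q.2)
        (pathTo X n ω, X (n + 1) ω) :=
    fun ω => (hf (X (n + 1) ω)).apply_extendPath X ω
  have h2 : ∀ ω, ∑ z', M.chainMatrix (X n ω) z' * f (fun i => X i ω) z' =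
      (fun p : Fin (n + 1) → S × A =>
        ∑ z', M.chainMatrix (p (Fin.last n)) z' * f (extendPath p) z') (pathTo X n ω) :=
    fun ω => Finset.sum_congr rfl fun z' _ => by
      rw [(hf z').apply_extendPath X ω]; rfl
  simp only [h1, h2]
  rw [← integral_map (φ := fun ω => (pathTo X n ω, X (n + 1) ω))
      (f := fun q : (Fin (n + 1) → S × A) × (S × A) => f (extendPath q.1) q.2)
      (hm.prodMk (hX.1 (n + 1))).aemeasurable
      (Measurable.of_discrete.aestronglyMeasurable),
    ← integral_map (φ := pathTo X n) (f := fun p : Fin (n + 1) → S × A =>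
        ∑ z', M.chainMatrix (p (Fin.last n)) z' * f (extendPath p) z') hm.aemeasurable
      (Measurable.of_discrete.aestronglyMeasurable),
    integral_fintype Integrable.of_finite, integral_fintype Integrable.of_finite,
    Fintype.sum_prod_type]
  refine Finset.sum_congr rfl fun p _ => ?_
  rw [smul_eq_mul, Finset.mul_sum]
  refine Finset.sum_congr rfl fun z' _ => ?_
  have h3 : (Pr.map fun ω => (pathTo X n ω, X (n + 1) ω)) {(p, z')} =
      Pr.map (pathTo X n) {p} * ENNReal.ofReal (M.chainMatrix (p (Fin.last n)) z') := by
    rw [Measure.map_apply (hm.prodMk (hX.1 (n + 1))) (measurableSet_singleton _),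
      Measure.map_apply hm (measurableSet_singleton _)]
    -- The finite-dimensional identity is applied to the sequence that follows p up to time n and
    -- equals z' afterwards.
    have h4 := hX.2 n fun i => if i ≤ n then extendPath p i else z'
    have h5 : {ω | ∀ i ≤ n, X i ω = if i ≤ n then extendPath p i else z'} =
        pathTo X n ⁻¹' {p} := by
      ext ω
      simp only [Set.mem_ofPred_eq, Set.mem_preimage, Set.mem_singleton_iff, funext_iff]
      constructor
      · intro hω i
        have := hω i (Nat.le_of_lt_succ i.2)
        rw [if_pos (Nat.le_of_lt_succ i.2)] at this
        rw [pathTo, this, extendPath]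
        congr 1
        ext
        simpa using Nat.le_of_lt_succ i.2
      · intro hω i hi
        rw [if_pos hi, extendPath, ← hω]
        simp [pathTo, hi]
    have h6 : {ω | ∀ i ≤ n + 1, X i ω = if i ≤ n then extendPath p i else z'} =
        (fun ω => (pathTo X n ω, X (n + 1) ω)) ⁻¹' {(p, z')} := by
      have : (fun ω => (pathTo X n ω, X (n + 1) ω)) ⁻¹' {(p, z')} =
          pathTo X n ⁻¹' {p} ∩ {ω | X (n + 1) ω = z'} := by
        ext ω; simp
      rw [this, ← h5]
      ext ω
      simp only [Set.mem_ofPred_eq, Set.mem_inter_iff]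
      constructor
      · intro hω
        exact ⟨fun i hi => hω i (by omega), by simpa using hω (n + 1) le_rfl⟩
      · rintro ⟨hω, hω'⟩ i hi
        rcases Nat.le_succ_iff.1 hi with hi | rfl
        · exact hω i hi
        · simpa using hω'
    rw [← h6, h4, h5]
    simp [extendPath, Fin.last]
  rw [measureReal_def, h3, ENNReal.toReal_mul, ENNReal.toReal_ofReal (M.chainMatrix_nonneg _ _),
    ← measureReal_def, smul_eq_mul, mul_assoc]

/-! ### Expected hitting times -/

lemma chainLaw_eq_traj (z : S × A) : M.chainLaw z =
    Kernel.traj (X := fun _ => S × A) (fun n =>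
      M.stepKernel.comap (fun x : (∀ _ : Finset.Iic n, S × A) => x ⟨n, by simp⟩) (by fun_prop)) 0
      (fun _ => z) := by
  have h1 : (Measure.dirac z).map
      (MeasurableEquiv.piUnique (fun _ : Finset.Iic 0 => S × A)).symm = Measure.dirac fun _ => z :=
    Measure.map_dirac' (MeasurableEquiv.measurable _) z
  refine (congrArg (fun μ => Measure.bind μ _) h1).trans ?_
  exact Measure.dirac_bind (Kernel.measurable _) _

instance (z : S × A) : IsProbabilityMeasure (M.chainLaw z) := by
  rw [chainLaw]; infer_instance

lemma chainLaw_zero (z : S × A) : ∀ᵐ x ∂(M.chainLaw z), x 0 = z := by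
  have h1 : (M.chainLaw z).map (Preorder.frestrictLe (π := fun _ => S × A) 0) =
      Measure.dirac fun _ => z := by
    rw [chainLaw_eq_traj, Kernel.traj_map_frestrictLe_apply, Kernel.partialTraj_self,
      Kernel.id_apply]
  have h2 : ∀ᵐ y ∂((M.chainLaw z).map (Preorder.frestrictLe (π := fun _ => S × A) 0)),
      y ⟨0, by simp⟩ = z := by
    rw [h1, ae_dirac_iff]
    have hm : Measurable fun x : Finset.Iic 0 → S × A => x ⟨0, by simp⟩ := measurable_pi_apply _
    exact hm (measurableSet_singleton z)
  exact ae_of_ae_map (by fun_prop) h2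

lemma isTrajectory_chainLaw (z : S × A) :
    M.IsTrajectory (M.chainLaw z) (fun n (x : ℕ → S × A) => x n) := by
  refine ⟨fun n => measurable_pi_apply n, fun n y => ?_⟩
  have h1 := Kernel.map_frestrictLe_trajMeasure_compProd_eq_map_trajMeasure
    (X := fun _ => S × A) (μ₀ := Measure.dirac z) (κ := fun n =>
      M.stepKernel.comap (fun x : (∀ _ : Finset.Iic n, S × A) => x ⟨n, by simp⟩) (by fun_prop))
    (a := n)
  have h2 := congrArg (fun μ => μ ({fun i : Finset.Iic n => y i} ×ˢ {y (n + 1)})) h1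
  change ((M.chainLaw z).map _ ⊗ₘ _) _ = (M.chainLaw z).map _ _ at h2
  rw [Measure.compProd_apply_prod (measurableSet_singleton _) (measurableSet_singleton _),
    lintegral_singleton,
    Measure.map_apply (by fun_prop) ((measurableSet_singleton _).prod (measurableSet_singleton _)),
    Measure.map_apply (by fun_prop) (measurableSet_singleton _), Kernel.comap_apply] at h2
  have h3 : M.stepKernel (y n) {y (n + 1)} = ENNReal.ofReal (M.chainMatrix (y n) (y (n + 1))) := by
    classical
    change (∑ z', ENNReal.ofReal (M.chainMatrix (y n) z') • Measure.dirac z') {y (n + 1)} = _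
    simp [Measure.coe_finsetSum, Finset.sum_apply, Measure.dirac_apply' _ (measurableSet_singleton _),
      Set.indicator_apply]
  have h4 : (fun x : ℕ → S × A => (Preorder.frestrictLe (π := fun _ => S × A) n x, x (n + 1))) ⁻¹'
      ({fun i : Finset.Iic n => y i} ×ˢ {y (n + 1)}) = {x | ∀ i ≤ n + 1, x i = y i} := by
    ext x
    simp only [Set.mem_preimage, Set.mem_prod, Set.mem_singleton_iff, funext_iff, Set.mem_ofPred_eq,
      Subtype.forall, Finset.mem_Iic, Preorder.frestrictLe_apply]
    constructor
    · rintro ⟨h5, h6⟩ i hi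
      rcases Nat.le_succ_iff.1 hi with hi | rfl
      · exact h5 i hi
      · exact h6
    · exact fun h5 => ⟨fun i hi => h5 i (by omega), h5 _ le_rfl⟩
  have h5 : Preorder.frestrictLe (π := fun _ => S × A) n ⁻¹' {fun i : Finset.Iic n => y i} =
      {x | ∀ i ≤ n, x i = y i} := by
    ext x
    simp [funext_iff]
  rw [h4, h5] at h2
  rw [← h2, ← h3, mul_comm]

/-- The induction is run for the product of the indicator up to time n with the survival probability
over m further steps from the current state; the Markov property trades one unit of n for one of m.
-/
lemma integral_avoid [DecidableEq (S × A)] (z₀ z : S × A) (n : ℕ) :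
    ∫ x, avoid z₀ n x ∂(M.chainLaw z) = survival M.chainMatrix z₀ n z := by
  have key : ∀ n m, ∫ x, avoid z₀ n x * survival M.chainMatrix z₀ m (x n) ∂(M.chainLaw z) =
      survival M.chainMatrix z₀ (n + m) z := by
    intro n
    induction n with
    | zero =>
      intro m
      have h0 : ∀ x : ℕ → S × A, avoid z₀ 0 x = 1 := fun x =>
        if_pos fun i h1 h2 => absurd h1 (by omega)
      rw [integral_congr_ae (g := fun _ => survival M.chainMatrix z₀ (0 + m) z)]
      · simp
      · filter_upwards [M.chainLaw_zero z] with x hx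
        rw [h0, hx, one_mul, zero_add]
    | succ n ih =>
      intro m
      have h1 : ∀ x : ℕ → S × A, avoid z₀ (n + 1) x * survival M.chainMatrix z₀ m (x (n + 1)) =
          (fun x z' => avoid z₀ n x * if z' = z₀ then 0 else survival M.chainMatrix z₀ m z')
            x (x (n + 1)) := by
        intro x
        simp only [avoid]
        by_cases hz : x (n + 1) = z₀
        · rw [if_neg (fun H => H (n + 1) (by omega) le_rfl hz), if_pos hz]; simp
        · rw [if_neg hz]
          congr 2
          refine propext ⟨fun H i h1 h2 => H i h1 (by omega), fun H i h1 h2 => ?_⟩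
          rcases Nat.le_succ_iff.1 h2 with h2 | rfl
          · exact H i h1 h2
          · exact hz
      simp only [h1]
      refine ((M.isTrajectory_chainLaw z).integral_succ (n := n) (f := fun x z' =>
        avoid z₀ n x * if z' = z₀ then 0 else survival M.chainMatrix z₀ m z')
        (fun z' x y hxy => by simp only [dependsOn_avoid z₀ n hxy])).trans ?_
      rw [show n + 1 + m = n + (m + 1) by ring, ← ih (m + 1)]
      congr 1
      funext x
      rw [survival_succ, Finset.mul_sum]
      refine Finset.sum_congr rfl fun z' _ => ?_
      simp only [tabooMatrix, Matrix.of_apply]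
      split_ifs <;> ring
  have := key n 0
  simpa only [survival_zero, mul_one, add_zero] using this

/-- The tail-sum formula, including the value ∞; it expresses the expected hitting time as the sum
of survival probabilities. -/
lemma toENNReal_eq_tsum (k : ℕ∞) :
    ENat.toENNReal k = ∑' n : ℕ, if (n : ℕ∞) < k then (1 : ℝ≥0∞) else 0 := by
  induction k using ENat.recTopCoe with
  | top => simp
  | coe k =>
    rw [tsum_eq_sum (s := Finset.range k) (fun n hn => by
      simp only [Finset.mem_range] at hn
      rw [if_neg]; exact_mod_cast hn)]
    rw [Finset.sum_congr rfl (g := fun _ => (1 : ℝ≥0∞)) (fun n hn => by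
      simp only [Finset.mem_range] at hn
      rw [if_pos]; exact_mod_cast hn)]
    simp

lemma expectedHit_eq [DecidableEq (S × A)] (z₀ z : S × A) :
    M.expectedHit z₀ z = ∑' n, ENNReal.ofReal (survival M.chainMatrix z₀ n z) := by
  have hm : ∀ n, Measurable fun x : ℕ → S × A => ENNReal.ofReal (avoid z₀ n x) := by
    intro n
    have : (fun x : ℕ → S × A => ENNReal.ofReal (avoid z₀ n x)) = fun x =>
        ENNReal.ofReal (avoid z₀ n (extendPath (pathTo (fun i (x : ℕ → S × A) => x i) n x))) :=
      funext fun x => by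
        rw [← (dependsOn_avoid z₀ n).apply_extendPath (fun i (x : ℕ → S × A) => x i) x]
    rw [this]
    exact (Measurable.of_discrete (f := fun p : Fin (n + 1) → S × A =>
      ENNReal.ofReal (avoid z₀ n (extendPath p)))).comp
      (measurable_pathTo (fun i => measurable_pi_apply i) n)
  have h1 : ∀ x : ℕ → S × A,
      ENat.toENNReal (hittingAfter (fun n (x : ℕ → S × A) => x n) {z₀} 1 x) =
        ∑' n : ℕ, ENNReal.ofReal (avoid z₀ n x) := by
    intro x
    refine (toENNReal_eq_tsum _).trans (tsum_congr fun n => ?_)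
    have h2 : (n : ℕ∞) < hittingAfter (fun n (x : ℕ → S × A) => x n) {z₀} 1 x ↔
        ∀ i, 1 ≤ i → i ≤ n → x i ≠ z₀ := by
      have h3 := hittingAfter_le_iff (u := fun n (x : ℕ → S × A) => x n) (s := {z₀}) (n := 1)
        (ω := x) (i := n)
      refine ((not_le (α := ℕ∞)).symm.trans (not_congr h3)).trans ?_
      simp only [Set.mem_Icc, Set.mem_singleton_iff, not_exists, not_and, and_imp]
    rw [avoid]
    by_cases hc : ∀ i, 1 ≤ i → i ≤ n → x i ≠ z₀
    · rw [if_pos (h2.2 hc), if_pos hc, ENNReal.ofReal_one]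
    · rw [if_neg (fun H => hc (h2.1 H)), if_neg hc, ENNReal.ofReal_zero]
  rw [expectedHit, lintegral_congr h1, lintegral_tsum fun n => (hm n).aemeasurable]
  refine tsum_congr fun n => ?_
  rw [← M.integral_avoid, ofReal_integral_eq_lintegral_ofReal]
  · exact (dependsOn_avoid z₀ n).integrable (X := fun i (x : ℕ → S × A) => x i)
      (fun i => measurable_pi_apply i)
  · exact ae_of_all _ fun x => by simp only [avoid]; split_ifs <;> simp

/-- The point is finiteness: `toReal` would turn an infinite supremum into 0, and irreducibility
with finitely many states excludes this. -/
lemma tsum_survival_le_tauMax [DecidableEq (S × A)] (hirr : M.chainMatrix.IsIrreducible)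
    (z₀ z : S × A) : ∑' n, survival M.chainMatrix z₀ n z ≤ M.tauMax z₀ := by
  have hs := summable_survival (z₀ := z₀) M.chainMatrix_nonneg M.chainMatrix_sum hirr
  have h0 : ∀ z, ∀ n, 0 ≤ survival M.chainMatrix z₀ n z := fun z n =>
    survival_nonneg M.chainMatrix_nonneg n z
  have h1 : ∀ z, M.expectedHit z₀ z = ENNReal.ofReal (∑' n, survival M.chainMatrix z₀ n z) :=
    fun z => by rw [expectedHit_eq, ENNReal.ofReal_tsum_of_nonneg (h0 z) (hs z)]
  rw [tauMax, ← ENNReal.ofReal_le_iff_le_toReal, ← h1]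
  · exact le_iSup (fun z => M.expectedHit z₀ z) z
  · rw [← lt_top_iff_ne_top]
    obtain ⟨w, -, hw⟩ := Finset.exists_max_image Finset.univ (fun z => M.expectedHit z₀ z)
      ⟨z, Finset.mem_univ _⟩
    refine (iSup_le fun z => hw z (Finset.mem_univ _)).trans_lt ?_
    rw [h1]
    exact ENNReal.ofReal_lt_top

/-- The Green kernel of the chain of state-action pairs. -/
def green [DecidableEq (S × A)] {d : S × A → ℝ} (hirr : M.chainMatrix.IsIrreducible)
    (hd : M.IsStationary d) (z₀ : S × A) : GreenKernel M.chainMatrix d (M.tauMax z₀) :=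
  GreenKernel.ofIrreducible M.chainMatrix_nonneg M.chainMatrix_sum hirr hd.1 hd.2.1 hd.2.2 z₀
    (M.tsum_survival_le_tauMax hirr z₀)

end RegLinearMDP
end

/-! ### Coupled recursions and the mean square error of an inner loop -/

noncomputable section

/-- Here a and b are the mean square errors in ‖Φ·‖∞ and in Euclidean norm, y is the mean square
error of the inner loop, w = 1 - x, and ρ is the reduction by the inner loop. The weight p⁶ is small
enough that 2p⁶a/μ² ≤ 2p⁴a is a small part of wa, while ρ/w ≤ p¹¹ is still much smaller than p⁶, so
b feeds back only with a small multiple of p⁶b. -/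
lemma coupled_recursion_step {a b a' b' y w p ρ μ ε : ℝ} (hw : 0 < w) (hw1 : w ≤ 1) (hp : 0 < p)
    (hp3 : p ≤ 1 / 3) (hpw : p ≤ w) (hpμ : p ≤ μ) (hρp : ρ ≤ p ^ 12) (ha : 0 ≤ a)
    (hb : 0 ≤ b) (hε : 0 < ε)
    (hy : y ≤ 6 * ρ * (b + a / μ ^ 2) + w ^ 2 * (a / 10 + 5 / 16 * ε))
    (ha' : a' ≤ (1 - w) * a + y / w) (hb' : b' ≤ 2 * y + 2 * (a / μ ^ 2)) :
    a' + p ^ 6 * b' ≤ (1 - w / 2) * (a + p ^ 6 * b) + 2 / 5 * w * ε := by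
  have hμ : 0 < μ := hp.trans_le hpμ
  have hp1 : p ≤ 1 := by linarith
  have e1 : p ^ 2 * (a / μ ^ 2) ≤ a := by
    rw [mul_div_assoc', div_le_iff₀ (by positivity), mul_comm]
    exact mul_le_mul_of_nonneg_left (pow_le_pow_left₀ hp.le hpμ 2) ha
  have q0 : 0 ≤ a / μ ^ 2 := by positivity
  have hp2 : p ^ 2 ≤ 1 / 9 := (pow_le_pow_left₀ hp.le hp3 2).trans_eq (by norm_num)
  have hp3' : p ^ 3 ≤ 1 / 27 := (pow_le_pow_left₀ hp.le hp3 3).trans_eq (by norm_num)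
  have hp4 : p ^ 4 ≤ 1 / 81 := (pow_le_pow_left₀ hp.le hp3 4).trans_eq (by norm_num)
  have hp6 : p ^ 6 ≤ 1 / 729 := (pow_le_pow_left₀ hp.le hp3 6).trans_eq (by norm_num)
  -- Y bounds y/w, the form in which y enters the recursion of a: one power of p and one of w are
  -- given up for the division.
  obtain ⟨Y, hY⟩ : ∃ Y, Y = 6 * p ^ 11 * (b + a / μ ^ 2) + w * (a / 10 + 5 / 16 * ε) := ⟨_, rfl⟩
  have hY0 : 0 ≤ Y := by rw [hY]; positivity
  have hyw : y ≤ w * Y := by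
    refine hy.trans ?_
    have h1 : 6 * ρ * (b + a / μ ^ 2) ≤ w * (6 * p ^ 11 * (b + a / μ ^ 2)) := by
      have h2 : ρ ≤ w * p ^ 11 := hρp.trans (by
        rw [show p ^ 12 = p * p ^ 11 by ring]
        exact mul_le_mul_of_nonneg_right hpw (by positivity))
      nlinarith [mul_le_mul_of_nonneg_right h2 (add_nonneg hb q0)]
    rw [hY]
    nlinarith
  have h2 : y / w ≤ Y := by rw [div_le_iff₀ hw]; linarith
  have h3 : y ≤ Y := hyw.trans (mul_le_of_le_one_left hY0 hw1)
  have h4 : a' + p ^ 6 * b' ≤ (1 - w) * a + Y * (731 / 729) + 2 * p ^ 4 * a := by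
    have k1 : p ^ 6 * b' ≤ p ^ 6 * (2 * Y + 2 * (a / μ ^ 2)) :=
      mul_le_mul_of_nonneg_left (by linarith) (by positivity)
    have k2 : p ^ 6 * (2 * Y) ≤ 1 / 729 * (2 * Y) := mul_le_mul_of_nonneg_right hp6 (by linarith)
    have k3 : p ^ 6 * (2 * (a / μ ^ 2)) ≤ 2 * p ^ 4 * a := by
      have := mul_le_mul_of_nonneg_left e1 (by positivity : 0 ≤ 2 * p ^ 4)
      calc _ = 2 * p ^ 4 * (p ^ 2 * (a / μ ^ 2)) := by ring
        _ ≤ _ := this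
    linarith
  have h5 : 2 * p ^ 4 * a ≤ 2 / 27 * w * a := by
    have : p ^ 4 ≤ w * (1 / 27) := by
      rw [show p ^ 4 = p * p ^ 3 by ring]
      exact mul_le_mul hpw hp3' (by positivity) hw.le
    nlinarith [mul_le_mul_of_nonneg_right this ha]
  have h6 : 6 * p ^ 11 * (a / μ ^ 2) ≤ 6 / 729 * w * a := by
    have : p ^ 9 ≤ w * (1 / 729) := by
      rw [show p ^ 9 = p * p ^ 2 * p ^ 6 by ring]
      refine mul_le_mul ?_ hp6 (by positivity) hw.le
      exact (mul_le_of_le_one_right hp.le (by linarith)).trans hpw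
    calc _ = 6 * p ^ 9 * (p ^ 2 * (a / μ ^ 2)) := by ring
      _ ≤ 6 * p ^ 9 * a := mul_le_mul_of_nonneg_left e1 (by positivity)
      _ ≤ _ := by nlinarith [mul_le_mul_of_nonneg_right this ha]
  have h7 : 6 * p ^ 11 * b ≤ 6 / 81 * (p ^ 6 * b) := by
    have : p ^ 5 ≤ 1 / 81 := by
      rw [show p ^ 5 = p ^ 4 * p by ring]
      exact (mul_le_of_le_one_right (by positivity) hp1).trans hp4
    have hb6 : 0 ≤ p ^ 6 * b := by positivity
    calc _ = 6 * p ^ 5 * (p ^ 6 * b) := by ring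
      _ ≤ _ := by nlinarith [mul_le_mul_of_nonneg_right this hb6]
  have hb6 : 0 ≤ p ^ 6 * b := by positivity
  have hwa : 0 ≤ w * a := by positivity
  have hwε : 0 ≤ w * ε := by positivity
  have h8 : Y ≤ 6 / 81 * (p ^ 6 * b) + 6 / 729 * w * a + w * (a / 10 + 5 / 16 * ε) := by
    rw [hY]; linarith
  have h9 : w * (p ^ 6 * b) ≤ p ^ 6 * b := mul_le_of_le_one_left hb6 hw1
  linarith

lemma affine_recursion {m : ℕ → ℝ} {q c : ℝ} (hq : 0 ≤ q)
    (h : ∀ t, m (t + 1) ≤ q * m t + (1 - q) * c) (t : ℕ) : m t ≤ q ^ t * (m 0 - c) + c := by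
  induction t with
  | zero => simp
  | succ t ih =>
    refine (h t).trans ?_
    have := mul_le_mul_of_nonneg_left ih hq
    rw [pow_succ]
    linarith

namespace RegLinearMDP

variable {S : Type u} {A : Type v} [Fintype S] [Fintype A] {h : ℕ} (M : RegLinearMDP S A h)

lemma inner_congr {α : ℝ} {x y : ℕ → S × A} {θ' : EuclideanSpace ℝ (Fin h)} {n k : ℕ}
    (hxy : ∀ i ≤ n + k, x i = y i) : M.inner α x θ' n k = M.inner α y θ' n k := by
  induction k with
  | zero => rfl
  | succ k ih =>
    rw [RegLinearMDP.inner, RegLinearMDP.inner, ih fun i hi => hxy i (by omega),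
      hxy (n + k) (by omega), hxy (n + k + 1) (by omega)]

lemma dependsOn_outer (α : ℝ) (K : ℕ) (θ₀ : EuclideanSpace ℝ (Fin h)) (t : ℕ) :
    DependsOn (fun x => M.outer α K θ₀ x t) (Set.Iic (t * K)) := by
  induction t with
  | zero => intro x y _; rfl
  | succ t ih =>
    intro x y hxy
    simp only [outer]
    have hle : t * K ≤ (t + 1) * K := Nat.mul_le_mul_right K (Nat.le_succ t)
    rw [show M.outer α K θ₀ x t = M.outer α K θ₀ y t from
      ih fun i hi => hxy i (le_trans (Set.mem_Iic.1 hi) hle)]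
    exact M.inner_congr fun i hi => hxy i (by rw [Set.mem_Iic]; linarith [Nat.succ_mul t K])

variable [DecidableEq (S × A)] [Nonempty A] [MeasurableSpace S] [MeasurableSingletonClass S]
  [MeasurableSpace A] [MeasurableSingletonClass A] {d : S × A → ℝ} {T Rm : ℝ}

/-- The mean square distance to the target after an inner loop. -/
lemma integral_inner_loop_le (g : GreenKernel M.chainMatrix d T) (hφ : ∀ z, ‖M.feat z‖ ≤ 1)
    (hRm : 0 ≤ Rm) (hr : ∀ s a s', |M.r s a s'| ≤ Rm) {α : ℝ} (hα : 0 < α)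
    (h1 : α * T * (1 + M.η) ^ 2 ≤ M.mu d / 48) (h2 : α * T * (1 + M.η) ^ 2 ≤ 1 / 192)
    {Ω : Type w} [MeasurableSpace Ω] {Pr : Measure Ω} [IsProbabilityMeasure Pr]
    {X : ℕ → Ω → S × A} (hX : M.IsTrajectory Pr X) (K : ℕ) (θ₀ : EuclideanSpace ℝ (Fin h)) (t : ℕ) :
    ∫ ω, ‖M.outer α K θ₀ (fun n => X n ω) (t + 1) - M.target d (M.outer α K θ₀ (fun n => X n ω) t)‖
        ^ 2 ∂Pr ≤
      3 * (1 - 3 / 4 * (α * M.mu d)) ^ K * ∫ ω, ‖M.outer α K θ₀ (fun n => X n ω) t -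
        M.target d (M.outer α K θ₀ (fun n => X n ω) t)‖ ^ 2 ∂Pr +
      20 * (α * T / M.mu d) * ∫ ω, (Rm + M.γ * ‖M.qfun (M.outer α K θ₀ (fun n => X n ω) t)‖) ^ 2
        ∂Pr := by
  have hT := g.one_le
  have hμ := M.mu_pos hφ g.d_nonneg g.d_sum
  have hμle : M.mu d ≤ 1 + M.η :=
    (M.mu_le_ell hφ g.d_nonneg g.d_sum).trans (M.ell_le hφ g.d_nonneg g.d_sum)
  obtain ⟨θ', hθ'⟩ : ∃ θ' : (ℕ → S × A) → EuclideanSpace ℝ (Fin h),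
    θ' = fun x => M.outer α K θ₀ x t := ⟨_, rfl⟩
  have hdep : DependsOn θ' (Set.Iic (t * K)) := hθ' ▸ M.dependsOn_outer α K θ₀ t
  obtain ⟨R, hR⟩ : ∃ R : (ℕ → S × A) → RidgeProblem M.chainMatrix d T (EuclideanSpace ℝ (Fin h)),
    R = fun x => M.ridge g hφ hRm hr (θ' x) := ⟨_, rfl⟩
  obtain ⟨y, hy⟩ : ∃ y : ℕ → (ℕ → S × A) → EuclideanSpace ℝ (Fin h),
    y = fun k x => M.inner α x (θ' x) (t * K) k - M.target d (θ' x) := ⟨_, rfl⟩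
  have hydep : ∀ k, DependsOn (y k) (Set.Iic (t * K + k)) := by
    intro k x x' hxx
    have h3 : θ' x = θ' x' := hdep fun i hi => hxx i (by
      simp only [Set.mem_Iic] at hi ⊢; omega)
    simp only [hy, h3]
    rw [M.inner_congr (y := x') fun i hi => hxx i hi]
  have hRdep : ∀ k, DependsOn R (Set.Iic (t * K + k)) := by
    intro k x x' hxx
    simp only [hR]
    rw [hdep fun i hi => hxx i (by simp only [Set.mem_Iic] at hi ⊢; omega)]
  obtain ⟨β, hβ⟩ : ∃ β : (ℕ → S × A) → ℝ, β = fun x => α * T * (R x).U ^ 2 / M.mu d := ⟨_, rfl⟩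
  have hβdep : DependsOn β (Set.Iic (t * K)) := by
    intro x x' hxx
    simp only [hβ]
    rw [hRdep 0 (by simpa using hxx)]
  obtain ⟨L, hL⟩ : ∃ L : ℕ → (ℕ → S × A) → ℝ,
    L = fun k x => (R x).lyap α (y k x) (x (t * K + k)) := ⟨_, rfl⟩
  have hLdep : ∀ k, DependsOn (L k) (Set.Iic (t * K + k)) := by
    intro k x x' hxx
    simp only [hL]
    rw [hRdep k hxx, hydep k hxx, hxx (t * K + k) (Set.mem_Iic.2 le_rfl)]
  have hLint : ∀ k, Integrable (fun ω => L k fun n => X n ω) Pr := fun k =>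
    (hLdep k).integrable hX.1
  have hβint : Integrable (fun ω => β fun n => X n ω) Pr := hβdep.integrable hX.1
  have hη : ∀ x, (R x).η = M.η := fun x => by rw [hR]; rfl
  have hμR : ∀ x, (R x).μ = M.mu d := fun x => by rw [hR]; rfl
  have hβ0 : ∀ x, 0 ≤ β x := fun x => by rw [hβ]; positivity
  obtain ⟨r, hrdef⟩ : ∃ r, r = 3 / 4 * (α * M.mu d) := ⟨_, rfl⟩
  have hr0 : 0 < r := by rw [hrdef]; positivity
  have hr1 : r ≤ 1 := by
    have k1 : α * M.mu d ≤ α * T * (1 + M.η) ^ 2 := by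
      have : M.mu d ≤ T * (1 + M.η) ^ 2 := by
        nlinarith [M.η_pos, mul_le_mul hT (le_refl ((1 + M.η) ^ 2)) (by positivity) (by linarith)]
      rw [mul_assoc]
      exact mul_le_mul_of_nonneg_left this hα.le
    rw [hrdef]; linarith
  have hstep : ∀ k, ∫ ω, L (k + 1) (fun n => X n ω) ∂Pr ≤
      (1 - r) * ∫ ω, L k (fun n => X n ω) ∂Pr +
        (1 - (1 - r)) * (16 * ∫ ω, β (fun n => X n ω) ∂Pr) := by
    intro k
    -- The regression problem is random, but it is determined by the path up to time tK; given the
    -- path up to time tK + k it is fixed and only the next state is averaged.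
    have e1 := hX.integral_succ (n := t * K + k) (f := fun x z' =>
      (R x).lyap α ((R x).step α (y k x) (x (t * K + k)) z') z') (fun z' x x' hxx => by
        simp only
        rw [hRdep k hxx, hydep k hxx, hxx (t * K + k) (Set.mem_Iic.2 le_rfl)])
    have e2 : ∀ ω, L (k + 1) (fun n => X n ω) = (R fun n => X n ω).lyap α
        ((R fun n => X n ω).step α (y k fun n => X n ω) (X (t * K + k) ω) (X (t * K + k + 1) ω))
        (X (t * K + k + 1) ω) := by
      intro ω
      simp only [hL, hy, hR]
      rw [M.inner_succ_sub g hφ hRm hr]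
      rfl
    simp only [e2]
    rw [e1, show (1 - r) * ∫ ω, L k (fun n => X n ω) ∂Pr +
        (1 - (1 - r)) * (16 * ∫ ω, β (fun n => X n ω) ∂Pr) =
        ∫ ω, ((1 - r) * L k (fun n => X n ω) + 16 * r * β (fun n => X n ω)) ∂Pr by
      rw [integral_add ((hLint k).const_mul _) (hβint.const_mul _), integral_const_mul,
        integral_const_mul]
      ring]
    refine integral_mono (DependsOn.integrable hX.1 (n := t * K + k) (f := fun x =>
      ∑ z', M.chainMatrix (x (t * K + k)) z' * (R x).lyap α
        ((R x).step α (y k x) (x (t * K + k)) z') z') fun x x' hxx => by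
        simp only
        rw [hRdep k hxx, hydep k hxx, hxx (t * K + k) (Set.mem_Iic.2 le_rfl)])
      (((hLint k).const_mul _).add (hβint.const_mul _)) fun ω => ?_
    have h3 := (R fun n => X n ω).lyap_drift hα (by rw [hη, hμR]; exact h1) (by rw [hη]; exact h2)
      (y k fun n => X n ω) (X (t * K + k) ω)
    rw [hμR, ← hrdef] at h3
    refine h3.trans_eq ?_
    simp only [hL, hβ]
    -- With r = (3/4)αμ the drift constant 12αμ is 16r, so 16β is the fixed point of the affine
    -- recursion.
    rw [show 12 * (α * M.mu d) = 16 * r by rw [hrdef]; ring]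
  have hfin := affine_recursion (m := fun k => ∫ ω, L k (fun n => X n ω) ∂Pr)
    (sub_nonneg.2 hr1) hstep K
  have hρ0 : 0 ≤ (1 - r) ^ K := pow_nonneg (sub_nonneg.2 hr1) K
  have hρ1 : (1 - r) ^ K ≤ 1 := pow_le_one₀ (sub_nonneg.2 hr1) (by linarith)
  have hy2int : ∀ k, Integrable (fun ω => ‖y k fun n => X n ω‖ ^ 2) Pr := fun k =>
    DependsOn.integrable hX.1 (n := t * K + k) (f := fun x => ‖y k x‖ ^ 2)
      fun x x' hxx => by simp only; rw [hydep k hxx]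
  have hL0 : ∫ ω, L 0 (fun n => X n ω) ∂Pr ≤
      2 * ∫ ω, ‖y 0 (fun n => X n ω)‖ ^ 2 ∂Pr + ∫ ω, β (fun n => X n ω) ∂Pr := by
    rw [← integral_const_mul, ← integral_add ((hy2int 0).const_mul _) hβint]
    refine integral_mono (hLint 0) (((hy2int 0).const_mul _).add hβint) fun ω => ?_
    have h3 := (R fun n => X n ω).lyap_le hα (by rw [hη]; exact h2)
      (y 0 fun n => X n ω) (X (t * K + 0) ω)
    rw [hμR] at h3
    simp only [hL, hβ]
    exact h3
  have hLK : ∫ ω, ‖y K (fun n => X n ω)‖ ^ 2 ∂Pr ≤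
      11 / 10 * ∫ ω, L K (fun n => X n ω) ∂Pr + ∫ ω, β (fun n => X n ω) ∂Pr := by
    rw [← integral_const_mul, ← integral_add ((hLint K).const_mul _) hβint]
    refine integral_mono (hy2int K) (((hLint K).const_mul _).add hβint) fun ω => ?_
    have h3 := (R fun n => X n ω).norm_sq_le_lyap hα (by rw [hη]; exact h2)
      (y K fun n => X n ω) (X (t * K + K) ω)
    rw [hμR] at h3
    simp only [hL, hβ]
    exact h3
  have hy0 : ∀ x, y 0 x = M.outer α K θ₀ x t - M.target d (M.outer α K θ₀ x t) := by
    intro x; simp only [hy, hθ']; rfl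
  have hyK : ∀ x, y K x = M.outer α K θ₀ x (t + 1) - M.target d (M.outer α K θ₀ x t) := by
    intro x; simp only [hy, hθ']; rfl
  have hβe : 20 * (α * T / M.mu d) *
      ∫ ω, (Rm + M.γ * ‖M.qfun (M.outer α K θ₀ (fun n => X n ω) t)‖) ^ 2 ∂Pr =
      20 * ∫ ω, β (fun n => X n ω) ∂Pr := by
    rw [mul_assoc, ← integral_const_mul]
    congr 2
    funext ω
    simp only [hβ, hR, hθ', ridge]
    ring
  have hB0 : 0 ≤ ∫ ω, β (fun n => X n ω) ∂Pr := integral_nonneg fun ω => hβ0 _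
  have hY0 : 0 ≤ ∫ ω, ‖y 0 (fun n => X n ω)‖ ^ 2 ∂Pr := integral_nonneg fun ω => sq_nonneg _
  rw [hβe, ← hrdef]
  simp only [← hy0, ← hyK]
  have h4 := mul_le_mul_of_nonneg_left hL0 hρ0
  have h5 := mul_le_mul_of_nonneg_right hρ1 hB0
  have h6 := mul_nonneg hρ0 hY0
  have h7 := mul_nonneg hρ0 hB0
  linarith

end RegLinearMDP
end

/-! ### Contraction of the outer iteration -/

noncomputable section

namespace RegLinearMDP

variable {S : Type u} {A : Type v} [Fintype S] [Fintype A] {h : ℕ} (M : RegLinearMDP S A h)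

section Pointwise

lemma reward_bound_sq_le {Rm : ℝ} (hRm : 0 ≤ Rm) (θs θ : EuclideanSpace ℝ (Fin h)) :
    (Rm + M.γ * ‖M.qfun θ‖) ^ 2 ≤
      2 * (Rm + M.γ * ‖M.qfun θs‖) ^ 2 + 2 * M.γ ^ 2 * ‖M.qfun (θ - θs)‖ ^ 2 := by
  have hγ := M.γ_pos
  have k1 : ‖M.qfun θ‖ ≤ ‖M.qfun θs‖ + ‖M.qfun (θ - θs)‖ := by
    rw [qfun_sub]; linarith [norm_sub_norm_le (M.qfun θ) (M.qfun θs)]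
  have k2 : Rm + M.γ * ‖M.qfun θ‖ ≤ (Rm + M.γ * ‖M.qfun θs‖) + M.γ * ‖M.qfun (θ - θs)‖ := by
    linarith [mul_le_mul_of_nonneg_left k1 hγ.le]
  have k3 := (pow_le_pow_left₀ (by positivity) k2 2).trans add_sq_le
  rw [mul_pow M.γ] at k3
  linarith

variable [Nonempty A] {d : S × A → ℝ}

lemma norm_target_sub_sq_le (hφ : ∀ z, ‖M.feat z‖ ≤ 1) (hd : ∀ z, 0 ≤ d z) (hd1 : ∑ z, d z = 1)
    {θs : EuclideanSpace ℝ (Fin h)} (hs : M.IsRPBESolution d θs) (θ : EuclideanSpace ℝ (Fin h)) :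
    ‖M.target d θ - θs‖ ^ 2 ≤ ‖M.qfun (θ - θs)‖ ^ 2 / M.mu d ^ 2 := by
  have hμ := M.mu_pos hφ hd hd1
  rw [le_div_iff₀ (by positivity), ← mul_pow, mul_comm]
  exact pow_le_pow_left₀ (by positivity) (M.norm_target_sub_le hφ hd hd1 hs θ) 2

lemma norm_sub_target_sq_le (hφ : ∀ z, ‖M.feat z‖ ≤ 1) (hd : ∀ z, 0 ≤ d z) (hd1 : ∑ z, d z = 1)
    {θs : EuclideanSpace ℝ (Fin h)} (hs : M.IsRPBESolution d θs) (θ : EuclideanSpace ℝ (Fin h)) :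
    ‖θ - M.target d θ‖ ^ 2 ≤
      2 * ‖θ - θs‖ ^ 2 + 2 / M.mu d ^ 2 * ‖M.qfun (θ - θs)‖ ^ 2 := by
  have k1 : ‖θ - M.target d θ‖ ≤ ‖θ - θs‖ + ‖M.target d θ - θs‖ := by
    rw [show θ - M.target d θ = (θ - θs) - (M.target d θ - θs) by abel]
    exact norm_sub_le _ _
  have k2 := (pow_le_pow_left₀ (norm_nonneg _) k1 2).trans add_sq_le
  have k3 := M.norm_target_sub_sq_le hφ hd hd1 hs θ
  rw [div_mul_eq_mul_div, mul_div_assoc]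
  linarith

lemma norm_sub_sol_sq_le (hφ : ∀ z, ‖M.feat z‖ ≤ 1) (hd : ∀ z, 0 ≤ d z) (hd1 : ∑ z, d z = 1)
    {θs : EuclideanSpace ℝ (Fin h)} (hs : M.IsRPBESolution d θs)
    (θ θ₁ : EuclideanSpace ℝ (Fin h)) :
    ‖θ₁ - θs‖ ^ 2 ≤
      2 * ‖θ₁ - M.target d θ‖ ^ 2 + 2 / M.mu d ^ 2 * ‖M.qfun (θ - θs)‖ ^ 2 := by
  have k1 : ‖θ₁ - θs‖ ≤ ‖θ₁ - M.target d θ‖ + ‖M.target d θ - θs‖ :=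
    norm_sub_le_norm_sub_add_norm_sub _ _ _
  have k2 := (pow_le_pow_left₀ (norm_nonneg _) k1 2).trans add_sq_le
  have k3 := M.norm_target_sub_sq_le hφ hd hd1 hs θ
  rw [div_mul_eq_mul_div, mul_div_assoc]
  linarith

/-- The triangle inequality through the target gives xe + n for the old error e and the inner-loop
error n. By convexity of the square, with weights x and 1 - x, (xe + n)² ≤ xe² + n²/(1 - x). -/
lemma norm_qfun_sub_sol_sq_le (hφ : ∀ z, ‖M.feat z‖ ≤ 1) (hx : M.contr d < 1)
    {θs : EuclideanSpace ℝ (Fin h)} (hs : M.IsRPBESolution d θs)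
    (θ θ₁ : EuclideanSpace ℝ (Fin h)) :
    ‖M.qfun (θ₁ - θs)‖ ^ 2 ≤ M.contr d * ‖M.qfun (θ - θs)‖ ^ 2 +
      1 / (1 - M.contr d) * ‖θ₁ - M.target d θ‖ ^ 2 := by
  have hx0 := M.contr_nonneg (d := d)
  have hw : 0 < 1 - M.contr d := by linarith
  have k1 : ‖M.qfun (θ₁ - θs)‖ ≤ M.contr d * ‖M.qfun (θ - θs)‖ + ‖θ₁ - M.target d θ‖ := by
    rw [show θ₁ - θs = (θ₁ - M.target d θ) - (θs - M.target d θ) by abel, qfun_sub]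
    refine (norm_sub_le _ _).trans ?_
    rw [add_comm]
    refine add_le_add ?_ (M.norm_qfun_le hφ _)
    rw [qfun_sub, norm_sub_rev, ← qfun_sub]
    exact M.norm_qfun_target_sub_le hs θ
  have k2 := pow_le_pow_left₀ (norm_nonneg _) k1 2
  refine k2.trans ?_
  generalize ‖M.qfun (θ - θs)‖ = e
  generalize ‖θ₁ - M.target d θ‖ = n
  have k3 : M.contr d * e ^ 2 + 1 / (1 - M.contr d) * n ^ 2 - (M.contr d * e + n) ^ 2 =
      M.contr d * ((1 - M.contr d) * e - n) ^ 2 / (1 - M.contr d) := by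
    field_simp; ring
  have k4 : 0 ≤ M.contr d * ((1 - M.contr d) * e - n) ^ 2 / (1 - M.contr d) := by positivity
  linarith

end Pointwise

section Outer

variable [MeasurableSpace S] [MeasurableSingletonClass S]
  [MeasurableSpace A] [MeasurableSingletonClass A] {d : S × A → ℝ} {T Rm : ℝ}

lemma integrable_outer {Ω : Type w} [MeasurableSpace Ω] {Pr : Measure Ω} [IsProbabilityMeasure Pr]
    {X : ℕ → Ω → S × A} (hX : M.IsTrajectory Pr X) (α : ℝ) (K : ℕ)
    (θ₀ : EuclideanSpace ℝ (Fin h)) (t : ℕ)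
    (F : EuclideanSpace ℝ (Fin h) → EuclideanSpace ℝ (Fin h) → ℝ) :
    Integrable (fun ω => F (M.outer α K θ₀ (fun n => X n ω) t)
      (M.outer α K θ₀ (fun n => X n ω) (t + 1))) Pr :=
  DependsOn.integrable hX.1 (n := (t + 1) * K)
    (f := fun x => F (M.outer α K θ₀ x t) (M.outer α K θ₀ x (t + 1))) fun x y hxy => by
      have h1 := M.dependsOn_outer α K θ₀ (t + 1) hxy
      have h2 : M.outer α K θ₀ x t = M.outer α K θ₀ y t :=
        M.dependsOn_outer α K θ₀ t fun i hi =>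
          hxy i (le_trans (Set.mem_Iic.1 hi) (Nat.mul_le_mul_right K (Nat.le_succ t)))
      simp only at h1 ⊢
      rw [h1, h2]

variable [DecidableEq (S × A)] [Nonempty A]

/-- The mean square error after one inner loop. -/
lemma outer_step_le (g : GreenKernel M.chainMatrix d T) (hφ : ∀ z, ‖M.feat z‖ ≤ 1)
    (hRm : 0 ≤ Rm) (hr : ∀ s a s', |M.r s a s'| ≤ Rm) (hx : M.contr d < 1)
    {θs : EuclideanSpace ℝ (Fin h)} (hs : M.IsRPBESolution d θs) {ε α p : ℝ} (hε : 0 < ε)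
    (hα : 0 < α) (h1 : α * T * (1 + M.η) ^ 2 ≤ M.mu d / 48)
    (h2 : α * T * (1 + M.η) ^ 2 ≤ 1 / 192)
    (h3 : α * T * M.γ ^ 2 / M.mu d ≤ (1 - M.contr d) ^ 2 / 400)
    (h4 : α * T * (Rm + M.γ * ‖M.qfun θs‖) ^ 2 / M.mu d ≤ ε * (1 - M.contr d) ^ 2 / 128)
    {K : ℕ} (hp : 0 < p) (hp3 : p ≤ 1 / 3) (hpw : p ≤ 1 - M.contr d) (hpμ : p ≤ M.mu d)
    (hρp : (1 - 3 / 4 * (α * M.mu d)) ^ K ≤ p ^ 12) (hρ0 : 0 ≤ (1 - 3 / 4 * (α * M.mu d)) ^ K)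
    {Ω : Type w} [MeasurableSpace Ω] {Pr : Measure Ω} [IsProbabilityMeasure Pr]
    {X : ℕ → Ω → S × A} (hX : M.IsTrajectory Pr X) (θ₀ : EuclideanSpace ℝ (Fin h)) (t : ℕ) :
    ∫ ω, ‖M.qfun (M.outer α K θ₀ (fun n => X n ω) (t + 1) - θs)‖ ^ 2 ∂Pr +
        p ^ 6 * ∫ ω, ‖M.outer α K θ₀ (fun n => X n ω) (t + 1) - θs‖ ^ 2 ∂Pr ≤
      (1 - (1 - M.contr d) / 2) *
        (∫ ω, ‖M.qfun (M.outer α K θ₀ (fun n => X n ω) t - θs)‖ ^ 2 ∂Pr +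
          p ^ 6 * ∫ ω, ‖M.outer α K θ₀ (fun n => X n ω) t - θs‖ ^ 2 ∂Pr) +
        2 / 5 * (1 - M.contr d) * ε := by
  have hμ := M.mu_pos hφ g.d_nonneg g.d_sum
  have hx0 := M.contr_nonneg (d := d)
  have hw : 0 < 1 - M.contr d := by linarith
  have hloop := M.integral_inner_loop_le g hφ hRm hr hα h1 h2 hX K θ₀ t
  have hint := M.integrable_outer hX α K θ₀ t
  have ha0 : 0 ≤ ∫ ω, ‖M.qfun (M.outer α K θ₀ (fun n => X n ω) t - θs)‖ ^ 2 ∂Pr :=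
    integral_nonneg fun ω => sq_nonneg _
  have hb0 : 0 ≤ ∫ ω, ‖M.outer α K θ₀ (fun n => X n ω) t - θs‖ ^ 2 ∂Pr :=
    integral_nonneg fun ω => sq_nonneg _
  have hint₂ : ∀ F : EuclideanSpace ℝ (Fin h) → ℝ,
      Integrable (fun ω => F (M.outer α K θ₀ (fun n => X n ω) t)) Pr := fun F => hint fun θ _ => F θ
  have hE0 : ∫ ω, ‖M.outer α K θ₀ (fun n => X n ω) t -
        M.target d (M.outer α K θ₀ (fun n => X n ω) t)‖ ^ 2 ∂Pr ≤
      2 * ∫ ω, ‖M.outer α K θ₀ (fun n => X n ω) t - θs‖ ^ 2 ∂Pr +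
      2 / M.mu d ^ 2 * ∫ ω, ‖M.qfun (M.outer α K θ₀ (fun n => X n ω) t - θs)‖ ^ 2 ∂Pr := by
    rw [← integral_const_mul, ← integral_const_mul,
      ← integral_add ((hint₂ fun θ => ‖θ - θs‖ ^ 2).const_mul _)
        ((hint₂ fun θ => ‖M.qfun (θ - θs)‖ ^ 2).const_mul _)]
    refine integral_mono (hint₂ fun θ => ‖θ - M.target d θ‖ ^ 2)
      (((hint₂ fun θ => ‖θ - θs‖ ^ 2).const_mul _).add
        ((hint₂ fun θ => ‖M.qfun (θ - θs)‖ ^ 2).const_mul _)) fun ω => ?_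
    exact M.norm_sub_target_sq_le hφ g.d_nonneg g.d_sum hs _
  have hE1 : ∫ ω, (Rm + M.γ * ‖M.qfun (M.outer α K θ₀ (fun n => X n ω) t)‖) ^ 2 ∂Pr ≤
      2 * (Rm + M.γ * ‖M.qfun θs‖) ^ 2 +
      2 * M.γ ^ 2 * ∫ ω, ‖M.qfun (M.outer α K θ₀ (fun n => X n ω) t - θs)‖ ^ 2 ∂Pr := by
    have hc : 2 * (Rm + M.γ * ‖M.qfun θs‖) ^ 2 =
        ∫ _, 2 * (Rm + M.γ * ‖M.qfun θs‖) ^ 2 ∂Pr := by simp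
    rw [hc, ← integral_const_mul, ← integral_add (integrable_const _)
        ((hint₂ fun θ => ‖M.qfun (θ - θs)‖ ^ 2).const_mul _)]
    refine integral_mono (hint₂ fun θ => (Rm + M.γ * ‖M.qfun θ‖) ^ 2)
      ((integrable_const _).add
        ((hint₂ fun θ => ‖M.qfun (θ - θs)‖ ^ 2).const_mul _)) fun ω => ?_
    exact M.reward_bound_sq_le hRm θs _
  have hA : ∫ ω, ‖M.qfun (M.outer α K θ₀ (fun n => X n ω) (t + 1) - θs)‖ ^ 2 ∂Pr ≤
      M.contr d * ∫ ω, ‖M.qfun (M.outer α K θ₀ (fun n => X n ω) t - θs)‖ ^ 2 ∂Pr +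
      1 / (1 - M.contr d) * ∫ ω, ‖M.outer α K θ₀ (fun n => X n ω) (t + 1) -
        M.target d (M.outer α K θ₀ (fun n => X n ω) t)‖ ^ 2 ∂Pr := by
    rw [← integral_const_mul, ← integral_const_mul,
      ← integral_add ((hint₂ fun θ => ‖M.qfun (θ - θs)‖ ^ 2).const_mul _)
        ((hint fun θ θ₁ => ‖θ₁ - M.target d θ‖ ^ 2).const_mul _)]
    refine integral_mono (hint fun _ θ₁ => ‖M.qfun (θ₁ - θs)‖ ^ 2)
      (((hint₂ fun θ => ‖M.qfun (θ - θs)‖ ^ 2).const_mul _).add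
        ((hint fun θ θ₁ => ‖θ₁ - M.target d θ‖ ^ 2).const_mul _)) fun ω => ?_
    exact M.norm_qfun_sub_sol_sq_le hφ hx hs _ _
  have hB : ∫ ω, ‖M.outer α K θ₀ (fun n => X n ω) (t + 1) - θs‖ ^ 2 ∂Pr ≤
      2 * ∫ ω, ‖M.outer α K θ₀ (fun n => X n ω) (t + 1) -
        M.target d (M.outer α K θ₀ (fun n => X n ω) t)‖ ^ 2 ∂Pr +
      2 / M.mu d ^ 2 * ∫ ω, ‖M.qfun (M.outer α K θ₀ (fun n => X n ω) t - θs)‖ ^ 2 ∂Pr := by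
    rw [← integral_const_mul, ← integral_const_mul,
      ← integral_add ((hint fun θ θ₁ => ‖θ₁ - M.target d θ‖ ^ 2).const_mul _)
        ((hint₂ fun θ => ‖M.qfun (θ - θs)‖ ^ 2).const_mul _)]
    refine integral_mono (hint fun _ θ₁ => ‖θ₁ - θs‖ ^ 2)
      (((hint fun θ θ₁ => ‖θ₁ - M.target d θ‖ ^ 2).const_mul _).add
        ((hint₂ fun θ => ‖M.qfun (θ - θs)‖ ^ 2).const_mul _)) fun ω => ?_
    exact M.norm_sub_sol_sq_le hφ g.d_nonneg g.d_sum hs _ _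
  have hT := g.one_le
  have hc0 : 0 ≤ 20 * (α * T / M.mu d) := by positivity
  have k1 := mul_le_mul_of_nonneg_left hE0 (by linarith : 0 ≤ 3 * (1 - 3 / 4 * (α * M.mu d)) ^ K)
  have k2 := mul_le_mul_of_nonneg_left hE1 hc0
  have k3 := mul_le_mul_of_nonneg_right h3 ha0
  refine coupled_recursion_step (y := ∫ ω, ‖M.outer α K θ₀ (fun n => X n ω) (t + 1) -
      M.target d (M.outer α K θ₀ (fun n => X n ω) t)‖ ^ 2 ∂Pr)
    hw (by linarith) hp hp3 hpw hpμ hρp ha0 hb0 hε ?_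
    (hA.trans_eq ?_) (hB.trans_eq ?_)
  · refine (hloop.trans (add_le_add k1 k2)).trans ?_
    generalize (1 - 3 / 4 * (α * M.mu d)) ^ K = ρ
    generalize ∫ ω, ‖M.qfun (M.outer α K θ₀ (fun n => X n ω) t - θs)‖ ^ 2 ∂Pr = a at k3 ⊢
    generalize ∫ ω, ‖M.outer α K θ₀ (fun n => X n ω) t - θs‖ ^ 2 ∂Pr = b
    -- With `h3` and `h4` the two terms become w²a/10 (from 40/400) and (5/16)w²ε (from 40/128),
    -- where w = 1 - x.
    have e1 : 20 * (α * T / M.mu d) * (2 * (Rm + M.γ * ‖M.qfun θs‖) ^ 2 + 2 * M.γ ^ 2 * a) =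
        40 * (α * T * (Rm + M.γ * ‖M.qfun θs‖) ^ 2 / M.mu d) +
        40 * (α * T * M.γ ^ 2 / M.mu d * a) := by ring
    have e2 : 3 * ρ * (2 * b + 2 / M.mu d ^ 2 * a) = 6 * ρ * (b + a / M.mu d ^ 2) := by ring
    rw [e1, e2]
    linarith
  · rw [sub_sub_cancel]; ring
  · ring

/-- Convergence of the outer iteration for admissible step sizes. -/
lemma integral_outer_le (g : GreenKernel M.chainMatrix d T) (hφ : ∀ z, ‖M.feat z‖ ≤ 1)
    (hRm : 0 ≤ Rm) (hr : ∀ s a s', |M.r s a s'| ≤ Rm) (hx : M.contr d < 1)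
    {θs : EuclideanSpace ℝ (Fin h)} (hs : M.IsRPBESolution d θs) {ε α : ℝ} (hε : 0 < ε)
    (hα : 0 < α) (h1 : α * T * (1 + M.η) ^ 2 ≤ M.mu d / 48)
    (h2 : α * T * (1 + M.η) ^ 2 ≤ 1 / 192)
    (h3 : α * T * M.γ ^ 2 / M.mu d ≤ (1 - M.contr d) ^ 2 / 400)
    (h4 : α * T * (Rm + M.γ * ‖M.qfun θs‖) ^ 2 / M.mu d ≤ ε * (1 - M.contr d) ^ 2 / 128)
    (θ₀ : EuclideanSpace ℝ (Fin h)) {K t : ℕ}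
    (hK : 16 / (M.mu d * α) * M.logK d θs θ₀ ε ≤ K)
    (ht : 16 / (1 - M.contr d) * M.logT θs θ₀ ε ≤ t)
    {Ω : Type w} [MeasurableSpace Ω] {Pr : Measure Ω} [IsProbabilityMeasure Pr]
    {X : ℕ → Ω → S × A} (hX : M.IsTrajectory Pr X) :
    ∫ ω, ‖M.qfun (M.outer α K θ₀ (fun n => X n ω) t - θs)‖ ^ 2 ∂Pr ≤ ε := by
  have hμ := M.mu_pos hφ g.d_nonneg g.d_sum
  have hμle : M.mu d ≤ 1 + M.η :=
    (M.mu_le_ell hφ g.d_nonneg g.d_sum).trans (M.ell_le hφ g.d_nonneg g.d_sum)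
  have hT := g.one_le
  have hx0 := M.contr_nonneg (d := d)
  obtain ⟨w, hw⟩ : ∃ w, w = 1 - M.contr d := ⟨_, rfl⟩
  have hw0 : 0 < w := by linarith
  have hw1 : w ≤ 1 := by linarith
  -- Q is the argument of the logarithm in the condition on K. It is chosen so that p = 1/Q is at
  -- most 1/3, μ and 1 - x, and p‖θ₀ - θ*‖² ≤ ε.
  obtain ⟨Q, hQ⟩ : ∃ Q, Q = 2 + 1 / M.mu d + 1 / w + ‖θ₀ - θs‖ ^ 2 / ε := ⟨_, rfl⟩
  have hlogK : M.logK d θs θ₀ ε = Real.log Q := by rw [logK, hQ, hw]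
  have q1 : 0 < 1 / M.mu d := by positivity
  have q2 : 1 ≤ 1 / w := (one_le_div hw0).2 hw1
  have q3 : 0 ≤ ‖θ₀ - θs‖ ^ 2 / ε := by positivity
  have hQ3 : 3 ≤ Q := by linarith
  have hQ0 : 0 < Q := by linarith
  obtain ⟨r, hrdef⟩ : ∃ r, r = 3 / 4 * (α * M.mu d) := ⟨_, rfl⟩
  have hr1 : r ≤ 1 := by
    have k1 : α * M.mu d ≤ α * T * (1 + M.η) ^ 2 := by
      have : M.mu d ≤ T * (1 + M.η) ^ 2 := by
        nlinarith [M.η_pos, mul_le_mul hT (le_refl ((1 + M.η) ^ 2)) (by positivity) (by linarith)]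
      rw [mul_assoc]
      exact mul_le_mul_of_nonneg_left this hα.le
    rw [hrdef]; linarith
  have exp_neg_log : ∀ (n : ℕ) (q : ℝ), 0 < q → Real.exp (-(n * Real.log q)) = (1 / q) ^ n := by
    intro n q hq
    rw [Real.exp_neg, Real.exp_nat_mul, Real.exp_log hq, one_div, inv_pow]
  have pow_le_exp : ∀ (s : ℝ) (n : ℕ), s ≤ 1 → (1 - s) ^ n ≤ Real.exp (-(n * s)) := by
    intro s n hs1
    rw [← mul_neg, Real.exp_nat_mul]
    exact pow_le_pow_left₀ (by linarith) (Real.one_sub_le_exp_neg s) n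
  -- The exponent is 12 = 16 · 3/4, from the constant in the condition on K and the drift rate.
  have hρ : (1 - r) ^ K ≤ (1 / Q) ^ 12 := by
    refine (pow_le_exp r K hr1).trans ?_
    rw [← exp_neg_log 12 Q hQ0]
    refine Real.exp_le_exp.2 (neg_le_neg ?_)
    rw [hlogK, div_mul_eq_mul_div, div_le_iff₀ (by positivity)] at hK
    rw [hrdef]
    push_cast
    nlinarith
  have hle_inv : ∀ {c : ℝ}, 0 < c → 1 / c ≤ Q → 1 / Q ≤ c := fun {c} hc h => by
    rw [div_le_iff₀ hQ0]
    rw [div_le_iff₀ hc] at h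
    linarith
  have hp0 : 0 < 1 / Q := by positivity
  have hp3 : 1 / Q ≤ 1 / 3 := one_div_le_one_div_of_le (by norm_num) hQ3
  have hstep := M.outer_step_le g hφ hRm hr hx hs hε hα h1 h2 h3 h4 hp0 hp3
    (by rw [← hw]; exact hle_inv hw0 (by linarith)) (hle_inv hμ (by linarith))
    (by rw [← hrdef]; exact hρ) (by rw [← hrdef]; exact pow_nonneg (by linarith) K) hX θ₀
  -- The additive term (2/5)wε is (w/2)·(4/5)ε, so the limit (4/5)ε leaves room for the transient.
  have hfin := affine_recursion (m := fun t =>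
      ∫ ω, ‖M.qfun (M.outer α K θ₀ (fun n => X n ω) t - θs)‖ ^ 2 ∂Pr +
        (1 / Q) ^ 6 * ∫ ω, ‖M.outer α K θ₀ (fun n => X n ω) t - θs‖ ^ 2 ∂Pr)
    (q := 1 - w / 2) (c := 4 / 5 * ε) (by linarith)
    (fun t => (hstep t).trans_eq (by rw [← hw]; ring)) t
  have hb0 : 0 ≤ (1 / Q) ^ 6 * ∫ ω, ‖M.outer α K θ₀ (fun n => X n ω) t - θs‖ ^ 2 ∂Pr :=
    mul_nonneg (by positivity) (integral_nonneg fun ω => sq_nonneg _)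
  simp only [outer, integral_const, probReal_univ, one_smul] at hfin
  obtain ⟨Q₁, hQ₁⟩ : ∃ Q₁, Q₁ = 2 + ‖M.qfun (θ₀ - θs)‖ ^ 2 / ε := ⟨_, rfl⟩
  have hlogT : M.logT θs θ₀ ε = Real.log Q₁ := by rw [logT, hQ₁]
  have q4 : 0 ≤ ‖M.qfun (θ₀ - θs)‖ ^ 2 / ε := by positivity
  have hQ₁2 : 2 ≤ Q₁ := by linarith
  have hQ₁0 : 0 < Q₁ := by linarith
  -- The exponent is 8 = 16 · 1/2. One power of Q₁ absorbs the initial value Q₁ε, the remaining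
  -- seven give 2⁻⁷ = 1/128.
  have hqt : (1 - w / 2) ^ t ≤ (1 / Q₁) ^ 8 := by
    refine (pow_le_exp (w / 2) t (by linarith)).trans ?_
    rw [← exp_neg_log 8 Q₁ hQ₁0]
    refine Real.exp_le_exp.2 (neg_le_neg ?_)
    rw [hlogT, ← hw, div_mul_eq_mul_div, div_le_iff₀ hw0] at ht
    push_cast
    linarith
  have hqt0 : 0 ≤ (1 - w / 2) ^ t := pow_nonneg (by linarith) t
  have hm0 : ‖M.qfun (θ₀ - θs)‖ ^ 2 + (1 / Q) ^ 6 * ‖θ₀ - θs‖ ^ 2 ≤ Q₁ * ε := by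
    have e1 : (1 / Q) * ‖θ₀ - θs‖ ^ 2 ≤ ε := by
      rw [one_div, inv_mul_le_iff₀ hQ0, mul_comm]
      have : ‖θ₀ - θs‖ ^ 2 / ε ≤ Q := by linarith
      rw [div_le_iff₀ hε] at this
      linarith
    have e2 : (1 / Q) ^ 6 ≤ 1 / Q := by
      have := pow_le_pow_of_le_one hp0.le (by linarith : 1 / Q ≤ 1) (by norm_num : 1 ≤ 6)
      rwa [pow_one] at this
    have e3 := mul_le_mul_of_nonneg_right e2 (sq_nonneg ‖θ₀ - θs‖)
    have e4 : Q₁ * ε = 2 * ε + ‖M.qfun (θ₀ - θs)‖ ^ 2 := by rw [hQ₁]; field_simp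
    linarith
  have hqt2 : (1 - w / 2) ^ t * (Q₁ * ε) ≤ ε / 128 := by
    have e1 : (1 / Q₁) ^ 7 ≤ 1 / 128 := by
      have := pow_le_pow_left₀ (by positivity) (one_div_le_one_div_of_le (by norm_num) hQ₁2) 7
      exact this.trans_eq (by norm_num)
    calc _ ≤ (1 / Q₁) ^ 8 * (Q₁ * ε) := mul_le_mul_of_nonneg_right hqt (by positivity)
      _ = (1 / Q₁) ^ 7 * ε := by field_simp
      _ ≤ 1 / 128 * ε := mul_le_mul_of_nonneg_right e1 hε.le
      _ = _ := by ring
  have e1 := mul_le_mul_of_nonneg_left hm0 hqt0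
  have e2 := mul_nonneg hqt0 hε.le
  linarith

end Outer

end RegLinearMDP
end

/-! ### Constants: step-size thresholds and order of the inner-loop length -/

noncomputable section

namespace RegLinearMDP

/-- Factor out (1 - x)² and use (1 + x)² ≤ 2(1 + x²). This trades the 1 - x² of the thresholds for
the 1 - x of the recursion. -/
lemma sq_one_sub_sq_le (x : ℝ) : (1 - x ^ 2) ^ 2 ≤ 2 * (1 + x ^ 2) * (1 - x) ^ 2 := by
  nlinarith [mul_nonneg (sq_nonneg (1 - x)) (sq_nonneg (1 - x))]

lemma sq_one_sub_le {x : ℝ} (hx0 : 0 ≤ x) (hx : x < 1) : (1 - x) ^ 2 ≤ (1 - x ^ 2) ^ 2 :=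
  pow_le_pow_left₀ (by linarith) (by nlinarith) 2

variable {S : Type u} {A : Type v} [Fintype S] [Fintype A] {h : ℕ} (M : RegLinearMDP S A h)

lemma sigmaSq_nonneg (θs : EuclideanSpace ℝ (Fin h)) : 0 ≤ M.sigmaSq θs :=
  Real.iSup_nonneg fun _ => Finset.sum_nonneg fun _ _ =>
    mul_nonneg (M.P_nonneg _ _ _) (sq_nonneg _)

/-- For u = γ‖Φθ*‖∞ the difference of 16R² + 32u² and (32/3)(R + u)² is (16/3)(R - 2u)². -/
lemma reward_bound_sq_le_g₃ (Rm : ℝ) (θs : EuclideanSpace ℝ (Fin h)) :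
    32 / 3 * (Rm + M.γ * ‖M.qfun θs‖) ^ 2 ≤ M.g₃ Rm θs := by
  have hσ := M.sigmaSq_nonneg θs
  have hη := M.η_pos
  have e1 : 0 ≤ M.η * (32 * (M.γ * ‖M.qfun θs‖) ^ 2 + 16 * Rm ^ 2) := by positivity
  rw [g₃]
  nlinarith [sq_nonneg (Rm - 2 * (M.γ * ‖M.qfun θs‖))]

lemma one_le_kap {d : S × A → ℝ} (hμ : 0 < M.mu d) (hμℓ : M.mu d ≤ M.ell d) : 1 ≤ M.kap d :=
  (one_le_div hμ).2 hμℓ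

section Constants

variable [MeasurableSpace S] [MeasurableSingletonClass S]
  [MeasurableSpace A] [MeasurableSingletonClass A]
  {d : S × A → ℝ} {z₀ : S × A} {Rm : ℝ} {θs : EuclideanSpace ℝ (Fin h)} {ε : ℝ}

lemma lV₁_ge (hT : 1 ≤ M.tauMax z₀) : 2 * (1 + M.η) ≤ M.lV₁ z₀ := by
  rw [lV₁]; nlinarith [M.η_pos]

lemma lV₁_ge_two_mul (hT : 1 ≤ M.tauMax z₀) : 2 * M.tauMax z₀ ≤ M.lV₁ z₀ := by
  rw [lV₁]; nlinarith [M.η_pos]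

lemma lV₂_ge : 1 ≤ M.lV₂ z₀ := le_max_right _ _

lemma lV₃_nonneg (hT : 1 ≤ M.tauMax z₀) (hRm : 0 ≤ Rm) : 0 ≤ M.lV₃ z₀ Rm θs := by
  have := M.γ_pos
  have := M.η_pos
  rw [lV₃]; positivity

lemma kap_mul_le_D₁ (hμ : 0 < M.mu d) (hμℓ : M.mu d ≤ M.ell d) (hT : 1 ≤ M.tauMax z₀)
    (hRm : 0 ≤ Rm) : M.kap d * M.lV₁ z₀ * M.γ ≤ M.D₁ d z₀ Rm θs := by
  have h1 := M.lV₁_ge hT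
  have h3 := M.lV₃_nonneg (θs := θs) hT hRm
  have := M.η_pos
  rw [D₁]
  exact le_add_of_nonneg_left (mul_nonneg (by linarith) (by linarith))

lemma ell_mul_le_D₁ (hμ : 0 < M.mu d) (hμℓ : M.mu d ≤ M.ell d) (hT : 1 ≤ M.tauMax z₀)
    (hRm : 0 ≤ Rm) : M.ell d * (12 * M.tauMax z₀) ≤ M.D₁ d z₀ Rm θs := by
  have h1 := M.lV₁_ge_two_mul hT
  have h3 := M.lV₃_nonneg (θs := θs) hT hRm
  have hκ := M.one_le_kap hμ hμℓ
  have hγ := M.γ_pos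
  have h4 : 0 ≤ M.kap d * M.lV₁ z₀ * M.γ :=
    mul_nonneg (mul_nonneg (by linarith) (by linarith)) hγ.le
  rw [D₁]
  refine le_add_of_le_of_nonneg (mul_le_mul_of_nonneg_left (by linarith) (by linarith)) h4

lemma E₁_ge (hμ : 0 < M.mu d) (hμℓ : M.mu d ≤ M.ell d) (hT : 1 ≤ M.tauMax z₀) (hRm : 0 ≤ Rm) :
    M.kap d * M.lV₁ z₀ * (42 * M.γ ^ 3 + 1) ≤ M.E₁ d z₀ Rm θs := by
  have h1 := M.kap_mul_le_D₁ (θs := θs) hμ hμℓ hT hRm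
  have h2 := M.lV₂_ge (z₀ := z₀)
  have hγ := M.γ_pos
  have hη := M.η_pos
  have hV := M.lV₁_ge hT
  have hκ := M.one_le_kap hμ hμℓ
  have h3 : 42 * M.γ ^ 2 ≤ M.g₂ := by rw [g₂]; gcongr; linarith
  have h4 : M.kap d * M.lV₁ z₀ ≤ M.D₃ d z₀ := by
    rw [D₃]; exact le_add_of_nonneg_right (mul_nonneg (by linarith) (by linarith))
  have h5 : M.kap d * M.lV₁ z₀ * M.γ ≤ M.D₁ d z₀ Rm θs + M.ell d / 2 := by linarith
  have h6 : 0 ≤ M.kap d * M.lV₁ z₀ * M.γ :=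
    mul_nonneg (mul_nonneg (by linarith) (by linarith)) hγ.le
  have h7 := mul_le_mul h5 h3 (by positivity) (h6.trans h5)
  rw [E₁]
  nlinarith

/-- 128 = 12 · 32/3, the product of the bounds for `D₁` and `g₃`. -/
lemma E₂_ge (hμ : 0 < M.mu d) (hμℓ : M.mu d ≤ M.ell d) (hT : 1 ≤ M.tauMax z₀) (hRm : 0 ≤ Rm) :
    128 * (M.mu d * M.tauMax z₀) * (Rm + M.γ * ‖M.qfun θs‖) ^ 2 ≤ M.E₂ d z₀ Rm θs := by
  have h1 := M.ell_mul_le_D₁ (θs := θs) hμ hμℓ hT hRm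
  have h2 := M.reward_bound_sq_le_g₃ Rm θs
  have h3 := M.lV₃_nonneg (θs := θs) hT hRm
  have h4 : M.mu d * M.tauMax z₀ ≤ M.ell d * M.tauMax z₀ := by gcongr
  have h5 : 12 * (M.mu d * M.tauMax z₀) ≤ M.D₁ d z₀ Rm θs + M.ell d / 2 := by linarith
  have h6 := mul_le_mul h5 h2 (by positivity) (le_trans (by positivity) h5)
  have h7 : 0 ≤ 2 * M.ell d * M.lV₃ z₀ Rm θs := mul_nonneg (by linarith) h3
  rw [E₂]
  linarith

lemma E₂_pos (hμ : 0 < M.mu d) (hμℓ : M.mu d ≤ M.ell d) (hT : 1 ≤ M.tauMax z₀) (hRm : 0 < Rm) :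
    0 < M.E₂ d z₀ Rm θs := by
  refine lt_of_lt_of_le ?_ (M.E₂_ge hμ hμℓ hT hRm.le)
  have := M.γ_pos
  positivity

/-! ### Consequences of the step-size condition -/

/-- Since `lV₁` = 2τ(1 + η), the denominator is at least (192ℓ + 48κ)τ(1 + η)². The κ term with κ ≥
1 gives the first bound, the ℓ term with μ ≤ ℓ the second. -/
lemma step_bounds_of_le_alpha₂ (hμ : 0 < M.mu d) (hμℓ : M.mu d ≤ M.ell d)
    (hT : 1 ≤ M.tauMax z₀) (hRm : 0 ≤ Rm) {α : ℝ} (hα : 0 < α) (h2 : α ≤ M.alpha₂ d z₀ Rm θs) :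
    α * M.tauMax z₀ * (1 + M.η) ^ 2 ≤ M.mu d / 48 ∧
      α * M.tauMax z₀ * (1 + M.η) ^ 2 ≤ 1 / 192 := by
  have hη := M.η_pos
  have h3 := M.lV₃_nonneg (θs := θs) hT hRm
  have hκ := M.one_le_kap hμ hμℓ
  have hℓ : 0 < M.ell d := by linarith
  have e1 : 0 ≤ 16 * M.ell d * M.lV₃ z₀ Rm θs * (1 + M.η) := by positivity
  have e2 : 0 < M.tauMax z₀ * (1 + M.η) ^ 2 := by positivity
  have e3 := mul_le_mul_of_nonneg_right hκ e2.le
  have hden : 192 * M.ell d * (M.tauMax z₀ * (1 + M.η) ^ 2) +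
      48 * (M.tauMax z₀ * (1 + M.η) ^ 2) ≤
      16 * M.ell d * (6 * M.lV₁ z₀ + M.lV₃ z₀ Rm θs) * (1 + M.η)
        + 24 * M.kap d * M.lV₁ z₀ * (1 + M.η) := by
    rw [show 16 * M.ell d * (6 * M.lV₁ z₀ + M.lV₃ z₀ Rm θs) * (1 + M.η)
        + 24 * M.kap d * M.lV₁ z₀ * (1 + M.η) = 16 * M.ell d * M.lV₃ z₀ Rm θs * (1 + M.η) +
        (192 * M.ell d * (M.tauMax z₀ * (1 + M.η) ^ 2) +
        48 * (M.kap d * (M.tauMax z₀ * (1 + M.η) ^ 2))) by rw [lV₁]; ring]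
    linarith
  have e4 : 0 < 192 * M.ell d * (M.tauMax z₀ * (1 + M.η) ^ 2) := by positivity
  rw [alpha₂, le_div_iff₀ (by linarith)] at h2
  have e5 := (mul_le_mul_of_nonneg_left hden hα.le).trans h2
  rw [mul_assoc]
  have e6 : 0 < α * (M.tauMax z₀ * (1 + M.η) ^ 2) := by positivity
  have e7 : 0 < α * (M.tauMax z₀ * (1 + M.η) ^ 2) * M.ell d := by positivity
  constructor
  · linarith
  · by_contra hcon
    have := mul_lt_mul_of_pos_right (not_le.1 hcon) hℓ
    linarith

lemma step_bound_of_le_alpha₃ (hμ : 0 < M.mu d) (hμℓ : M.mu d ≤ M.ell d)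
    (hT : 1 ≤ M.tauMax z₀) (hRm : 0 ≤ Rm) {α : ℝ} (hα : 0 < α) (h3 : α ≤ M.alpha₃ d z₀ Rm θs) :
    α * M.tauMax z₀ * M.γ ^ 2 / M.mu d ≤ (1 - M.contr d) ^ 2 / 400 := by
  have hγ := M.γ_pos
  have hE := M.E₁_ge (θs := θs) hμ hμℓ hT hRm
  have hκ := M.one_le_kap hμ hμℓ
  have hV := M.lV₁_ge_two_mul hT
  have hV₂ := M.lV₂_ge (z₀ := z₀)
  have hκV : 2 * M.tauMax z₀ ≤ M.kap d * M.lV₁ z₀ :=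
    hV.trans (le_mul_of_one_le_left (by linarith) hκ)
  -- The cubic 84γ³ - 50γ² + 4γ + 2 has its positive critical point near 0.351 and is positive
  -- there; the squares are centred at that point. The terms 2 + 84γ³ come from 2`E₁` and 4γ from
  -- the rest of the denominator.
  have e0 : 50 * M.γ ^ 2 ≤ 2 + 4 * M.γ + 84 * M.γ ^ 3 := by
    nlinarith [mul_nonneg hγ.le (sq_nonneg (M.γ - 351 / 1000)), sq_nonneg (M.γ - 351 / 1000)]
  have e1 := mul_le_mul hκV e0 (by positivity) (le_trans (by positivity) hκV)
  have e2 : 0 ≤ M.ell d * M.lV₂ z₀ := mul_nonneg (by linarith) (by linarith)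
  have hden : 100 * M.tauMax z₀ * M.γ ^ 2 ≤ 2 * M.E₁ d z₀ Rm θs
      + 4 * (M.lV₁ z₀ * M.γ * M.kap d + M.ell d * M.lV₂ z₀) := by linarith
  have e3 : 0 < 100 * M.tauMax z₀ * M.γ ^ 2 := by positivity
  have e4 := sq_one_sub_sq_le (M.contr d)
  have e5 : 0 < M.mu d * (8 * (1 + M.contr d ^ 2)) := by positivity
  rw [alpha₃, show 8 * (1 + M.contr d ^ 2) * (2 * M.mu d * M.E₁ d z₀ Rm θs
      + 4 * M.mu d * (M.lV₁ z₀ * M.γ * M.kap d + M.ell d * M.lV₂ z₀)) =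
      M.mu d * (8 * (1 + M.contr d ^ 2)) * (2 * M.E₁ d z₀ Rm θs
      + 4 * (M.lV₁ z₀ * M.γ * M.kap d + M.ell d * M.lV₂ z₀)) by ring,
    le_div_iff₀ (mul_pos e5 (by linarith))] at h3
  have e6 := mul_le_mul_of_nonneg_left (mul_le_mul_of_nonneg_left hden e5.le) hα.le
  have e7 := mul_le_mul_of_nonneg_left e4 (sq_nonneg (M.mu d))
  have e8 : (M.mu d * (1 + M.contr d ^ 2)) * (800 * (α * M.tauMax z₀ * M.γ ^ 2)) ≤
      (M.mu d * (1 + M.contr d ^ 2)) * (2 * M.mu d * (1 - M.contr d) ^ 2) := by linarith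
  have e9 := le_of_mul_le_mul_left e8 (by positivity)
  rw [div_le_iff₀ hμ]
  linarith

lemma step_bound_of_le_alpha₄ (hμ : 0 < M.mu d) (hμℓ : M.mu d ≤ M.ell d)
    (hT : 1 ≤ M.tauMax z₀) (hRm : 0 < Rm) (hε : 0 < ε) {α : ℝ} (hα : 0 < α)
    (h4 : α ≤ M.alpha₄ d z₀ Rm θs ε) :
    α * M.tauMax z₀ * (Rm + M.γ * ‖M.qfun θs‖) ^ 2 / M.mu d ≤
      ε * (1 - M.contr d) ^ 2 / 128 := by
  have hE := M.E₂_ge (θs := θs) hμ hμℓ hT hRm.le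
  have hE0 := M.E₂_pos (θs := θs) hμ hμℓ hT hRm
  have hV := M.lV₃_nonneg (θs := θs) hT hRm.le
  have hℓ : 0 < M.ell d := by linarith
  have e1 : 0 ≤ 3 * M.ell d * M.lV₃ z₀ Rm θs * M.mu d := by positivity
  have e2 : 0 < 4 * (1 + M.contr d ^ 2) := by positivity
  rw [alpha₄, le_div_iff₀ (mul_pos e2 (by linarith))] at h4
  have e3 := mul_le_mul_of_nonneg_left (mul_le_mul_of_nonneg_left (hE.trans
    (le_add_of_nonneg_right e1)) e2.le) hα.le
  have hγ2 : M.γ ^ 2 ≤ 1 := pow_le_one₀ M.γ_pos.le M.γ_lt_one.le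
  have e4 : 2 * M.mu d ^ 2 * ε * M.γ ^ 2 * (1 - M.contr d ^ 2) ^ 2 ≤
      2 * M.mu d ^ 2 * ε * 1 * (2 * (1 + M.contr d ^ 2) * (1 - M.contr d) ^ 2) := by
    gcongr
    exact sq_one_sub_sq_le _
  have e5 := e3.trans (h4.trans e4)
  have e6 : (4 * M.mu d * (1 + M.contr d ^ 2)) *
        (128 * (α * M.tauMax z₀ * (Rm + M.γ * ‖M.qfun θs‖) ^ 2)) ≤
      (4 * M.mu d * (1 + M.contr d ^ 2)) * (M.mu d * ε * (1 - M.contr d) ^ 2) := by linarith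
  have e7 := le_of_mul_le_mul_left e6 (by positivity)
  rw [div_le_iff₀ hμ]
  linarith

/-! ### The step-size threshold against the order of the inner-loop length -/

/-- In this lemma and the next three, one entry of the maximum in `orderK` matches the reciprocal of
μ times the threshold up to a factor at most 32. -/
lemma le_orderK_mul_alpha₁ (hμ : 0 < M.mu d) (hμℓ : M.mu d ≤ M.ell d) (hℓ : M.ell d ≤ 1 + M.η)
    (hT : 1 ≤ M.tauMax z₀) (hRm : 0 < Rm) :
    1 ≤ 32 * M.mu d * M.orderK d z₀ Rm θs ε * M.alpha₁ d z₀ Rm θs := by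
  have hη := M.η_pos
  have hγ := M.γ_pos
  have hγ1 := M.γ_lt_one
  have hκ := M.one_le_kap hμ hμℓ
  have hV := M.lV₁_ge hT
  have hV₃ := M.lV₃_nonneg (θs := θs) hT hRm.le
  have hℓ0 : 0 < M.ell d := by linarith
  have hO : (M.ell d * (6 * M.lV₁ z₀ + M.lV₃ z₀ Rm θs) * (1 + M.η)
      + M.kap d * M.lV₁ z₀ * (1 + M.η)) / M.mu d ^ 2 ≤ M.orderK d z₀ Rm θs ε := le_max_left _ _
  rw [div_le_iff₀ (by positivity)] at hO
  have hV0 : 0 < M.lV₁ z₀ := by linarith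
  have hκ0 : 0 < M.kap d := by linarith
  have hden0 : 0 < (M.D₁ d z₀ Rm θs + M.ell d / 2) * M.g₁ + 2 * M.D₂ d z₀ := by
    rw [D₁, D₂, g₁]; positivity
  have hden : (M.D₁ d z₀ Rm θs + M.ell d / 2) * M.g₁ + 2 * M.D₂ d z₀ ≤
      32 * (M.ell d * (6 * M.lV₁ z₀ + M.lV₃ z₀ Rm θs) * (1 + M.η)
      + M.kap d * M.lV₁ z₀ * (1 + M.η)) := by
    have e1 : M.kap d * M.lV₁ z₀ * (1 + M.η) * M.γ ≤ M.kap d * M.lV₁ z₀ * (1 + M.η) * 1 := by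
      gcongr
    have e2 : M.ell d * (1 + M.η) * 1 ≤ M.ell d * (1 + M.η) * M.lV₁ z₀ := by gcongr; linarith
    have e3 : M.kap d * M.lV₁ z₀ * (1 + M.ell d) ≤ M.kap d * M.lV₁ z₀ * (2 * (1 + M.η)) := by
      gcongr; linarith
    have e4 : 0 < M.ell d * M.lV₁ z₀ * (1 + M.η) := by positivity
    have e5 : 0 ≤ M.ell d * M.lV₃ z₀ Rm θs * (1 + M.η) := by positivity
    rw [D₁, D₂, g₁]
    linarith
  rw [alpha₁, mul_div_assoc', one_le_div hden0]
  linarith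

lemma le_orderK_mul_alpha₂ (hμ : 0 < M.mu d) (hμℓ : M.mu d ≤ M.ell d)
    (hT : 1 ≤ M.tauMax z₀) (hRm : 0 < Rm) :
    1 ≤ 32 * M.mu d * M.orderK d z₀ Rm θs ε * M.alpha₂ d z₀ Rm θs := by
  have hη := M.η_pos
  have hκ := M.one_le_kap hμ hμℓ
  have hV := M.lV₁_ge hT
  have hV₃ := M.lV₃_nonneg (θs := θs) hT hRm.le
  have hℓ0 : 0 < M.ell d := by linarith
  have hO : (M.ell d * (6 * M.lV₁ z₀ + M.lV₃ z₀ Rm θs) * (1 + M.η)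
      + M.kap d * M.lV₁ z₀ * (1 + M.η)) / M.mu d ^ 2 ≤ M.orderK d z₀ Rm θs ε := le_max_left _ _
  rw [div_le_iff₀ (by positivity)] at hO
  have hV0 : 0 < M.lV₁ z₀ := by linarith
  have hκ0 : 0 < M.kap d := by linarith
  have e1 : 0 < M.ell d * (6 * M.lV₁ z₀ + M.lV₃ z₀ Rm θs) * (1 + M.η) := by positivity
  have e2 : 0 < M.kap d * M.lV₁ z₀ * (1 + M.η) := by positivity
  rw [alpha₂, mul_div_assoc', one_le_div (by linarith)]
  linarith

lemma le_orderK_mul_alpha₃ (hμ : 0 < M.mu d) (hμℓ : M.mu d ≤ M.ell d)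
    (hx : M.contr d < 1) (hT : 1 ≤ M.tauMax z₀) (hRm : 0 < Rm) :
    1 ≤ 32 * M.mu d * M.orderK d z₀ Rm θs ε * M.alpha₃ d z₀ Rm θs := by
  have hγ := M.γ_pos
  have hx0 := M.contr_nonneg (d := d)
  have hη := M.η_pos
  have hκ := M.one_le_kap hμ hμℓ
  have hV := M.lV₁_ge hT
  have hV₂ := M.lV₂_ge (z₀ := z₀)
  have hE := M.E₁_ge (θs := θs) hμ hμℓ hT hRm.le
  have hℓ0 : 0 < M.ell d := by linarith
  have hV0 : 0 < M.lV₁ z₀ := by linarith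
  have hκ0 : 0 < M.kap d := by linarith
  have hE0 : 0 < M.E₁ d z₀ Rm θs := lt_of_lt_of_le (by positivity) hE
  have hw : 0 < 1 - M.contr d := by linarith
  obtain ⟨N, hN⟩ : ∃ N, N = 2 * M.mu d * M.E₁ d z₀ Rm θs
    + 4 * M.mu d * (M.lV₁ z₀ * M.kap d + M.ell d * M.lV₂ z₀) := ⟨_, rfl⟩
  have hO : N / (M.mu d ^ 3 * (1 - M.contr d) ^ 2) ≤ M.orderK d z₀ Rm θs ε := by
    rw [hN]; exact (le_max_left _ _).trans (le_max_right _ _)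
  rw [div_le_iff₀ (by positivity)] at hO
  have e1 : 0 < M.lV₁ z₀ * M.γ * M.kap d + M.ell d * M.lV₂ z₀ := by positivity
  have hN' : 2 * M.mu d * M.E₁ d z₀ Rm θs
      + 4 * M.mu d * (M.lV₁ z₀ * M.γ * M.kap d + M.ell d * M.lV₂ z₀) ≤ N := by
    have : M.lV₁ z₀ * M.γ * M.kap d ≤ M.lV₁ z₀ * 1 * M.kap d := by
      gcongr; exact M.γ_lt_one.le
    rw [mul_one] at this
    rw [hN]
    gcongr
  have hO0 : 0 ≤ M.orderK d z₀ Rm θs ε := by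
    refine nonneg_of_mul_nonneg_left (b := M.mu d ^ 3 * (1 - M.contr d) ^ 2) ?_ (by positivity)
    exact le_trans (by positivity) (hN'.trans hO)
  rw [alpha₃, mul_div_assoc', one_le_div (by positivity)]
  have e2 : 8 * (1 + M.contr d ^ 2) ≤ 16 := by nlinarith
  calc _ ≤ 16 * (M.orderK d z₀ Rm θs ε * (M.mu d ^ 3 * (1 - M.contr d) ^ 2)) :=
        mul_le_mul e2 (hN'.trans hO) (by positivity) (by norm_num)
    _ ≤ 32 * (M.orderK d z₀ Rm θs ε * (M.mu d ^ 3 * (1 - M.contr d ^ 2) ^ 2)) := by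
        gcongr ?_ * (_ * (_ * ?_))
        · norm_num
        · exact sq_one_sub_le hx0 hx
    _ = _ := by ring

lemma le_orderK_mul_alpha₄ (hμ : 0 < M.mu d) (hμℓ : M.mu d ≤ M.ell d)
    (hx : M.contr d < 1) (hT : 1 ≤ M.tauMax z₀) (hRm : 0 < Rm) (hε : 0 < ε) :
    1 ≤ 32 * M.mu d * M.orderK d z₀ Rm θs ε * M.alpha₄ d z₀ Rm θs ε := by
  have hγ := M.γ_pos
  have hx0 := M.contr_nonneg (d := d)
  have hV₃ := M.lV₃_nonneg (θs := θs) hT hRm.le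
  have hE0 := M.E₂_pos (θs := θs) hμ hμℓ hT hRm
  have hℓ0 : 0 < M.ell d := by linarith
  have hw : 0 < 1 - M.contr d := by linarith
  have hO : (M.E₂ d z₀ Rm θs + M.mu d * M.ell d * M.lV₃ z₀ Rm θs) /
      (ε * M.mu d ^ 3 * M.γ ^ 2 * (1 - M.contr d) ^ 2) ≤ M.orderK d z₀ Rm θs ε :=
    (le_max_right _ _).trans (le_max_right _ _)
  rw [div_le_iff₀ (by positivity)] at hO
  have e1 : 0 ≤ M.mu d * M.ell d * M.lV₃ z₀ Rm θs := by positivity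
  have hO0 : 0 ≤ M.orderK d z₀ Rm θs ε := by
    refine nonneg_of_mul_nonneg_left
      (b := ε * M.mu d ^ 3 * M.γ ^ 2 * (1 - M.contr d) ^ 2) ?_ (by positivity)
    linarith
  rw [alpha₄, mul_div_assoc', one_le_div (by positivity)]
  have e2 : 4 * (1 + M.contr d ^ 2) ≤ 8 := by nlinarith
  calc _ ≤ 8 * (3 * (M.orderK d z₀ Rm θs ε *
          (ε * M.mu d ^ 3 * M.γ ^ 2 * (1 - M.contr d) ^ 2))) :=
        mul_le_mul e2 (by linarith) (by positivity) (by norm_num)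
    _ = 24 * (M.orderK d z₀ Rm θs ε *
          (ε * M.mu d ^ 3 * M.γ ^ 2 * (1 - M.contr d) ^ 2)) := by ring
    _ ≤ 64 * (M.orderK d z₀ Rm θs ε *
          (ε * M.mu d ^ 3 * M.γ ^ 2 * (1 - M.contr d ^ 2) ^ 2)) := by
        gcongr ?_ * (_ * (_ * ?_))
        · norm_num
        · exact sq_one_sub_le hx0 hx
    _ = _ := by ring

/-- The first entry of the maximum is at least 6·`lV₁`·ℓ(1 + η)/μ² with `lV₁` ≥ 2. The lower bound
serves to absorb the rounding of K to an integer. -/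
lemma orderK_ge (hμ : 0 < M.mu d) (hμℓ : M.mu d ≤ M.ell d) (hℓ : M.ell d ≤ 1 + M.η)
    (hT : 1 ≤ M.tauMax z₀) (hRm : 0 < Rm) : 12 ≤ M.orderK d z₀ Rm θs ε := by
  have hη := M.η_pos
  have hκ := M.one_le_kap hμ hμℓ
  have hV := M.lV₁_ge hT
  have hV₃ := M.lV₃_nonneg (θs := θs) hT hRm.le
  have hℓ0 : 0 < M.ell d := by linarith
  have e0 : 0 ≤ M.kap d * M.lV₁ z₀ * (1 + M.η) :=
    mul_nonneg (mul_nonneg (by linarith) (by linarith)) (by linarith)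
  refine le_trans ?_ (le_max_left _ _)
  rw [le_div_iff₀ (by positivity)]
  have e1 : M.mu d * 12 * M.mu d ≤
      M.ell d * (6 * M.lV₁ z₀ + M.lV₃ z₀ Rm θs) * (1 + M.η) := by
    exact mul_le_mul (mul_le_mul hμℓ (by linarith) (by norm_num) hℓ0.le) (by linarith) hμ.le
      (mul_nonneg hℓ0.le (by linarith))
  linarith

lemma le_orderK_mul_alphaBar (hμ : 0 < M.mu d) (hμℓ : M.mu d ≤ M.ell d)
    (hℓ : M.ell d ≤ 1 + M.η) (hx : M.contr d < 1) (hT : 1 ≤ M.tauMax z₀) (hRm : 0 < Rm)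
    (hε : 0 < ε) : 1 ≤ 32 * M.mu d * M.orderK d z₀ Rm θs ε * M.alphaBar d z₀ Rm θs ε := by
  rw [alphaBar]
  rcases min_choice (min (M.alpha₁ d z₀ Rm θs) (M.alpha₂ d z₀ Rm θs))
    (min (M.alpha₃ d z₀ Rm θs) (M.alpha₄ d z₀ Rm θs ε)) with h | h <;> rw [h]
  · rcases min_choice (M.alpha₁ d z₀ Rm θs) (M.alpha₂ d z₀ Rm θs) with h' | h' <;> rw [h']
    · exact M.le_orderK_mul_alpha₁ hμ hμℓ hℓ hT hRm
    · exact M.le_orderK_mul_alpha₂ hμ hμℓ hT hRm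
  · rcases min_choice (M.alpha₃ d z₀ Rm θs) (M.alpha₄ d z₀ Rm θs ε) with h' | h' <;> rw [h']
    · exact M.le_orderK_mul_alpha₃ hμ hμℓ hx hT hRm
    · exact M.le_orderK_mul_alpha₄ hμ hμℓ hx hT hRm hε

end Constants

lemma one_half_le_logT (θs θ₀ : EuclideanSpace ℝ (Fin h)) {ε : ℝ} (hε : 0 < ε) :
    1 / 2 ≤ M.logT θs θ₀ ε := by
  have h1 : Real.log 2 ≤ M.logT θs θ₀ ε :=
    Real.log_le_log (by norm_num) (le_add_of_nonneg_right (by positivity))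
  linarith [Real.log_two_gt_d9]

lemma one_half_le_logK {d : S × A → ℝ} (hμ : 0 < M.mu d) (hx : M.contr d < 1)
    (θs θ₀ : EuclideanSpace ℝ (Fin h)) {ε : ℝ} (hε : 0 < ε) : 1 / 2 ≤ M.logK d θs θ₀ ε := by
  have hw : 0 < 1 - M.contr d := by linarith
  have h1 : Real.log 2 ≤ M.logK d θs θ₀ ε := by
    refine Real.log_le_log (by norm_num) ?_
    have : 0 ≤ 1 / M.mu d + 1 / (1 - M.contr d) + ‖θ₀ - θs‖ ^ 2 / ε := by positivity
    linarith
  linarith [Real.log_two_gt_d9]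

end RegLinearMDP

end

theorem mainTheorem2 :
    ∃ C C' : ℝ, 0 < C ∧ 0 < C' ∧
      ∀ (S : Type u) (A : Type v) [Fintype S] [Fintype A]
        [MeasurableSpace S] [MeasurableSingletonClass S]
        [MeasurableSpace A] [MeasurableSingletonClass A]
        (h : ℕ) (M : RegLinearMDP S A h) (Rm : ℝ) (d : S × A → ℝ) (z₀ : S × A),
        (∀ z, ‖M.feat z‖ ≤ 1) →
        0 < Rm →
        (∀ s a s', |M.r s a s'| ≤ Rm) →
        M.chainMatrix.IsIrreducible →
        M.IsStationary d →
        M.contr d < 1 →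
        (∃! θs : EuclideanSpace ℝ (Fin h), M.IsRPBESolution d θs) ∧
        ∀ (θs θ₀ : EuclideanSpace ℝ (Fin h)) (ε : ℝ), M.IsRPBESolution d θs → 0 < ε →
          (∀ (α : ℝ) (K t : ℕ), 0 < α → α ≤ M.alphaBar d z₀ Rm θs ε →
            C / (M.mu d * α) * M.logK d θs θ₀ ε ≤ K →
            C / (1 - M.contr d) * M.logT θs θ₀ ε ≤ t →
            ∀ (Ω : Type w) [MeasurableSpace Ω] (Pr : MeasureTheory.Measure Ω)
              [MeasureTheory.IsProbabilityMeasure Pr] (X : ℕ → Ω → S × A),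
              M.IsTrajectory Pr X →
              MeasureTheory.Integrable
                (fun ω => ‖M.qfun (M.outer α K θ₀ (fun n => X n ω) t - θs)‖ ^ 2) Pr ∧
              ∫ ω, ‖M.qfun (M.outer α K θ₀ (fun n => X n ω) t - θs)‖ ^ 2 ∂Pr ≤ ε) ∧
          0 < M.alphaBar d z₀ Rm θs ε ∧
          ∃ K t : ℕ,
            C / (M.mu d * M.alphaBar d z₀ Rm θs ε) * M.logK d θs θ₀ ε ≤ K ∧
            (K : ℝ) ≤ C' * M.orderK d z₀ Rm θs ε * M.logK d θs θ₀ ε ∧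
            C / (1 - M.contr d) * M.logT θs θ₀ ε ≤ t ∧
            (t : ℝ) ≤ C' / (1 - M.contr d) * M.logT θs θ₀ ε := by
  refine ⟨16, 600, by norm_num, by norm_num, ?_⟩
  intro S A _ _ _ _ _ _ h M Rm d z₀ hφ hRm hr hirr hd hx
  classical
  have : Nonempty A := ⟨z₀.2⟩
  have g := M.green hirr hd z₀
  refine ⟨M.existsUnique_isRPBESolution hx, fun θs θ₀ ε hs hε => ?_⟩
  have hμ := M.mu_pos hφ g.d_nonneg g.d_sum
  have hμℓ := M.mu_le_ell hφ g.d_nonneg g.d_sum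
  have hℓ := M.ell_le hφ g.d_nonneg g.d_sum
  have hT := g.one_le
  have hx0 := M.contr_nonneg (d := d)
  have hw : 0 < 1 - M.contr d := by linarith
  have hO := M.orderK_ge (θs := θs) (ε := ε) hμ hμℓ hℓ hT hRm
  have hOα := M.le_orderK_mul_alphaBar (θs := θs) hμ hμℓ hℓ hx hT hRm hε
  have hc : 0 < 32 * M.mu d * M.orderK d z₀ Rm θs ε := mul_pos (by linarith) (by linarith)
  -- Positivity of the threshold is read off from its product with a positive number being at least
  -- 1.
  have hbar : 0 < M.alphaBar d z₀ Rm θs ε :=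
    pos_of_mul_pos_right (lt_of_lt_of_le one_pos hOα) hc.le
  refine ⟨fun α K t hα hle hK ht Ω _ Pr _ X hX => ⟨?_, ?_⟩, hbar, ?_⟩
  · exact M.integrable_outer hX α K θ₀ t fun θ _ => ‖M.qfun (θ - θs)‖ ^ 2
  · have hle₂ := (hle.trans (min_le_left _ _)).trans (min_le_right _ _)
    have hle₃ := (hle.trans (min_le_right _ _)).trans (min_le_left _ _)
    have hle₄ := (hle.trans (min_le_right _ _)).trans (min_le_right _ _)
    obtain ⟨h1, h2⟩ := M.step_bounds_of_le_alpha₂ hμ hμℓ hT hRm.le hα hle₂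
    exact M.integral_outer_le g hφ hRm.le hr hx hs hε hα h1 h2
      (M.step_bound_of_le_alpha₃ hμ hμℓ hT hRm.le hα hle₃)
      (M.step_bound_of_le_alpha₄ hμ hμℓ hT hRm hε hα hle₄) θ₀ hK ht hX
  · have hlK := M.one_half_le_logK hμ hx θs θ₀ hε
    have hlT := M.one_half_le_logT θs θ₀ hε
    refine ⟨_, _, Nat.le_ceil _, ?_, Nat.le_ceil _, ?_⟩
    · have e1 : 16 / (M.mu d * M.alphaBar d z₀ Rm θs ε) ≤ 512 * M.orderK d z₀ Rm θs ε := by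
        rw [div_le_iff₀ (by positivity)]
        linarith
      have e2 := mul_le_mul_of_nonneg_right e1 (by linarith : 0 ≤ M.logK d θs θ₀ ε)
      -- `orderK` times the logarithm is at least 6, so the 1 lost in rounding up fits between 512 =
      -- 16 · 32 and 600.
      have e3 := mul_le_mul hO hlK (by norm_num) (by linarith)
      refine (Nat.ceil_lt_add_one (by positivity)).le.trans ?_
      linarith
    · have e1 : 1 / 2 ≤ M.logT θs θ₀ ε / (1 - M.contr d) := by
        rw [le_div_iff₀ hw]
        linarith
      refine (Nat.ceil_lt_add_one (by positivity)).le.trans ?_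
      rw [div_mul_eq_mul_div, div_mul_eq_mul_div, mul_div_assoc, mul_div_assoc]
      linarith
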